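/- **Setting.** Let $G$ be a group with a unitary representation $U$ on the local space $\mathbb C^d$. For every ring length $L\ge 1$ a tensor $\mathbb A^{ij}\in M_\chi(\mathbb C)$ ($\chi\ge1$) gives the operator $\rho_L=\sum \mathrm{tr}(\mathbb A^{i_1j_1}\cdots\mathbb A^{i_Lj_L})\,|i_1\dots i_L\rangle\langle j_1\dots j_L|$. States are considered up to a positive normalization factor. $\rho$ is a *strong injective MPDO* if all $\rho_L$ are positive semidefinite, $X\mapsto(\sum_{\alpha\beta}\mathbb A^{ij}_{\alpha\beta}X_{\alpha\beta})_{ij}$ is injective, and $\sum_i\mathbb A^{ii}$ has a real eigenvalue of multiplicity one that exceeds the modulus of every other eigenvalue. It has *strong symmetry* $G$ if $U_g^{\otimes L}\rho_L=e^{i\theta}\rho_L$ and $\rho_L (U_g^{\otimes L})^\dagger=e^{-i\theta}\rho_L$ for all $g$ and $L$, with phases $\theta=\theta(g,L)$. An injective tensor $A$ with an onsite action $R$ of a group $H$ is in class $[\omega]\in H^2(H,U(1))$ if $\sum_j R(g)_{ij}A^j=c(g)\,V_g^{-1}A^iV_g$ with phases $c(g)$ and invertible $V_g$ with $V_gV_h=\omega'(g,h)V_{gh}$,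 $[\omega']=[\omega]$. A *pure SPT state in class* $[\omega]$ is a symmetric matrix product state with injective tensor in class $[\omega]$. The MPDO $\rho$ is in the *mixed-state SPT phase* $[\omega]\in H^2(G,U(1))$ if its doubled state (physical index $(i,j)$, $(g,h)\in G\times G$ acting as $U_g\otimes \overline{U_h}$) is in the class of $\omega(g,g')\,\overline{\omega(h,h')}$. A *local purification* of $\rho$ is a matrix product state $\Psi_{QE}$ with tensor $A^{ik}$ ($k$ labels the ancilla) such that, in a suitable gauge of the virtual space, $\mathbb A^{ij}=\sum_kA^{ik}\otimes (A^{jk})^*$; $G$ acts on it by $U_g\otimes 1$. A quantum channel with Kraus operators $K_k$ is *non-degenerate* if it is injective on operators, and *strongly symmetric* if $U'_gK_kU_g^\dagger=e^{i\theta_g}K_k$ with a phase independent of $k$, where $U$ and $U'$ are the representations on input and output. **Theorem.** Let $\rho$ be a strong injective MPDO with strong symmetry $G$, and let $\omega$ be a $U(1)$-valued 2-cocycle of $G$. The following are equivalent: 1. $\rho$ is in the mixed-state SPT phase $[\omega]$ and has a local purification; 2. $\rho$ has a local purification that is a pure SPT state in class $[\omega]$ ($G$ acting trivially on the ancilla);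 3. $\rho$ has a local purification, and every local purification of $\rho$ is a pure SPT state in class $[\omega]$; 4. $\rho_L\propto\mathcal N^{\otimes L}(|\Psi_L\rangle\langle\Psi_L|)$ for all $L\ge1$, for some pure SPT state $\Psi$ in class $[\omega]$ (on a possibly different local space) and some strongly symmetric non-degenerate onsite channel $\mathcal N$. **Consequence.** On the set of all strong injective MPDOs with strong symmetry $G$ that have a local purification (for all local spaces and representations), consider the equivalence relation generated by * the one-way connection: $\rho'=\mathcal N[\rho]$ or $\rho=\mathcal N[\rho']$, on all rings of even length, where $\mathcal N$ is a brickwork circuit of two-site strongly symmetric non-degenerate channels whose depth does not depend on the length; and * the standard equivalence of pure states: $\rho=|\Psi[A_0]\rangle\langle\Psi[A_0]|$ and $\rho'=|\Psi[A_1]\rangle\langle\Psi[A_1]|$ for a continuous path $(A_s)_{s\in[0,1]}$ of tensors of symmetric injective matrix product states. Every such $\rho$ is in exactly one phase $[\omega]\in H^2(G,U(1))$, and two of them are equivalent if and only if they are in the same phase. If $G$ is finite, every class in $H^2(G,U(1))$ occurs, so the equivalence classes are in bijection with $H^2(G,U(1))$. -/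

import Mathlib

open scoped Kronecker ComplexOrder

noncomputable section

namespace SPT

/-! ### Group cohomology with coefficients in `U(1)` -/

/-- `U(1)` (written additively) as a `G`-module with trivial action. -/
abbrev U1 (G : Type) [Group G] : Rep ℤ G := Rep.trivial ℤ G (Additive Circle)

/-- `U(1)`-valued 2-cocycles of `G`. -/
abbrev Z2 (G : Type) [Group G] : Type := groupCohomology.cocycles₂ (U1 G)

/-- The second cohomology group `H²(G, U(1))`. -/
abbrev H2 (G : Type) [Group G] : Type := groupCohomology.H2 (U1 G)

variable {G : Type} [Group G]

/-- The cohomology class `[ω]`. -/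
def cohClass (ω : Z2 G) : H2 G := groupCohomology.H2π (U1 G) ω

/-- The phase `ω(g, h)` as a complex number. -/
def phase (ω : Z2 G) (g h : G) : ℂ := ((Additive.toMul (ω (g, h) : Additive Circle) : Circle) : ℂ)

/-- The 2-cocycle `((g, g'), (h, h')) ↦ ω(g, h) ω(g', h')⁻¹` of `G × G`. Its class has the
components `[ω]` on the left factor, `-[ω]` on the right factor, and no mixed component. -/
def doubledCocycle (ω : Z2 G) : Z2 (G × G) :=
  ⟨fun p => (ω (p.1.1, p.2.1) : Additive Circle) - (ω (p.1.2, p.2.2) : Additive Circle), by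
    rw [groupCohomology.mem_cocycles₂_iff]
    intro g h j
    have h1 := (groupCohomology.mem_cocycles₂_iff (A := U1 G) ω.1).1 ω.2 g.1 h.1 j.1
    have h2 := (groupCohomology.mem_cocycles₂_iff (A := U1 G) ω.1).1 ω.2 g.2 h.2 j.2
    have e1 : (ω (g.1 * h.1, j.1) : Additive Circle) + ω (g.1, h.1)
        = ω (h.1, j.1) + ω (g.1, h.1 * j.1) := h1
    have e2 : (ω (g.2 * h.2, j.2) : Additive Circle) + ω (g.2, h.2)
        = ω (h.2, j.2) + ω (g.2, h.2 * j.2) := h2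
    change ((ω (g.1 * h.1, j.1) : Additive Circle) - ω (g.2 * h.2, j.2))
        + ((ω (g.1, h.1) : Additive Circle) - ω (g.2, h.2))
      = ((ω (h.1, j.1) : Additive Circle) - ω (h.2, j.2))
        + ((ω (g.1, h.1 * j.1) : Additive Circle) - ω (g.2, h.2 * j.2))
    rw [sub_add_sub_comm, sub_add_sub_comm, e1, e2]⟩

/-! ### Operators on a ring of sites -/

/-- The product operator `⨂ₓ K x` on a chain of `L` sites. -/
def tensorOp {L : ℕ} {a b : Type} (K : Fin L → Matrix b a ℂ) :
    Matrix (Fin L → b) (Fin L → a) ℂ :=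
  Matrix.of fun s t => ∏ x, K x (s x) (t x)

/-- `X` and `Y` are the same state up to normalization. -/
def SameState {n : Type} (X Y : Matrix n n ℂ) : Prop :=
  ∃ r : ℝ, 0 < r ∧ X = (r : ℂ) • Y

/-- `X ↦ ∑ₖ Kₖ X Kₖ†`. -/
def krausMap {κ a b : Type} [Fintype κ] [Fintype a] (K : κ → Matrix b a ℂ)
    (X : Matrix a a ℂ) : Matrix b b ℂ :=
  ∑ k, K k * X * (K k).conjTranspose

/-- The Kraus operators `K` define a (trace preserving) quantum channel that is non-degenerate
(injective on operators) and strongly symmetric, where `G` acts by `R` on the input and by `R'` on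
the output: `R'(g) Kₖ R(g)† = e^{iθ(g)} Kₖ`, with the same phase for all Kraus operators. -/
structure IsSymNondegChannel {κ a b : Type} [Fintype κ] [Fintype a] [Fintype b] [DecidableEq a]
    (R : G → Matrix a a ℂ) (R' : G → Matrix b b ℂ) (K : κ → Matrix b a ℂ) : Prop where
  tracePreserving : ∑ k, (K k).conjTranspose * K k = 1
  nondegenerate : Function.Injective (krausMap K)
  stronglySymmetric : ∃ θ : G → Circle, ∀ g k,
    R' g * K k * (R g).conjTranspose = (θ g : ℂ) • K k

/-- The onsite channel `N ⊗ ⋯ ⊗ N` on `L` sites, where `N` has the Kraus operators `K`. -/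
def onsiteChannel {κ a b : Type} [Fintype κ] [Fintype a] (K : κ → Matrix b a ℂ) (L : ℕ)
    (X : Matrix (Fin L → a) (Fin L → a) ℂ) : Matrix (Fin L → b) (Fin L → b) ℂ :=
  krausMap (fun k : Fin L → κ => tensorOp fun x => K (k x)) X

/-! ### Injective matrix product states -/

/-- The unnormalized periodic matrix product state on `L` sites with local tensor `A`. -/
def mps {ι : Type} {D : ℕ} (A : ι → Matrix (Fin D) (Fin D) ℂ) (L : ℕ) : (Fin L → ι) → ℂ :=
  fun s => (List.ofFn fun x => A (s x)).prod.trace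

/-- The (unnormalized) density matrix `|Ψ⟩⟨Ψ|` of the matrix product state. -/
def mpsDensity {ι : Type} {D : ℕ} (A : ι → Matrix (Fin D) (Fin D) ℂ) (L : ℕ) :
    Matrix (Fin L → ι) (Fin L → ι) ℂ :=
  Matrix.vecMulVec (mps A L) (star (mps A L))

/-- The tensor is injective as a map from the virtual to the physical space. -/
def InjectiveTensor {ι : Type} {D : ℕ} (A : ι → Matrix (Fin D) (Fin D) ℂ) : Prop :=
  Function.Injective fun (X : Matrix (Fin D) (Fin D) ℂ) (i : ι) => ∑ α, ∑ β, A i α β * X α β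

/-- Under the onsite action `R` of `H`, the tensor transforms as
`∑ⱼ R(g)ᵢⱼ Aʲ = c(g) V(g)⁻¹ Aⁱ V(g)`, where `V` is a projective representation on the virtual
space whose 2-cocycle lies in the class `[ω]`. The phase `c(g)` is the phase per site that the
state acquires. -/
def HasSPTClass {H : Type} [Group H] {ι : Type} [Fintype ι] {D : ℕ}
    (A : ι → Matrix (Fin D) (Fin D) ℂ) (R : H → Matrix ι ι ℂ) (ω : Z2 H) : Prop :=
  ∃ (V : H → (Matrix (Fin D) (Fin D) ℂ)ˣ) (c : H → Circle) (ω' : Z2 H),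
    (∀ g i, ∑ j, R g i j • A j = (c g : ℂ) • (((V g)⁻¹ : (Matrix (Fin D) (Fin D) ℂ)ˣ).val
      * A i * (V g).val)) ∧
    (∀ g h, (V g).val * (V h).val = phase ω' g h • (V (g * h)).val) ∧
    cohClass ω' = cohClass ω

/-- The matrix product state is symmetric under the onsite action `R`, up to a phase. -/
def SymmetricMPS {H : Type} {ι : Type} [Fintype ι] {D : ℕ}
    (A : ι → Matrix (Fin D) (Fin D) ℂ) (R : H → Matrix ι ι ℂ) : Prop :=
  ∀ L : ℕ, 0 < L → ∀ g, ∃ θ : Circle,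
    (tensorOp fun _ : Fin L => R g).mulVec (mps A L) = (θ : ℂ) • mps A L

/-- `A` is the tensor of an injective, symmetric matrix product state in the SPT phase `[ω]`. -/
structure IsPureSPT {ι : Type} [Fintype ι] {D : ℕ}
    (A : ι → Matrix (Fin D) (Fin D) ℂ) (R : G → Matrix ι ι ℂ) (ω : Z2 G) : Prop where
  bond_pos : 0 < D
  injective : InjectiveTensor A
  symmetric : SymmetricMPS A R
  sptClass : HasSPTClass A R ω

/-! ### Matrix product density operators -/

/-- The data of a translation invariant matrix product operator: a unitary representation `U` of
`G` on the local space `ℂ^d`, a bond dimension `χ`, and the local tensor `𝔸^{ij}`. The conditions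
that make it a density operator are in `IsStrongInjectiveMPDO`. -/
structure MPO (G : Type) [Group G] where
  d : ℕ
  U : G →* Matrix.unitaryGroup (Fin d) ℂ
  χ : ℕ
  tensor : Fin d → Fin d → Matrix (Fin χ) (Fin χ) ℂ

namespace MPO

variable (ρ : MPO G)

/-- The representation matrix `U_g` on one site. -/
def rep (g : G) : Matrix (Fin ρ.d) (Fin ρ.d) ℂ := (ρ.U g).val

/-- The operator `ρ` on a ring of `L` sites. -/
def state (L : ℕ) : Matrix (Fin L → Fin ρ.d) (Fin L → Fin ρ.d) ℂ :=
  Matrix.of fun s t => (List.ofFn fun x => ρ.tensor (s x) (t x)).prod.trace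

/-- The tensor of the doubled state: ket and bra indices form one physical index. -/
def doubledTensor : Fin ρ.d × Fin ρ.d → Matrix (Fin ρ.χ) (Fin ρ.χ) ℂ :=
  fun p => ρ.tensor p.1 p.2

/-- The action of `(g, h)` on one site of the doubled state: `U_g` on the ket and the complex
conjugate of `U_h` on the bra. -/
def doubledRep (p : G × G) : Matrix (Fin ρ.d × Fin ρ.d) (Fin ρ.d × Fin ρ.d) ℂ :=
  ρ.rep p.1 ⊗ₖ (ρ.rep p.2).map star

/-- The transfer matrix `∑ᵢ 𝔸^{ii}`. -/
def transfer : Matrix (Fin ρ.χ) (Fin ρ.χ) ℂ := ∑ i, ρ.tensor i i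

/-- `ρ` is a density operator (up to normalization) for every system size, and it is strong
injective: the tensor of the doubled state is injective, and the transfer matrix has a real
eigenvalue of multiplicity one that is larger than the modulus of every other eigenvalue. -/
structure IsStrongInjectiveMPDO : Prop where
  bond_pos : 0 < ρ.χ
  posSemidef : ∀ L : ℕ, 0 < L → (ρ.state L).PosSemidef
  injective : InjectiveTensor ρ.doubledTensor
  uniqueLargest : ∃ lam : ℝ, ρ.transfer.charpoly.rootMultiplicity (lam : ℂ) = 1 ∧
    ∀ μ : ℂ, ρ.transfer.charpoly.IsRoot μ → μ ≠ (lam : ℂ) → ‖μ‖ < lam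

/-- Strong symmetry: `U_g ρ = e^{iθ} ρ` and `ρ U_g† = e^{-iθ} ρ`. -/
def StronglySymmetric : Prop :=
  ∀ L : ℕ, 0 < L → ∀ g, ∃ θ : Circle,
    (tensorOp fun _ : Fin L => ρ.rep g) * ρ.state L = (θ : ℂ) • ρ.state L ∧
    ρ.state L * (tensorOp fun _ : Fin L => ρ.rep g).conjTranspose
      = ((θ⁻¹ : Circle) : ℂ) • ρ.state L

/-- `ρ` is in the mixed-state SPT phase `[ω]`: the doubled state, as a matrix product state with
symmetry `G × G` (ket and bra), is in the class `([ω], -[ω], 0)`. -/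
def InPhase (ω : Z2 G) : Prop :=
  HasSPTClass ρ.doubledTensor ρ.doubledRep (doubledCocycle ω)

/-- `A` is the tensor of a local purification of `ρ` (physical index: system, ancilla): in a
suitable gauge of the virtual space, `𝔸^{ij} = ∑ₖ A^{ik} ⊗ (A^{jk})*`. -/
def IsLocalPurification {e D : ℕ} (A : Fin ρ.d × Fin e → Matrix (Fin D) (Fin D) ℂ) : Prop :=
  ∃ (X : Matrix (Fin D × Fin D) (Fin ρ.χ) ℂ) (Y : Matrix (Fin ρ.χ) (Fin D × Fin D) ℂ),
    X * Y = 1 ∧ Y * X = 1 ∧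
    ∀ i j, X * ρ.tensor i j * Y = ∑ k, A (i, k) ⊗ₖ (A (j, k)).map star

def LocallyPurifiable : Prop :=
  ∃ (e D : ℕ) (A : Fin ρ.d × Fin e → Matrix (Fin D) (Fin D) ℂ), ρ.IsLocalPurification A

/-- The action of `G` on system and ancilla that is trivial on the ancilla. -/
def purifiedRep (e : ℕ) (g : G) : Matrix (Fin ρ.d × Fin e) (Fin ρ.d × Fin e) ℂ :=
  ρ.rep g ⊗ₖ (1 : Matrix (Fin e) (Fin e) ℂ)

/-- `ρ` is the image of a pure SPT state in class `[ω]` under a strongly symmetric non-degenerate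
onsite channel. -/
def FromPureSPT (ω : Z2 G) : Prop :=
  ∃ (m D e : ℕ) (U' : G →* Matrix.unitaryGroup (Fin m) ℂ)
    (B : Fin m → Matrix (Fin D) (Fin D) ℂ) (K : Fin e → Matrix (Fin ρ.d) (Fin m) ℂ),
    IsPureSPT B (fun g => (U' g).val) ω ∧
    IsSymNondegChannel (fun g => (U' g).val) ρ.rep K ∧
    ∀ L : ℕ, 0 < L → SameState (ρ.state L) (onsiteChannel K L (mpsDensity B L))

end MPO

/-! ### Local channel circuits and the one-way connection -/

/-- First site of the `x`-th pair in layer `t` of a brickwork circuit on a ring of `2M` sites: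
even layers couple the sites `(2x, 2x+1)`, odd layers `(2x+1, 2x+2)`. -/
def pairFst {M : ℕ} (t : ℕ) (x : Fin M) : Fin (2 * M) :=
  ⟨2 * x.val + t % 2, by have := x.isLt; have := Nat.mod_lt t (by norm_num : 0 < 2); omega⟩

/-- Second site of the `x`-th pair in layer `t`. -/
def pairSnd {M : ℕ} (t : ℕ) (x : Fin M) : Fin (2 * M) :=
  ⟨(2 * x.val + t % 2 + 1) % (2 * M), Nat.mod_lt _ (by have := x.isLt; omega)⟩

/-- One layer of a brickwork circuit: on the `x`-th pair of sites acts the channel with Kraus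
operators `K x`. -/
def layerChannel {M e d d' : ℕ} (t : ℕ)
    (K : Fin M → Fin e → Matrix (Fin d' × Fin d') (Fin d × Fin d) ℂ)
    (X : Matrix (Fin (2 * M) → Fin d) (Fin (2 * M) → Fin d) ℂ) :
    Matrix (Fin (2 * M) → Fin d') (Fin (2 * M) → Fin d') ℂ :=
  krausMap (fun k : Fin M → Fin e => Matrix.of fun s r =>
    ∏ x, K x (k x) (s (pairFst t x), s (pairSnd t x)) (r (pairFst t x), r (pairSnd t x))) X

/-- The action of `G` on two sites. -/
def pairRep {d : ℕ} (U : G →* Matrix.unitaryGroup (Fin d) ℂ) (g : G) :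
    Matrix (Fin d × Fin d) (Fin d × Fin d) ℂ :=
  (U g).val ⊗ₖ (U g).val

/-- `BrickworkImage U₀ X₀ t d U X`: on a ring of `2M` sites, a brickwork circuit of depth `t` made
of strongly symmetric non-degenerate two-site channels maps `X₀` to `X`. The local space and the
representation may change from layer to layer; onsite channels are the circuits of depth one
whose gates are products. -/
inductive BrickworkImage {M d₀ : ℕ} (U₀ : G →* Matrix.unitaryGroup (Fin d₀) ℂ)
    (X₀ : Matrix (Fin (2 * M) → Fin d₀) (Fin (2 * M) → Fin d₀) ℂ) :
    ℕ → (d : ℕ) → (G →* Matrix.unitaryGroup (Fin d) ℂ) →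
      Matrix (Fin (2 * M) → Fin d) (Fin (2 * M) → Fin d) ℂ → Prop
  | nil : BrickworkImage U₀ X₀ 0 d₀ U₀ X₀
  | layer {t d d' e : ℕ} {U : G →* Matrix.unitaryGroup (Fin d) ℂ}
      {X : Matrix (Fin (2 * M) → Fin d) (Fin (2 * M) → Fin d) ℂ}
      (U' : G →* Matrix.unitaryGroup (Fin d') ℂ)
      (K : Fin M → Fin e → Matrix (Fin d' × Fin d') (Fin d × Fin d) ℂ)
      (hX : BrickworkImage U₀ X₀ t d U X)
      (hK : ∀ x, IsSymNondegChannel (pairRep U) (pairRep U') (K x)) :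
      BrickworkImage U₀ X₀ (t + 1) d' U' (layerChannel t K X)

/-- `ρ' = 𝒩[ρ]` for a strongly symmetric non-degenerate local channel `𝒩`, that is, a brickwork
circuit whose depth does not depend on the system size. -/
def MapsTo (ρ ρ' : MPO G) : Prop :=
  ∃ t : ℕ, ∀ M : ℕ, 0 < M → ∃ Y, BrickworkImage ρ.U (ρ.state (2 * M)) t ρ'.d ρ'.U Y ∧
    SameState (ρ'.state (2 * M)) Y

/-- The matrix product operator `|Ψ[A]⟩⟨Ψ[A]|`, with tensor `A^i ⊗ (A^j)*`. -/
def pureMPO {d D : ℕ} (U : G →* Matrix.unitaryGroup (Fin d) ℂ)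
    (A : Fin d → Matrix (Fin D) (Fin D) ℂ) : MPO G where
  d := d
  U := U
  χ := D * D
  tensor := fun i j => Matrix.reindex finProdFinEquiv finProdFinEquiv (A i ⊗ₖ (A j).map star)

/-- `ρ` and `ρ'` are pure states that are connected by a continuous path of symmetric injective
matrix product states. -/
def PureDeformation (ρ ρ' : MPO G) : Prop :=
  ∃ (d D : ℕ) (U : G →* Matrix.unitaryGroup (Fin d) ℂ)
    (A : unitInterval → Fin d → Matrix (Fin D) (Fin D) ℂ),
    Continuous A ∧
    (∀ s, InjectiveTensor (A s) ∧ SymmetricMPS (A s) fun g => (U g).val) ∧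
    ρ = pureMPO U (A 0) ∧ ρ' = pureMPO U (A 1)

/-- Strongly symmetric, strong injective MPDOs that have a local purification. -/
def PurifiableMPDO (G : Type) [Group G] : Type :=
  {ρ : MPO G // ρ.IsStrongInjectiveMPDO ∧ ρ.StronglySymmetric ∧ ρ.LocallyPurifiable}

/-- The equivalence relation generated by the one-way connection (`ρ' = 𝒩[ρ]` or `ρ = 𝒩[ρ']`)
together with the deformation of pure states. -/
def oneWaySetoid (G : Type) [Group G] : Setoid (PurifiableMPDO G) :=
  Relation.EqvGen.setoid fun ρ ρ' =>
    MapsTo ρ.1 ρ'.1 ∨ MapsTo ρ'.1 ρ.1 ∨ PureDeformation ρ.1 ρ'.1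

end SPT

end

/-!
Injectivity of a tensor is used in the form that its matrices span the full matrix algebra (`Spans`).
Up to scalars, the states of such a tensor on two and three sites are the trace form and the structure
constants of that algebra, so by Skolem–Noether the states determine the tensor up to conjugation
(`exists_conj_of_trace_eq`). Everything about gauge transformations and classes follows from this.

**Equivalence of the four descriptions.** If `ρ = Ψ Ψ†`, then `(U - e^{iθ}) Ψ Ψ† = 0` forces
`(U - e^{iθ}) Ψ = 0`, so strong symmetry passes to every local purification
(`MPO.IsLocalPurification.symmetric`). Injectivity passes as well (`spans_of_spans_kronecker`), and so
every local purification has a class. With virtual symmetries `V(g)` for the purification, the doubled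
tensor has `V(g) ⊗ V(h)*`, so the class of the purification is the phase of `ρ`
(`MPO.IsLocalPurification.inPhase`), which is unique (`MPO.InPhase.unique`). The polar decomposition
`A = W B` of a purification into an isometry `W` and a bijection `B` from the virtual to the physical
space exhibits `ρ` as the image of the pure state of `B` under the channel that applies `W` and traces
out the ancilla; this channel is non-degenerate because the doubled tensor is injective
(`MPO.IsLocalPurification.exists_channel`). Conversely, the Kraus index of a non-degenerate channel is
the ancilla of a purification (`MPO.FromPureSPT.exists_purification`).

**The class is an invariant of the equivalence relation.** On the doubled state, the symmetry of the
ket index truncated to a long interval acts as a product of two operators near the ends of the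
interval, and the operators at one end compose projectively, with the cocycle `ω` (`HasStrings`). Gates
of a brickwork circuit of non-degenerate channels are injective on operators, so each layer transports
such a pair of operators, with supports that grow by one site (`HasStrings.brickwork`). For an injective
tensor, truncated symmetries of this kind can only be insertions of the virtual symmetries
(`insert_of_insert_insert`), so they determine the class, and one-way connected states have the same
class (`MapsTo.cohClass_eq`). Along a path of pure states, virtual symmetries of determinant one are
unique up to roots of unity and depend continuously on the parameter up to these. Their products
differ from the virtual symmetries of the products by roots of unity, which cannot jump, so the class
is locally constant, uniformly over a possibly infinite group (`eventually_cohClass_eq`).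

**States with the same class are equivalent.** The positive definite eigenvector of the completely
positive map `X ↦ ∑ Aⁱ X Aⁱ†` provides a gauge in which the virtual symmetry is unitary
(`Spans.exists_unitary_gauge`), and `ρ` is the image of a pure state in this gauge
(`PurifiableMPDO.exists_gauge`). Two pure states with the same virtual symmetry are embedded in the
direct sum of their local spaces, where the segment between them is a path of symmetric injective
tensors (`IsGauge.related`). It remains to change the virtual symmetry. For projective representations
`V` and `V'` with cocycle `ω`, both summands of `V ⊕ V'` define states in which each site carries a
virtual index on either side, and neighbouring sites share entangled pairs (`bondTensor`). The bond
states of the two summands are orthogonal invariant vectors of `(V ⊕ V') ⊗ (V ⊕ V')*`, which are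
exchanged by an invariant reflection. Reflections on all bonds form a circuit of depth two, which
connects the two states (`mapsTo_bondTensor`). For a finite group, the regular projective representation
realizes every class in this way (`phaseClass_surjective`).
-/

open scoped Kronecker ComplexOrder

noncomputable section

namespace SPT

/-! ### Injective tensors and the fundamental theorem -/

/-- The matrices of the tensor span the full matrix algebra; `injectiveTensor_iff_spans` identifies
this with injectivity. -/
def Spans {ι n : Type} (A : ι → Matrix n n ℂ) : Prop :=
  Submodule.span ℂ (Set.range A) = ⊤

theorem injectiveTensor_iff_spans {ι : Type} {D : ℕ} (A : ι → Matrix (Fin D) (Fin D) ℂ) :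
    InjectiveTensor A ↔ Spans A := by
  constructor
  · intro h
    by_contra hne
    obtain ⟨f, hf, hle⟩ := Submodule.exists_le_ker_of_lt_top _ (lt_top_iff_ne_top.2 hne)
    apply hf
    have key : ∀ M : Matrix (Fin D) (Fin D) ℂ, f M = ∑ α, ∑ β, M α β * f (Matrix.single α β 1) := by
      intro M
      conv_lhs => rw [Matrix.matrix_eq_sum_single M]
      simp only [map_sum]
      refine Finset.sum_congr rfl fun α _ => Finset.sum_congr rfl fun β _ => ?_
      have : Matrix.single α β (M α β) = M α β • Matrix.single α β (1 : ℂ) := by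
        simp [Matrix.smul_single]
      rw [this, map_smul, smul_eq_mul]
    have h0 : (Matrix.of fun α β => f (Matrix.single α β 1) : Matrix (Fin D) (Fin D) ℂ) = 0 := by
      apply h
      funext i
      have : f (A i) = 0 := hle (Submodule.subset_span ⟨i, rfl⟩)
      rw [key] at this
      simpa using this
    ext M
    rw [key]
    have h1 : ∀ α β, f (Matrix.single α β 1) = 0 := fun α β => congrFun (congrFun h0 α) β
    simp [h1]
  · intro h X Y hXY
    let f : Matrix (Fin D) (Fin D) ℂ →ₗ[ℂ] ℂ :=
      { toFun := fun M => ∑ α, ∑ β, M α β * (X α β - Y α β)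
        map_add' := fun M N => by simp [add_mul, Finset.sum_add_distrib]
        map_smul' := fun c M => by simp [Finset.mul_sum, mul_assoc] }
    have hf : f = 0 := by
      apply LinearMap.ext_on_range h
      intro i
      have := congrFun hXY i
      simp only [f, LinearMap.coe_mk, AddHom.coe_mk, mul_sub, Finset.sum_sub_distrib,
        LinearMap.zero_apply]
      exact sub_eq_zero.2 this
    ext α β
    have := LinearMap.congr_fun hf (Matrix.single α β 1)
    simp only [f, LinearMap.coe_mk, AddHom.coe_mk, LinearMap.zero_apply] at this
    rw [Finset.sum_eq_single α, Finset.sum_eq_single β] at this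
    · simpa [sub_eq_zero] using this
    · intro b _ hb; simp [Matrix.single, hb.symm]
    · simp
    · intro b _ hb; simp [Matrix.single, hb.symm]
    · simp

/-- Every family of matrices is a linear combination of the matrices of an injective tensor. -/
theorem Spans.exists_coeff {ι κ n : Type} [Fintype ι] {A : ι → Matrix n n ℂ} (hA : Spans A)
    (T : κ → Matrix n n ℂ) : ∃ O : Matrix κ ι ℂ, ∀ i, ∑ j, O i j • A j = T i := by
  have : ∀ i, ∃ c : ι → ℂ, ∑ j, c j • A j = T i := fun i =>
    (Submodule.mem_span_range_iff_exists_fun ℂ).1 (by rw [hA]; trivial)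
  choose O hO using this
  exact ⟨Matrix.of O, hO⟩

theorem Spans.ext {ι n M : Type} [AddCommGroup M] [Module ℂ M]
    {A : ι → Matrix n n ℂ} (hA : Spans A) {f g : Matrix n n ℂ →ₗ[ℂ] M}
    (h : ∀ i, f (A i) = g (A i)) : f = g :=
  LinearMap.ext_on_range hA h

/-- A matrix commuting with an injective tensor is scalar. -/
theorem Spans.eq_smul_one {ι n : Type} [Fintype n] [DecidableEq n] [Nonempty n]
    {A : ι → Matrix n n ℂ} (hA : Spans A) {X : Matrix n n ℂ} (h : ∀ i, X * A i = A i * X) :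
    ∃ c : ℂ, X = c • 1 := by
  have e : LinearMap.mulLeft ℂ X = LinearMap.mulRight ℂ X := hA.ext fun i => by simpa using h i
  obtain ⟨c, hc⟩ := Matrix.mem_range_scalar_of_commute_single (M := X) fun i j _ => by
    have := LinearMap.congr_fun e (Matrix.single i j 1)
    exact (by simpa using this.symm : Matrix.single i j 1 * X = X * Matrix.single i j 1)
  exact ⟨c, by rw [← hc, Matrix.scalar_apply, Matrix.smul_one_eq_diagonal]⟩

/-- Algebra isomorphisms between matrix algebras are inner (Skolem–Noether). -/
theorem algEquiv_eq_conj {n m : Type} [Fintype n] [Fintype m] [DecidableEq n] [DecidableEq m]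
    (f : Matrix n n ℂ ≃ₐ[ℂ] Matrix m m ℂ) :
    ∃ (X : Matrix m n ℂ) (Y : Matrix n m ℂ), X * Y = 1 ∧ Y * X = 1 ∧ ∀ M, f M = X * M * Y := by
  obtain ⟨T, hT⟩ := AlgEquiv.eq_linearEquivConjAlgEquiv
    ((Matrix.toLinAlgEquiv'.symm.trans f).trans Matrix.toLinAlgEquiv')
  refine ⟨LinearMap.toMatrix' T.toLinearMap, LinearMap.toMatrix' T.symm.toLinearMap, ?_, ?_, ?_⟩
  · rw [← LinearMap.toMatrix'_comp]; simp
  · rw [← LinearMap.toMatrix'_comp]; simp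
  · intro M
    have := AlgEquiv.congr_fun hT (Matrix.toLinAlgEquiv' M)
    simp only [AlgEquiv.trans_apply, AlgEquiv.symm_apply_apply, LinearEquiv.conjAlgEquiv_apply]
      at this
    apply Matrix.toLinAlgEquiv'.injective
    rw [this]
    refine LinearMap.ext fun v => ?_
    simp [Matrix.toLinAlgEquiv'_apply, ← Matrix.mulVec_mulVec, LinearMap.toMatrix'_mulVec]

/-- Fundamental theorem of injective matrix product states. Two injective tensors whose states on
two and three sites agree up to scalars are related by a gauge transformation and a scalar: up to
normalization, `A i ↦ B i` extends to an isomorphism of matrix algebras. -/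
theorem exists_conj_of_trace_eq {ι n m : Type} [Fintype ι] [Fintype n] [Fintype m] [DecidableEq n]
    [DecidableEq m] {A : ι → Matrix n n ℂ} {B : ι → Matrix m m ℂ} (hA : Spans A) (hB : Spans B)
    {t₂ t₃ : ℂ} (h₂ : t₂ ≠ 0) (h₃ : t₃ ≠ 0)
    (e₂ : ∀ i j, (B i * B j).trace = t₂ * (A i * A j).trace)
    (e₃ : ∀ i j k, (B i * B j * B k).trace = t₃ * (A i * A j * A k).trace) :
    ∃ (X : Matrix m n ℂ) (Y : Matrix n m ℂ), X * Y = 1 ∧ Y * X = 1 ∧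
      ∀ i, B i = (t₃ / t₂) • (X * A i * Y) := by
  have surj : ∀ {k : Type} [Fintype k] [DecidableEq k] {C : ι → Matrix k k ℂ}, Spans C →
      LinearMap.range (Fintype.linearCombination ℂ C) = ⊤ := by
    intro k _ _ C hC
    rw [Fintype.range_linearCombination]; exact hC
  set LA := Fintype.linearCombination ℂ A
  set LB := Fintype.linearCombination ℂ B
  have hLA : ∀ c, LA c = ∑ i, c i • A i := fun c => Fintype.linearCombination_apply ℂ A c
  have hLB : ∀ c, LB c = ∑ i, c i • B i := fun c => Fintype.linearCombination_apply ℂ B c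
  have E₂ : ∀ c d, (LB c * LB d).trace = t₂ * (LA c * LA d).trace := by
    intro c d
    simp only [hLA, hLB, Finset.sum_mul, Finset.mul_sum, Matrix.trace_sum, smul_mul_smul_comm,
      Matrix.trace_smul, e₂, smul_eq_mul]
    exact Finset.sum_congr rfl fun _ _ => Finset.sum_congr rfl fun _ _ => by ring
  have E₃ : ∀ c d e, (LB c * LB d * LB e).trace = t₃ * (LA c * LA d * LA e).trace := by
    intro c d e
    simp only [hLA, hLB, Finset.sum_mul, Finset.mul_sum, Matrix.trace_sum, smul_mul_smul_comm,
      Matrix.trace_smul, e₃, smul_eq_mul]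
    exact Finset.sum_congr rfl fun _ _ => Finset.sum_congr rfl fun _ _ =>
      Finset.sum_congr rfl fun _ _ => by ring
  -- the trace form is nondegenerate, so the linear relations between the matrices of a spanning
  -- tensor can be read off from its state on two sites
  have hker : LinearMap.ker LA = LinearMap.ker LB := by
    ext c
    simp only [LinearMap.mem_ker]
    constructor
    · intro h
      rw [Matrix.ext_iff_trace_mul_right]
      intro y
      obtain ⟨d, rfl⟩ := LinearMap.range_eq_top.1 (surj hB) y
      change (LB c * LB d).trace = _
      rw [E₂, h]; simp
    · intro h
      rw [Matrix.ext_iff_trace_mul_right]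
      intro y
      obtain ⟨d, rfl⟩ := LinearMap.range_eq_top.1 (surj hA) y
      have := E₂ c d
      rw [h] at this
      simp only [zero_mul, Matrix.trace_zero, zero_eq_mul] at this ⊢
      exact this.resolve_left h₂
  let φ : Matrix n n ℂ ≃ₗ[ℂ] Matrix m m ℂ :=
    (LA.quotKerEquivOfSurjective (LinearMap.range_eq_top.1 (surj hA))).symm ≪≫ₗ
      Submodule.quotEquivOfEq _ _ hker ≪≫ₗ
      LB.quotKerEquivOfSurjective (LinearMap.range_eq_top.1 (surj hB))
  have hφ : ∀ c, φ (LA c) = LB c := by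
    intro c
    simp [φ]
  -- the states on two and three sites are the trace form and the structure constants: `φ` is
  -- multiplicative up to the ratio of the two scalars
  have hmul : ∀ x y, φ x * φ y = (t₃ / t₂) • φ (x * y) := by
    intro x y
    rw [Matrix.ext_iff_trace_mul_right]
    intro z
    obtain ⟨z, rfl⟩ := φ.surjective z
    obtain ⟨a, rfl⟩ := LinearMap.range_eq_top.1 (surj hA) x
    obtain ⟨b, rfl⟩ := LinearMap.range_eq_top.1 (surj hA) y
    obtain ⟨c, rfl⟩ := LinearMap.range_eq_top.1 (surj hA) z
    obtain ⟨d, hd⟩ := LinearMap.range_eq_top.1 (surj hA) (LA a * LA b)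
    change _ = ((t₃ / t₂) • φ (LA a * LA b) * φ (LA c)).trace
    rw [← hd]
    change (φ (LA a) * φ (LA b) * φ (LA c)).trace = _
    rw [hφ, hφ, hφ, hφ, E₃, smul_mul_assoc, Matrix.trace_smul, E₂, hd, smul_eq_mul]
    field_simp
  have ht : t₃ / t₂ ≠ 0 := div_ne_zero h₃ h₂
  let ψ : Matrix n n ℂ ≃ₗ[ℂ] Matrix m m ℂ := φ ≪≫ₗ LinearEquiv.smulOfNeZero ℂ _ _ (inv_ne_zero ht)
  have hψ : ∀ x, ψ x = (t₃ / t₂)⁻¹ • φ x := fun x => rfl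
  have ψmul : ∀ x y, ψ (x * y) = ψ x * ψ y := by
    intro x y
    rw [hψ, hψ, hψ, smul_mul_smul_comm, hmul, smul_smul, mul_assoc, inv_mul_cancel₀ ht, mul_one]
  have ψone : ψ 1 = 1 := by
    obtain ⟨y, hy⟩ := ψ.surjective 1
    have := ψmul y 1
    rw [mul_one, hy, one_mul] at this
    exact this.symm
  obtain ⟨X, Y, hXY, hYX, hf⟩ := algEquiv_eq_conj (AlgEquiv.ofLinearEquiv ψ ψone ψmul)
  refine ⟨X, Y, hXY, hYX, fun i => ?_⟩
  rw [← hf, AlgEquiv.ofLinearEquiv_apply, hψ, smul_smul, mul_inv_cancel₀ ht, one_smul]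
  classical
  have hi := hφ (Pi.single i 1)
  have h1 : LA (Pi.single i 1) = A i := by simp [LA]
  have h2 : LB (Pi.single i 1) = B i := by simp [LB]
  rw [← h2, ← hi, h1]

/-! ### Cohomology classes of projective representations -/

section Cohomology

variable {G : Type} [Group G]

theorem cohClass_eq_iff (ω ω' : Z2 G) : cohClass ω = cohClass ω' ↔
    ∃ f : G → Additive Circle, ∀ g h, (ω (g, h) : Additive Circle) - (ω' (g, h) : Additive Circle)
      = f h - f (g * h) + f g := by
  unfold cohClass
  rw [groupCohomology.H2π_eq_iff]
  constructor
  · rintro ⟨f, hf⟩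
    exact ⟨f, fun g h => (congrFun hf (g, h)).symm⟩
  · rintro ⟨f, hf⟩
    exact ⟨f, funext fun p => (hf p.1 p.2).symm⟩

theorem cohClass_surjective : Function.Surjective (cohClass : Z2 G → H2 G) := fun x =>
  groupCohomology.H2_induction_on x fun ω => ⟨ω, rfl⟩

theorem phase_ne_zero (ω : Z2 G) (g h : G) : phase ω g h ≠ 0 := Circle.coe_ne_zero _

theorem norm_phase (ω : Z2 G) (g h : G) : ‖phase ω g h‖ = 1 := Circle.norm_coe _

theorem phase_doubledCocycle (ω : Z2 G) (p q : G × G) :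
    phase (doubledCocycle ω) p q = phase ω p.1 q.1 * star (phase ω p.2 q.2) := by
  have : phase (doubledCocycle ω) p q
      = (((Additive.toMul (ω (p.1, q.1) : Additive Circle) : Circle) /
        (Additive.toMul (ω (p.2, q.2) : Additive Circle) : Circle) : Circle) : ℂ) := rfl
  rw [this, div_eq_mul_inv, Circle.coe_mul, Circle.coe_inv_eq_conj]
  rfl

/-- Two cocycles are cohomologous if they differ by the coboundary of a cochain with values in the
nonzero complex numbers: the moduli of the cochain can be divided out. -/
theorem cohClass_eq_of_phase {ω ω' : Z2 G} (lam : G → ℂ) (h0 : ∀ g, lam g ≠ 0)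
    (h : ∀ g h, phase ω g h * lam (g * h) = phase ω' g h * (lam g * lam h)) :
    cohClass ω = cohClass ω' := by
  rw [cohClass_eq_iff]
  have hn : ∀ g h, ‖lam (g * h)‖ = ‖lam g‖ * ‖lam h‖ := fun g k => by
    have := congrArg norm (h g k)
    simpa [norm_phase] using this
  let u : G → Circle := fun g => ⟨lam g / ‖lam g‖, by
    refine mem_sphere_zero_iff_norm.2 ?_
    rw [norm_div, Complex.norm_real, norm_norm,
      div_self (norm_ne_zero_iff.2 (h0 g))]⟩
  have hu : ∀ g, (u g : ℂ) = lam g / ‖lam g‖ := fun g => rfl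
  refine ⟨fun g => Additive.ofMul (u g), fun g k => ?_⟩
  change Additive.ofMul ((Additive.toMul (ω (g, k) : Additive Circle) : Circle) /
    (Additive.toMul (ω' (g, k) : Additive Circle) : Circle))
    = Additive.ofMul (u k / u (g * k) * u g)
  congr 1
  rw [div_eq_iff_eq_mul]
  ext
  push_cast
  have e := h g k
  change phase ω g k = _ * phase ω' g k
  rw [hu, hu, hu, hn]
  have a := h0 g
  have b := h0 k
  have c := h0 (g * k)
  have a' : (‖lam g‖ : ℂ) ≠ 0 := by exact_mod_cast norm_ne_zero_iff.2 a
  have b' : (‖lam k‖ : ℂ) ≠ 0 := by exact_mod_cast norm_ne_zero_iff.2 b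
  push_cast
  field_simp
  rw [e]; ring

/-- Cohomologous cocycles differ by the coboundary of a cochain with values in the circle. -/
theorem exists_phase_of_cohClass_eq {ω ω' : Z2 G} (h : cohClass ω = cohClass ω') :
    ∃ lam : G → Circle, ∀ g h, phase ω g h * lam (g * h) = phase ω' g h * (lam g * lam h) := by
  obtain ⟨f, hf⟩ := (cohClass_eq_iff ω ω').1 h
  refine ⟨fun g => (f g).toMul, fun g k => ?_⟩
  have h1 : (ω (g, k) : Additive Circle) + f (g * k) = (ω' (g, k) : Additive Circle) + (f g + f k) := by
    have := hf g k
    rw [sub_eq_iff_eq_add] at this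
    rw [this]; abel
  have h2 := congrArg (fun z : Additive Circle => ((Additive.toMul z : Circle) : ℂ)) h1
  simpa [phase] using h2

/-- A `U(1)`-valued function on pairs that satisfies the cocycle identity, as an element of
`Z2 G`. -/
theorem exists_cocycle (κ : G → G → Circle)
    (h : ∀ g h j, κ (g * h) j * κ g h = κ h j * κ g (h * j)) :
    ∃ ω : Z2 G, ∀ g h, phase ω g h = κ g h := by
  refine ⟨⟨fun p => Additive.ofMul (κ p.1 p.2), ?_⟩, fun g h => rfl⟩
  refine (groupCohomology.mem_cocycles₂_iff (A := U1 G) _).2 fun g k j => ?_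
  exact congrArg Additive.ofMul (h g k j)

theorem phase_cocycle (ω : Z2 G) (g h j : G) :
    phase ω (g * h) j * phase ω g h = phase ω h j * phase ω g (h * j) := by
  have h1 := (groupCohomology.mem_cocycles₂_iff (A := U1 G) ω.1).1 ω.2 g h j
  have h2 := congrArg (fun z : Additive Circle => ((Additive.toMul z : Circle) : ℂ)) h1
  exact h2

theorem cohClass_doubledCocycle_congr {ω ω' : Z2 G} (h : cohClass ω = cohClass ω') :
    cohClass (doubledCocycle ω) = cohClass (doubledCocycle ω') := by
  obtain ⟨l, hl⟩ := exists_phase_of_cohClass_eq h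
  refine cohClass_eq_of_phase (fun p => (l p.1 : ℂ) * star (l p.2 : ℂ)) (fun p => ?_) fun p q => ?_
  · exact mul_ne_zero (Circle.coe_ne_zero _) (star_ne_zero.2 (Circle.coe_ne_zero _))
  · rw [phase_doubledCocycle, phase_doubledCocycle]
    have h1 := hl p.1 q.1
    have h2 := congrArg star (hl p.2 q.2)
    simp only [star_mul'] at h2
    simp only [Prod.fst_mul, Prod.snd_mul]
    linear_combination star (phase ω p.2 q.2) * star (l (p.2 * q.2) : ℂ) * h1
      + phase ω' p.1 q.1 * l p.1 * l q.1 * h2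

/-- Restriction of a cocycle of `G × G` to the first factor. -/
theorem exists_restrict (ω' : Z2 (G × G)) :
    ∃ ω : Z2 G, ∀ g h, phase ω g h = phase ω' (g, 1) (h, 1) := by
  obtain ⟨ω, hω⟩ := exists_cocycle
    (fun g h => (Additive.toMul (ω' ((g, 1), (h, 1)) : Additive Circle) : Circle)) fun g h j => by
      have := phase_cocycle ω' (g, 1) (h, 1) (j, 1)
      simp only [Prod.mk_mul_mk, mul_one] at this
      ext
      push_cast
      exact this
  exact ⟨ω, hω⟩

/-- A cocycle in the class of the doubled cocycle of `ω` restricts on the first factor to the class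
of `ω`. The factor `ω(1, 1)` left over from the second factor is a coboundary. -/
theorem cohClass_restrict_doubledCocycle {ω : Z2 G} {ω' : Z2 (G × G)} {ω₁ : Z2 G}
    (h : cohClass ω' = cohClass (doubledCocycle ω))
    (h₁ : ∀ g h, phase ω₁ g h = phase ω' (g, 1) (h, 1)) : cohClass ω₁ = cohClass ω := by
  obtain ⟨l, hl⟩ := exists_phase_of_cohClass_eq h
  refine cohClass_eq_of_phase (fun g => (l (g, 1) : ℂ) * star (phase ω 1 1))
    (fun g => mul_ne_zero (Circle.coe_ne_zero _) (star_ne_zero.2 (phase_ne_zero _ _ _))) fun g k => ?_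
  have h2 := hl (g, 1) (k, 1)
  rw [phase_doubledCocycle] at h2
  simp only [Prod.mk_mul_mk, mul_one] at h2
  rw [h₁]
  linear_combination star (phase ω 1 1) * h2

end Cohomology

/-! ### Projective action on the virtual space -/

/-- The onsite operator `O` applied to the physical index of the tensor `A`. -/
def act {ι κ n : Type} [Fintype ι] (O : Matrix κ ι ℂ) (A : ι → Matrix n n ℂ) :
    κ → Matrix n n ℂ := fun i => ∑ j, O i j • A j

theorem act_act {ι κ μ n : Type} [Fintype ι] [Fintype κ] (P : Matrix μ κ ℂ) (O : Matrix κ ι ℂ)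
    (A : ι → Matrix n n ℂ) : act P (act O A) = act (P * O) A := by
  funext i
  simp only [act, Finset.smul_sum, smul_smul, Matrix.mul_apply, Finset.sum_smul]
  rw [Finset.sum_comm]

theorem act_one {ι n : Type} [Fintype ι] [DecidableEq ι]
    (A : ι → Matrix n n ℂ) : act (1 : Matrix ι ι ℂ) A = A := by
  funext i
  simp [act, Matrix.one_apply, ite_smul]

theorem act_smul {ι κ n : Type} [Fintype ι] (O : Matrix κ ι ℂ)
    (c : ℂ) (A : ι → Matrix n n ℂ) : act O (fun i => c • A i) = fun i => c • act O A i := by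
  funext i
  simp only [act, Finset.smul_sum, smul_smul]
  exact Finset.sum_congr rfl fun j _ => by rw [mul_comm]

theorem smul_act {ι κ n : Type} [Fintype ι] (O : Matrix κ ι ℂ)
    (c : ℂ) (A : ι → Matrix n n ℂ) : act (c • O) A = fun i => c • act O A i := by
  funext i
  simp only [act, Finset.smul_sum, smul_smul, Matrix.smul_apply, smul_eq_mul]

theorem act_mul_mul {ι κ n l : Type} [Fintype ι] [Fintype n] (O : Matrix κ ι ℂ)
    (X : Matrix l n ℂ) (Y : Matrix n l ℂ) (A : ι → Matrix n n ℂ) :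
    act O (fun i => X * A i * Y) = fun i => X * act O A i * Y := by
  funext i
  simp only [act, Matrix.mul_smul, Matrix.smul_mul, Matrix.mul_sum,
    Matrix.sum_mul]

/-- If `K` commutes with an injective tensor up to a scalar, then the scalar is `1` and `K` is a
multiple of the identity. -/
theorem Spans.twisted_commute {ι n : Type} [Fintype n] [DecidableEq n] [Nonempty n]
    {A : ι → Matrix n n ℂ} (hA : Spans A) {K : Matrix n n ℂ} (hK : K ≠ 0) {ζ : ℂ}
    (h : ∀ i, K * A i = ζ • (A i * K)) : ζ = 1 ∧ ∃ k : ℂ, K = k • 1 := by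
  have e : LinearMap.mulLeft ℂ K = ζ • LinearMap.mulRight ℂ K :=
    hA.ext fun i => by simpa using h i
  have h1 := LinearMap.congr_fun e 1
  simp only [LinearMap.mulLeft_apply, mul_one, LinearMap.smul_apply, LinearMap.mulRight_apply,
    one_mul] at h1
  have hζ : ζ = 1 := by
    have : (ζ - 1) • K = 0 := by rw [sub_smul, one_smul, ← h1, sub_self]
    rcases smul_eq_zero.1 this with h | h
    · exact sub_eq_zero.1 h
    · exact absurd h hK
  exact ⟨hζ, hA.eq_smul_one fun i => by simpa [hζ] using h i⟩

/-- The virtual action that implements a given transformation of an injective tensor is unique up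
to a scalar, and its phase is unique. -/
theorem Spans.gauge_unique {ι n : Type} [Fintype n] [DecidableEq n] [Nonempty n]
    {A : ι → Matrix n n ℂ} (hA : Spans A) {V W : (Matrix n n ℂ)ˣ} {c d : ℂ} (hc : c ≠ 0)
    (h : ∀ i, c • ((V⁻¹).val * A i * V.val) = d • ((W⁻¹).val * A i * W.val)) :
    c = d ∧ ∃ k : ℂ, k ≠ 0 ∧ W.val = k • V.val := by
  have hK : W.val * (V⁻¹).val ≠ 0 := (W * V⁻¹).ne_zero
  obtain ⟨h1, k, hk⟩ := hA.twisted_commute (K := W.val * (V⁻¹).val) (ζ := c⁻¹ * d) hK fun i => by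
    have := congrArg (fun M => c⁻¹ • (W.val * M * (V⁻¹).val)) (h i)
    simp only [Matrix.mul_smul, Matrix.smul_mul, smul_smul, inv_mul_cancel₀ hc, one_smul] at this
    simp only [mul_assoc, Units.mul_inv, mul_one] at this
    simp only [mul_assoc]
    rw [this, ← mul_assoc W.val, Units.mul_inv, one_mul]
  refine ⟨by field_simp at h1; exact h1.symm, k, ?_, ?_⟩
  · rintro rfl
    exact hK (by simpa using hk)
  · have := congrArg (fun M => M * V.val) hk
    simpa [mul_assoc] using this

/-- A nonzero scalar multiple of an invertible matrix, as a unit. -/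
def scaleUnit {n : Type} [Fintype n] [DecidableEq n] (r : ℂ) (hr : r ≠ 0) (V : (Matrix n n ℂ)ˣ) :
    (Matrix n n ℂ)ˣ where
  val := r • V.val
  inv := r⁻¹ • (V⁻¹).val
  val_inv := by rw [smul_mul_smul_comm, mul_inv_cancel₀ hr, Units.mul_inv, one_smul]
  inv_val := by rw [smul_mul_smul_comm, inv_mul_cancel₀ hr, Units.inv_mul, one_smul]

theorem scaleUnit_conj {n : Type} [Fintype n] [DecidableEq n] (r : ℂ) (hr : r ≠ 0)
    (V : (Matrix n n ℂ)ˣ) (M : Matrix n n ℂ) :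
    ((scaleUnit r hr V)⁻¹).val * M * (scaleUnit r hr V).val = (V⁻¹).val * M * V.val := by
  change r⁻¹ • (V⁻¹).val * M * (r • V.val) = _
  rw [Matrix.smul_mul, Matrix.smul_mul, Matrix.mul_smul, smul_smul, inv_mul_cancel₀ hr, one_smul]

section Class

variable {H : Type} [Group H] {ι : Type} [Fintype ι] {D : ℕ}

/-- The virtual matrices that implement a representation of a group multiply up to scalars. -/
theorem Spans.exists_mul_eq_smul (hD : 0 < D) {A : ι → Matrix (Fin D) (Fin D) ℂ} (hA : Spans A)
    {R : H → Matrix ι ι ℂ} (hR : ∀ g h, R (g * h) = R g * R h)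
    {V : H → (Matrix (Fin D) (Fin D) ℂ)ˣ} {c : H → Circle}
    (h : ∀ g i, act (R g) A i = (c g : ℂ) • (((V g)⁻¹).val * A i * (V g).val)) (g k : H) :
    c (g * k) = c g * c k ∧ ∃ κ : ℂ, κ ≠ 0 ∧ (V g).val * (V k).val = κ • (V (g * k)).val := by
  have : Nonempty (Fin D) := ⟨⟨0, hD⟩⟩
  have key : ∀ i, (c (g * k) : ℂ) • (((V (g * k))⁻¹).val * A i * (V (g * k)).val)
      = ((c g : ℂ) * c k) • (((V g * V k)⁻¹).val * A i * (V g * V k).val) := by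
    intro i
    rw [← h (g * k) i, hR, ← act_act]
    have : act (R k) A = fun i => (c k : ℂ) • (((V k)⁻¹).val * A i * (V k).val) := funext (h k)
    rw [this, act_smul, act_mul_mul]
    simp only [h g, mul_inv_rev, Units.val_mul, Matrix.mul_smul, Matrix.smul_mul, smul_smul,
      mul_assoc]
    rw [mul_comm]
  obtain ⟨h1, κ, h2, h3⟩ := hA.gauge_unique (Circle.coe_ne_zero _) key
  exact ⟨Circle.ext (by push_cast; exact h1), κ, h2, h3⟩

/-- An injective tensor on which a representation acts by gauge transformations has a class: if the
virtual matrices have determinants of modulus one, they multiply up to phases, and the phases form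
a cocycle. -/
theorem exists_hasSPTClass (hD : 0 < D) {A : ι → Matrix (Fin D) (Fin D) ℂ} (hA : Spans A)
    {R : H → Matrix ι ι ℂ} (hR : ∀ g h, R (g * h) = R g * R h)
    (h : ∀ g, ∃ (V : (Matrix (Fin D) (Fin D) ℂ)ˣ) (c : Circle), ∀ i,
      act (R g) A i = (c : ℂ) • ((V⁻¹).val * A i * V.val)) :
    ∃ ω : Z2 H, HasSPTClass A R ω := by
  have h' : ∀ g, ∃ (V : (Matrix (Fin D) (Fin D) ℂ)ˣ) (c : Circle), ‖V.val.det‖ = 1 ∧ ∀ i,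
      act (R g) A i = (c : ℂ) • ((V⁻¹).val * A i * V.val) := by
    intro g
    obtain ⟨V, c, hV⟩ := h g
    have hd : V.val.det ≠ 0 := ((Matrix.isUnit_iff_isUnit_det _).1 V.isUnit).ne_zero
    have hd' : 0 < ‖V.val.det‖ := norm_pos_iff.2 hd
    -- a gauge transformation is defined up to a scalar, which is used to make `|det V| = 1`
    set r : ℝ := (‖V.val.det‖⁻¹) ^ ((D : ℝ)⁻¹) with hr
    have hr0 : 0 < r := Real.rpow_pos_of_pos (inv_pos.2 hd') _
    have hrD : r ^ D = ‖V.val.det‖⁻¹ := Real.rpow_inv_natCast_pow (inv_pos.2 hd').le hD.ne'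
    have hrc : (r : ℂ) ≠ 0 := by exact_mod_cast hr0.ne'
    refine ⟨scaleUnit r hrc V, c, ?_, fun i => by rw [scaleUnit_conj]; exact hV i⟩
    change ‖((r : ℂ) • V.val).det‖ = 1
    rw [Matrix.det_smul, norm_mul, norm_pow, Complex.norm_real, Real.norm_of_nonneg hr0.le,
      Fintype.card_fin, hrD, inv_mul_cancel₀ hd'.ne']
  choose V c hdet hV using h'
  have hmul := fun g k => (hA.exists_mul_eq_smul hD hR hV g k).2
  choose κ hκ0 hκ using hmul
  have hκ1 : ∀ g k, ‖κ g k‖ = 1 := by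
    intro g k
    have := congrArg (fun M : Matrix (Fin D) (Fin D) ℂ => ‖M.det‖) (hκ g k)
    simp only [Matrix.det_mul, Matrix.det_smul, norm_mul, hdet, norm_pow, Fintype.card_fin,
      mul_one] at this
    exact (pow_eq_one_iff_of_nonneg (norm_nonneg _) hD.ne').1 this.symm
  obtain ⟨ω, hω⟩ := exists_cocycle
    (fun g k => (⟨κ g k, mem_sphere_zero_iff_norm.2 (hκ1 g k)⟩ : Circle)) fun g k j => by
      ext
      change κ (g * k) j * κ g k = κ k j * κ g (k * j)
      have e1 : (V g).val * (V k).val * (V j).val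
          = (κ (g * k) j * κ g k) • (V (g * k * j)).val := by
        rw [hκ, Matrix.smul_mul, hκ, smul_smul, mul_comm]
      have e2 : (V g).val * (V k).val * (V j).val
          = (κ k j * κ g (k * j)) • (V (g * k * j)).val := by
        rw [mul_assoc, hκ k j, Matrix.mul_smul, hκ, smul_smul, mul_assoc g k j]
      have : Nonempty (Fin D) := ⟨⟨0, hD⟩⟩
      exact smul_left_injective ℂ (V (g * k * j)).ne_zero (e1.symm.trans e2)
  exact ⟨ω, V, c, ω, hV, fun g k => by rw [hκ, hω], rfl⟩

/-- The class of an injective tensor is unique. -/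
theorem HasSPTClass.unique (hD : 0 < D) {A : ι → Matrix (Fin D) (Fin D) ℂ} (hA : Spans A)
    {R : H → Matrix ι ι ℂ} {ω ω' : Z2 H} (h : HasSPTClass A R ω) (h' : HasSPTClass A R ω') :
    cohClass ω = cohClass ω' := by
  have : Nonempty (Fin D) := ⟨⟨0, hD⟩⟩
  obtain ⟨V, c, ω₁, hV, hm, hω⟩ := h
  obtain ⟨V', c', ω₁', hV', hm', hω'⟩ := h'
  rw [← hω, ← hω']
  have key := fun g => (hA.gauge_unique (Circle.coe_ne_zero (c g))
    fun i => (hV g i).symm.trans (hV' g i)).2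
  choose l hl0 hl using key
  symm
  refine cohClass_eq_of_phase l hl0 fun g k => ?_
  have e : (V' g).val * (V' k).val = (l g * l k * phase ω₁ g k) • (V (g * k)).val := by
    rw [hl, hl, smul_mul_smul_comm, hm, smul_smul]
  rw [hm', hl, smul_smul] at e
  have := smul_left_injective ℂ (V (g * k)).ne_zero e
  rw [this]; ring

end Class

/-! ### Ordered products and states on a ring -/

section OrderedProducts

theorem prod_ofFn_sum {R κ : Type} [Semiring R] [Fintype κ] {L : ℕ} (f : Fin L → κ → R) :
    (List.ofFn fun x => ∑ k, f x k).prod = ∑ k : Fin L → κ, (List.ofFn fun x => f x (k x)).prod := by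
  induction L with
  | zero => simp
  | succ L ih =>
    rw [List.ofFn_succ, List.prod_cons, ih, ← (Fin.consEquiv fun _ => κ).sum_comp,
      Fintype.sum_prod_type, Finset.sum_mul]
    refine Finset.sum_congr rfl fun k _ => ?_
    rw [Finset.mul_sum]
    refine Finset.sum_congr rfl fun l _ => ?_
    simp [Fin.consEquiv, List.ofFn_succ]

variable {n m : Type} [Fintype n] [Fintype m] [DecidableEq n] [DecidableEq m]

theorem prod_ofFn_smul {L : ℕ} (c : Fin L → ℂ) (M : Fin L → Matrix n n ℂ) :
    (List.ofFn fun x => c x • M x).prod = (∏ x, c x) • (List.ofFn M).prod := by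
  induction L with
  | zero => simp
  | succ L ih =>
    rw [List.ofFn_succ, List.prod_cons, ih, List.ofFn_succ, List.prod_cons, Fin.prod_univ_succ,
      smul_mul_smul_comm]

theorem prod_ofFn_kronecker {L : ℕ} (P : Fin L → Matrix n n ℂ) (Q : Fin L → Matrix m m ℂ) :
    (List.ofFn fun x => P x ⊗ₖ Q x).prod = (List.ofFn P).prod ⊗ₖ (List.ofFn Q).prod := by
  induction L with
  | zero => simp
  | succ L ih => simp only [List.ofFn_succ, List.prod_cons, ih, Matrix.mul_kronecker_mul]

theorem prod_ofFn_map_star {L : ℕ} (Q : Fin L → Matrix n n ℂ) :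
    (List.ofFn fun x => (Q x).map star).prod = ((List.ofFn Q).prod).map star := by
  induction L with
  | zero => simp
  | succ L ih =>
    simp only [List.ofFn_succ, List.prod_cons, ih]
    exact (Matrix.map_mul (f := starRingEnd ℂ)).symm

theorem prod_ofFn_conj {L : ℕ} {X : Matrix m n ℂ} {Y : Matrix n m ℂ} (hXY : X * Y = 1)
    (hYX : Y * X = 1) (M : Fin L → Matrix n n ℂ) :
    (List.ofFn fun x => X * M x * Y).prod = X * (List.ofFn M).prod * Y := by
  induction L with
  | zero => simp [hXY]
  | succ L ih =>
    simp only [List.ofFn_succ, List.prod_cons, ih]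
    simp only [Matrix.mul_assoc]
    rw [← Matrix.mul_assoc Y X, hYX, Matrix.one_mul]

end OrderedProducts

/-- The product operator `⨂ₓ K x` for an arbitrary finite set of sites. -/
def siteOp {ι a b : Type} [Fintype ι] (K : ι → Matrix b a ℂ) : Matrix (ι → b) (ι → a) ℂ :=
  Matrix.of fun s t => ∏ x, K x (s x) (t x)

theorem siteOp_mul {ι a b c : Type} [Fintype ι] [DecidableEq ι] [Fintype b]
    (K : ι → Matrix c b ℂ) (K' : ι → Matrix b a ℂ) :
    siteOp K * siteOp K' = siteOp fun x => K x * K' x := by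
  ext s t
  simp only [Matrix.mul_apply, siteOp, Matrix.of_apply, ← Finset.prod_mul_distrib]
  rw [Finset.prod_univ_sum, Fintype.piFinset_univ]

theorem siteOp_one {ι a : Type} [Fintype ι] [DecidableEq a] :
    siteOp (fun _ : ι => (1 : Matrix a a ℂ)) = 1 := by
  ext s t
  simp only [siteOp, Matrix.of_apply, Matrix.one_apply, funext_iff]
  rw [Finset.prod_ite_zero]
  simp

theorem siteOp_smul {ι a b : Type} [Fintype ι] (c : ι → ℂ) (K : ι → Matrix b a ℂ) :
    siteOp (fun x => c x • K x) = (∏ x, c x) • siteOp K := by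
  ext s t
  simp [siteOp, Finset.prod_mul_distrib]

/-- The periodic matrix product state with site-dependent tensors `T x`. -/
def chain {a n : Type} [Fintype n] [DecidableEq n] {L : ℕ} (T : Fin L → a → Matrix n n ℂ) :
    (Fin L → a) → ℂ :=
  fun s => (List.ofFn fun x => T x (s x)).prod.trace

theorem siteOp_mulVec_chain {a b n : Type} [Fintype a] [Fintype n] [DecidableEq n] {L : ℕ}
    (K : Fin L → Matrix b a ℂ) (T : Fin L → a → Matrix n n ℂ) :
    (siteOp K).mulVec (chain T) = chain fun x => act (K x) (T x) := by
  funext s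
  simp only [Matrix.mulVec, dotProduct, siteOp, Matrix.of_apply, chain, act]
  rw [prod_ofFn_sum, Matrix.trace_sum]
  refine Finset.sum_congr rfl fun t _ => ?_
  rw [prod_ofFn_smul, Matrix.trace_smul, smul_eq_mul]

theorem chain_smul {a n : Type} [Fintype n] [DecidableEq n] {L : ℕ} (c : Fin L → ℂ)
    (T : Fin L → a → Matrix n n ℂ) :
    chain (fun x i => c x • T x i) = (∏ x, c x) • chain T := by
  funext s
  simp only [chain, prod_ofFn_smul (fun x => c x), Matrix.trace_smul, Pi.smul_apply]

/-- Conjugation of all tensors by the same invertible matrix does not change the state. -/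
theorem chain_conj {a n m : Type} [Fintype n] [DecidableEq n] [Fintype m] [DecidableEq m] {L : ℕ}
    {X : Matrix m n ℂ} {Y : Matrix n m ℂ} (hXY : X * Y = 1) (hYX : Y * X = 1)
    (T : Fin L → a → Matrix n n ℂ) :
    chain (fun x i => X * T x i * Y) = chain T := by
  funext s
  rw [chain, prod_ofFn_conj hXY hYX, Matrix.trace_mul_comm, ← Matrix.mul_assoc, hYX, Matrix.one_mul,
    chain]

theorem mps_eq_chain {ι : Type} {D : ℕ} (A : ι → Matrix (Fin D) (Fin D) ℂ) (L : ℕ) :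
    mps A L = chain fun _ : Fin L => A := rfl

/-- Tracing out the second factor of the physical space of `|Ψ⟩⟨Ψ|`. -/
theorem chain_sum_kronecker {a b κ n m : Type} [Fintype κ] [Fintype n] [DecidableEq n]
    [Fintype m] [DecidableEq m] {L : ℕ}
    (A : a → κ → Matrix n n ℂ) (B : b → κ → Matrix m m ℂ) (s : Fin L → a) (t : Fin L → b) :
    (List.ofFn fun x => ∑ k, A (s x) k ⊗ₖ (B (t x) k).map star).prod.trace
      = ∑ k : Fin L → κ, chain (fun _ (i : a × κ) => A i.1 i.2) (fun x => (s x, k x))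
        * star (chain (fun _ (i : b × κ) => B i.1 i.2) (fun x => (t x, k x))) := by
  rw [prod_ofFn_sum, Matrix.trace_sum]
  refine Finset.sum_congr rfl fun k _ => ?_
  rw [prod_ofFn_kronecker, Matrix.trace_kronecker, prod_ofFn_map_star (fun x => B (t x) (k x))]
  congr 1
  simp [chain, Matrix.trace]

theorem MPO.state_eq_mps {G : Type} [Group G] (ρ : MPO G) (L : ℕ) (s t : Fin L → Fin ρ.d) :
    ρ.state L s t = mps ρ.doubledTensor L fun x => (s x, t x) := rfl

/-- The state of an operator tensor with a local purification is the partial trace of the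
purification. -/
theorem MPO.state_eq_sum {G : Type} [Group G] (ρ : MPO G) {e D : ℕ}
    {A : Fin ρ.d × Fin e → Matrix (Fin D) (Fin D) ℂ} (hA : ρ.IsLocalPurification A) (L : ℕ)
    (s t : Fin L → Fin ρ.d) : ρ.state L s t = ∑ k : Fin L → Fin e,
      mps A L (fun x => (s x, k x)) * star (mps A L (fun x => (t x, k x))) := by
  obtain ⟨X, Y, hXY, hYX, h⟩ := hA
  have h1 := chain_sum_kronecker (fun i k => A (i, k)) (fun i k => A (i, k)) s t
  simp only [← h] at h1
  rw [prod_ofFn_conj hXY hYX, Matrix.trace_mul_comm, ← Matrix.mul_assoc, hYX, Matrix.one_mul] at h1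
  exact h1

/-! ### Local purifications are injective, symmetric, and have a class -/

/-- If the tensors `∑ₖ A^{ik} ⊗ (A^{jk})*` span, then so do the `A^{ik}`: a
functional that vanishes on all `A^{ik}` gives one that vanishes on all these tensors. -/
theorem spans_of_spans_kronecker {a κ n : Type} [Fintype κ] [Fintype n] [DecidableEq n]
    {A : a × κ → Matrix n n ℂ}
    (h : Spans fun p : a × a => ∑ k, A (p.1, k) ⊗ₖ (A (p.2, k)).map star) : Spans A := by
  rcases isEmpty_or_nonempty n with hn | ⟨⟨y⟩⟩
  · exact Subsingleton.elim _ _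
  by_contra hne
  obtain ⟨f, hf, hle⟩ := Submodule.exists_le_ker_of_lt_top _ (lt_top_iff_ne_top.2 hne)
  apply hf
  have hfA : ∀ i, f (A i) = 0 := fun i => hle (Submodule.subset_span ⟨i, rfl⟩)
  -- the functional `f` on the first factor and a matrix entry on the second factor
  let F : Matrix (n × n) (n × n) ℂ →ₗ[ℂ] ℂ := f ∘ₗ
    { toFun := fun M => Matrix.of fun α β => M (α, y) (β, y)
      map_add' := fun M N => rfl
      map_smul' := fun c M => rfl }
  have hF : ∀ P Q, F (P ⊗ₖ Q) = Q y y * f P := by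
    intro P Q
    have : (Matrix.of fun α β => (P ⊗ₖ Q) (α, y) (β, y)) = Q y y • P := by
      ext α β; simp [mul_comm]
    change f (Matrix.of fun α β => (P ⊗ₖ Q) (α, y) (β, y)) = _
    rw [this, map_smul, smul_eq_mul]
  have hF0 : F = 0 := h.ext fun p => by
    rw [map_sum]
    simp [hF, hfA]
  ext P
  have := hF P 1
  rw [hF0] at this
  simpa using this.symm

theorem Spans.conj {ι n m : Type} [Fintype n] [Fintype m] [DecidableEq n] [DecidableEq m]
    {A : ι → Matrix n n ℂ} (hA : Spans A) {X : Matrix m n ℂ} {Y : Matrix n m ℂ}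
    (hXY : X * Y = 1) : Spans fun i => X * A i * Y := by
  let F : Matrix n n ℂ →ₗ[ℂ] Matrix m m ℂ :=
    { toFun := fun M => X * M * Y
      map_add' := fun M N => by rw [Matrix.mul_add, Matrix.add_mul]
      map_smul' := fun c M => by simp }
  have hF : Function.Surjective F := fun M => ⟨Y * M * X, by
    change X * (Y * M * X) * Y = M
    simp only [Matrix.mul_assoc, hXY, Matrix.mul_one]
    rw [← Matrix.mul_assoc, hXY, Matrix.one_mul]⟩
  unfold Spans at hA ⊢
  have : Set.range (fun i => X * A i * Y) = F '' Set.range A := by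
    rw [← Set.range_comp]; rfl
  rw [this, Submodule.span_image, hA, Submodule.map_top, LinearMap.range_eq_top.2 hF]

variable {G : Type} [Group G]

theorem MPO.IsLocalPurification.spans {ρ : MPO G} (hρ : InjectiveTensor ρ.doubledTensor) {e D : ℕ}
    {A : Fin ρ.d × Fin e → Matrix (Fin D) (Fin D) ℂ} (hA : ρ.IsLocalPurification A) : Spans A := by
  obtain ⟨X, Y, hXY, hYX, h⟩ := hA
  apply spans_of_spans_kronecker
  have := ((injectiveTensor_iff_spans _).1 hρ).conj hXY
  simpa only [MPO.doubledTensor, h] using this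

theorem MPO.IsLocalPurification.bond_pos {ρ : MPO G} (hρ : 0 < ρ.χ) {e D : ℕ}
    {A : Fin ρ.d × Fin e → Matrix (Fin D) (Fin D) ℂ} (hA : ρ.IsLocalPurification A) : 0 < D := by
  obtain ⟨X, Y, hXY, hYX, h⟩ := hA
  rcases Nat.eq_zero_or_pos D with rfl | h
  · have := congrFun (congrFun hYX ⟨0, hρ⟩) ⟨0, hρ⟩
    simp [Matrix.mul_apply] at this
  · exact h

/-- An injective tensor of a symmetric matrix product state transforms by a gauge transformation: the
transformed tensor generates the same states up to phases. -/
theorem Spans.exists_gauge {ι : Type} [Fintype ι] [DecidableEq ι] {D : ℕ}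
    {A : ι → Matrix (Fin D) (Fin D) ℂ}
    (hA : Spans A) {u v : Matrix ι ι ℂ} (huv : v * u = 1)
    (h : ∀ L : ℕ, 0 < L → ∃ θ : Circle,
      (tensorOp fun _ : Fin L => u).mulVec (mps A L) = (θ : ℂ) • mps A L) :
    ∃ (V : (Matrix (Fin D) (Fin D) ℂ)ˣ) (c : Circle), ∀ i,
      act u A i = (c : ℂ) • ((V⁻¹).val * A i * V.val) := by
  have hB : Spans (act u A) := by
    unfold Spans at hA ⊢
    rw [eq_top_iff, ← hA, Submodule.span_le]
    rintro _ ⟨i, rfl⟩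
    have : A i = ∑ j, v i j • act u A j := by
      have := congrFun (act_act v u A) i
      rw [huv, act_one] at this
      exact this.symm
    rw [this]
    exact Submodule.sum_mem _ fun j _ => Submodule.smul_mem _ _ (Submodule.subset_span ⟨j, rfl⟩)
  have hc : ∀ L : ℕ, 0 < L → ∃ θ : Circle, ∀ s : Fin L → ι,
      (List.ofFn fun x => act u A (s x)).prod.trace
        = (θ : ℂ) * (List.ofFn fun x => A (s x)).prod.trace := by
    intro L hL
    obtain ⟨θ, hθ⟩ := h L hL
    refine ⟨θ, fun s => ?_⟩
    have h1 := congrFun (siteOp_mulVec_chain (fun _ : Fin L => u) fun _ => A) s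
    exact h1.symm.trans (congrFun hθ s)
  -- rings of two and three sites suffice, and the phase of the gauge transformation is `t₃ / t₂`
  obtain ⟨t₂, h₂⟩ := hc 2 two_pos
  obtain ⟨t₃, h₃⟩ := hc 3 three_pos
  obtain ⟨X, Y, hXY, hYX, hX⟩ := exists_conj_of_trace_eq hA hB (Circle.coe_ne_zero t₂)
    (Circle.coe_ne_zero t₃) (fun i j => by simpa using h₂ ![i, j])
    (fun i j k => by simpa [mul_assoc] using h₃ ![i, j, k])
  exact ⟨⟨Y, X, hYX, hXY⟩, t₃ / t₂, fun i => by rw [hX, Circle.coe_div]; rfl⟩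

/-- Symmetry of the reduced state implies symmetry of the purification: `(U - e^{iθ}) Ψ Ψ† = 0`
forces `(U - e^{iθ}) Ψ = 0`. -/
theorem MPO.IsLocalPurification.symmetric {ρ : MPO G} (hs : ρ.StronglySymmetric) {e D : ℕ}
    {A : Fin ρ.d × Fin e → Matrix (Fin D) (Fin D) ℂ} (hA : ρ.IsLocalPurification A) :
    SymmetricMPS A (ρ.purifiedRep e) := by
  intro L hL g
  obtain ⟨θ, hθ, -⟩ := hs L hL g
  refine ⟨θ, ?_⟩
  let Ψ : Matrix (Fin L → Fin ρ.d) (Fin L → Fin e) ℂ :=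
    Matrix.of fun s k => mps A L fun x => (s x, k x)
  have hΨ : ρ.state L = Ψ * Ψ.conjTranspose := by
    ext s t
    rw [ρ.state_eq_sum hA]; rfl
  set u := tensorOp fun _ : Fin L => ρ.rep g
  have h1 : (u - (θ : ℂ) • 1) * Ψ = 0 := by
    rw [← Matrix.mul_self_mul_conjTranspose_eq_zero, ← hΨ, Matrix.sub_mul, hθ, Matrix.smul_mul,
      Matrix.one_mul, sub_self]
  have h2 : u * Ψ = (θ : ℂ) • Ψ := by
    rw [Matrix.sub_mul, Matrix.smul_mul, Matrix.one_mul, sub_eq_zero] at h1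
    exact h1
  funext w
  have h3 := congrFun (congrFun h2 fun x => (w x).1) fun x => (w x).2
  simp only [Matrix.mul_apply, Matrix.smul_apply, smul_eq_mul] at h3
  simp only [Matrix.mulVec, dotProduct, Pi.smul_apply, smul_eq_mul]
  have h4 : (Ψ (fun x => (w x).1) fun x => (w x).2) = mps A L w := rfl
  rw [← h4, ← h3]
  rw [← (Equiv.arrowProdEquivProdArrow (Fin L) (fun _ => Fin ρ.d) (fun _ => Fin e)).symm.sum_comp,
    Fintype.sum_prod_type]
  refine Finset.sum_congr rfl fun s _ => ?_
  rw [Finset.sum_eq_single fun x => (w x).2]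
  · have : (tensorOp fun _ : Fin L => ρ.purifiedRep e g) w (fun x => (s x, (w x).2))
        = u (fun x => (w x).1) s := by
      simp [tensorOp, MPO.purifiedRep, u]
    simp only [Equiv.arrowProdEquivProdArrow, Equiv.coe_fn_symm_mk, this]
    rfl
  · intro k _ hk
    obtain ⟨x, hx⟩ := Function.ne_iff.1 hk
    have : (tensorOp fun _ : Fin L => ρ.purifiedRep e g) w (fun x => (s x, k x)) = 0 := by
      simp only [tensorOp, Matrix.of_apply, MPO.purifiedRep, Matrix.kroneckerMap_apply]
      refine Finset.prod_eq_zero (Finset.mem_univ x) ?_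
      rw [Matrix.one_apply_ne hx.symm, mul_zero]
    simp only [Equiv.arrowProdEquivProdArrow, Equiv.coe_fn_symm_mk, this, zero_mul]
  · exact fun h => absurd (Finset.mem_univ _) h

/-! ### The class of a local purification and the phase of the mixed state -/

section Phase

variable {G : Type} [Group G] {ρ : MPO G}

theorem MPO.rep_mul (ρ : MPO G) (g h : G) : ρ.rep (g * h) = ρ.rep g * ρ.rep h := by
  simp [MPO.rep]

theorem MPO.rep_one (ρ : MPO G) : ρ.rep 1 = 1 := by
  simp [MPO.rep]

theorem MPO.purifiedRep_mul (ρ : MPO G) (e : ℕ) (g h : G) :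
    ρ.purifiedRep e (g * h) = ρ.purifiedRep e g * ρ.purifiedRep e h := by
  simp [MPO.purifiedRep, MPO.rep_mul, ← Matrix.mul_kronecker_mul]

theorem MPO.purifiedRep_one (ρ : MPO G) (e : ℕ) : ρ.purifiedRep e 1 = 1 := by
  simp [MPO.purifiedRep, MPO.rep_one]

/-- A local purification of a strong injective MPDO with strong symmetry has a class. -/
theorem MPO.IsLocalPurification.exists_class (hρ : ρ.IsStrongInjectiveMPDO)
    (hs : ρ.StronglySymmetric) {e D : ℕ} {A : Fin ρ.d × Fin e → Matrix (Fin D) (Fin D) ℂ}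
    (hA : ρ.IsLocalPurification A) : ∃ ω, HasSPTClass A (ρ.purifiedRep e) ω := by
  have hsp := hA.spans hρ.injective
  refine exists_hasSPTClass (hA.bond_pos hρ.bond_pos) hsp (ρ.purifiedRep_mul e) fun g => ?_
  refine hsp.exists_gauge (v := ρ.purifiedRep e g⁻¹) ?_ fun L hL => hA.symmetric hs L hL g
  rw [← ρ.purifiedRep_mul, inv_mul_cancel, ρ.purifiedRep_one]

theorem MPO.IsLocalPurification.isPureSPT (hρ : ρ.IsStrongInjectiveMPDO)
    (hs : ρ.StronglySymmetric) {e D : ℕ} {A : Fin ρ.d × Fin e → Matrix (Fin D) (Fin D) ℂ}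
    (hA : ρ.IsLocalPurification A) {ω : Z2 G} (h : HasSPTClass A (ρ.purifiedRep e) ω) :
    IsPureSPT A (ρ.purifiedRep e) ω :=
  ⟨hA.bond_pos hρ.bond_pos, (injectiveTensor_iff_spans _).2 (hA.spans hρ.injective),
    hA.symmetric hs, h⟩

/-- An operator on the ket and bra indices of the doubled tensor acts separately on the two copies of
the purification. -/
theorem act_kronecker_sum {a κ n : Type} [Fintype a] [Fintype κ] [DecidableEq κ]
    (P Q : Matrix a a ℂ) (A : a × κ → Matrix n n ℂ) (p : a × a) :
    act (P ⊗ₖ Q.map star) (fun p : a × a => ∑ k, A (p.1, k) ⊗ₖ (A (p.2, k)).map star) p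
      = ∑ k, act (P ⊗ₖ (1 : Matrix κ κ ℂ)) A (p.1, k)
        ⊗ₖ (act (Q ⊗ₖ (1 : Matrix κ κ ℂ)) A (p.2, k)).map star := by
  have h1 : ∀ (O : Matrix a a ℂ) i k, act (O ⊗ₖ (1 : Matrix κ κ ℂ)) A (i, k)
      = ∑ j, O i j • A (j, k) := by
    intro O i k
    simp only [act, Fintype.sum_prod_type, Matrix.kroneckerMap_apply, Matrix.one_apply]
    refine Finset.sum_congr rfl fun j _ => ?_
    simp [ite_smul]
  simp only [h1]
  ext ⟨x, y⟩ ⟨x', y'⟩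
  simp only [act, Matrix.sum_apply, Matrix.smul_apply, Matrix.kroneckerMap_apply, Matrix.map_apply,
    smul_eq_mul, star_sum, star_mul', Finset.mul_sum, Finset.sum_mul, Fintype.sum_prod_type]
  rw [Finset.sum_comm_cycle]
  refine Finset.sum_congr rfl fun k _ => ?_
  rw [Finset.sum_comm]
  refine Finset.sum_congr rfl fun j _ => Finset.sum_congr rfl fun i _ => ?_
  ring

/-- The class of a local purification is the phase of the mixed state: if `V(g)` is the virtual
symmetry of the purification, then `V(g) ⊗ V(h)*` is that of `(g, h)` for the doubled tensor. -/
theorem MPO.IsLocalPurification.inPhase {e D : ℕ}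
    {A : Fin ρ.d × Fin e → Matrix (Fin D) (Fin D) ℂ}
    (hA : ρ.IsLocalPurification A) {ω : Z2 G} (h : HasSPTClass A (ρ.purifiedRep e) ω) :
    ρ.InPhase ω := by
  obtain ⟨V, c, ω', hV, hm, hω⟩ := h
  obtain ⟨X, Y, hXY, hYX, hT⟩ := hA
  have hstar : ∀ P Q : Matrix (Fin D) (Fin D) ℂ, P.map star * Q.map star = (P * Q).map star :=
    fun P Q => (Matrix.map_mul (f := starRingEnd ℂ)).symm
  have hmul : ∀ P Q : Matrix (Fin D × Fin D) (Fin D × Fin D) ℂ,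
      (Y * P * X) * (Y * Q * X) = Y * (P * Q) * X := by
    intro P Q
    simp only [Matrix.mul_assoc]
    rw [← Matrix.mul_assoc X Y, hXY, Matrix.one_mul]
  have hone : Y * (1 : Matrix (Fin D × Fin D) (Fin D × Fin D) ℂ) * X = 1 := by rw [Matrix.mul_one, hYX]
  have hs1 : (1 : Matrix (Fin D) (Fin D) ℂ).map star = 1 := by simp
  let W : G × G → (Matrix (Fin ρ.χ) (Fin ρ.χ) ℂ)ˣ := fun p =>
    { val := Y * ((V p.1).val ⊗ₖ (V p.2).val.map star) * X
      inv := Y * (((V p.1)⁻¹).val ⊗ₖ ((V p.2)⁻¹).val.map star) * X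
      val_inv := by
        rw [hmul, ← Matrix.mul_kronecker_mul, hstar, Units.mul_inv, Units.mul_inv, hs1,
          Matrix.one_kronecker_one, hone]
      inv_val := by
        rw [hmul, ← Matrix.mul_kronecker_mul, hstar, Units.inv_mul, Units.inv_mul, hs1,
          Matrix.one_kronecker_one, hone] }
  refine ⟨W, fun p => c p.1 * (c p.2)⁻¹, doubledCocycle ω', ?_, ?_,
    cohClass_doubledCocycle_congr hω⟩
  · rintro ⟨g, h⟩ ⟨i, j⟩
    change act (ρ.doubledRep (g, h)) ρ.doubledTensor (i, j) = _
    have e0 : ∀ p, ρ.doubledTensor p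
        = Y * (∑ k, A (p.1, k) ⊗ₖ (A (p.2, k)).map star) * X := by
      intro p
      rw [← hT]
      simp only [Matrix.mul_assoc, hYX, Matrix.mul_one]
      rw [← Matrix.mul_assoc, hYX, Matrix.one_mul]; rfl
    have e1 : ρ.doubledTensor
        = fun p => Y * (∑ k, A (p.1, k) ⊗ₖ (A (p.2, k)).map star) * X := funext e0
    rw [e1]
    have e2 : act (ρ.doubledRep (g, h))
        (fun p => Y * (∑ k, A (p.1, k) ⊗ₖ (A (p.2, k)).map star) * X) (i, j)
        = Y * act (ρ.doubledRep (g, h))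
          (fun p => ∑ k, A (p.1, k) ⊗ₖ (A (p.2, k)).map star) (i, j) * X := by
      simp only [act, Matrix.mul_smul, Matrix.smul_mul, Matrix.mul_sum, Matrix.sum_mul]
    rw [e2]
    have e3 := act_kronecker_sum (κ := Fin e) (ρ.rep g) (ρ.rep h) A (i, j)
    rw [MPO.doubledRep, e3]
    have e4 : ∀ g i k, act (ρ.rep g ⊗ₖ (1 : Matrix (Fin e) (Fin e) ℂ)) A (i, k)
        = (c g : ℂ) • (((V g)⁻¹).val * A (i, k) * (V g).val) := fun g i k => hV g (i, k)
    simp only [e4]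
    have e5 : ∀ k, ((c g : ℂ) • (((V g)⁻¹).val * A (i, k) * (V g).val)) ⊗ₖ
        ((c h : ℂ) • (((V h)⁻¹).val * A (j, k) * (V h).val)).map star
        = ((c g * (c h)⁻¹ : Circle) : ℂ) • ((((V g)⁻¹).val ⊗ₖ ((V h)⁻¹).val.map star)
          * (A (i, k) ⊗ₖ (A (j, k)).map star) * ((V g).val ⊗ₖ (V h).val.map star)) := by
      intro k
      rw [← Matrix.mul_kronecker_mul, ← Matrix.mul_kronecker_mul, hstar, hstar]
      ext ⟨x, y⟩ ⟨x', y'⟩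
      simp only [Matrix.kroneckerMap_apply, Matrix.smul_apply, Matrix.map_apply, smul_eq_mul,
        star_mul', Circle.coe_mul, Circle.coe_inv_eq_conj]
      rw [Complex.star_def]; ring
    simp only [e5, ← Finset.smul_sum, ← Finset.sum_mul, ← Finset.mul_sum]
    change _ = ((c g * (c h)⁻¹ : Circle) : ℂ) • ((Y * (((V g)⁻¹).val ⊗ₖ ((V h)⁻¹).val.map star) * X)
      * (Y * _ * X) * (Y * ((V g).val ⊗ₖ (V h).val.map star) * X))
    rw [hmul, hmul, Matrix.mul_smul, Matrix.smul_mul]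
  · intro p q
    change (Y * _ * X) * (Y * _ * X) = _ • (Y * _ * X)
    rw [hmul, ← Matrix.mul_kronecker_mul, hstar, hm, hm, phase_doubledCocycle,
      ← Matrix.smul_mul, ← Matrix.mul_smul]
    congr 2
    ext ⟨x, y⟩ ⟨x', y'⟩
    simp only [Matrix.kroneckerMap_apply, Matrix.smul_apply, Matrix.map_apply, smul_eq_mul,
        star_mul', Prod.fst_mul, Prod.snd_mul]
    ring

/-- The symmetry acting on the ket index alone detects the phase. -/
theorem MPO.InPhase.leftClass {ω : Z2 G} (h : ρ.InPhase ω) :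
    HasSPTClass ρ.doubledTensor (ρ.purifiedRep ρ.d) ω := by
  obtain ⟨V, c, ω', hV, hm, hω⟩ := h
  obtain ⟨ω₁, h₁⟩ := exists_restrict ω'
  refine ⟨fun g => V (g, 1), fun g => c (g, 1), ω₁, fun g i => ?_, fun g h => ?_,
    cohClass_restrict_doubledCocycle hω h₁⟩
  · rw [← hV]
    simp [MPO.purifiedRep, MPO.doubledRep, MPO.rep_one]
  · rw [hm, h₁]
    simp

theorem MPO.InPhase.unique (hρ : ρ.IsStrongInjectiveMPDO) {ω ω' : Z2 G}
    (h : ρ.InPhase ω) (h' : ρ.InPhase ω') : cohClass ω = cohClass ω' :=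
  HasSPTClass.unique hρ.bond_pos ((injectiveTensor_iff_spans _).1 hρ.injective)
    h.leftClass h'.leftClass

theorem HasSPTClass.congr {H : Type} [Group H] {ι : Type} [Fintype ι] {D : ℕ}
    {A : ι → Matrix (Fin D) (Fin D) ℂ} {R : H → Matrix ι ι ℂ} {ω ω' : Z2 H}
    (h : HasSPTClass A R ω) (hω : cohClass ω = cohClass ω') : HasSPTClass A R ω' := by
  obtain ⟨V, c, ω₁, hV, hm, h₁⟩ := h
  exact ⟨V, c, ω₁, hV, hm, h₁.trans hω⟩

theorem MPO.InPhase.congr {ω ω' : Z2 G} (h : ρ.InPhase ω) (hω : cohClass ω = cohClass ω') :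
    ρ.InPhase ω' :=
  HasSPTClass.congr h (cohClass_doubledCocycle_congr hω)

/-- Every local purification of a state in the phase `[ω]` is in the class `[ω]`, because it has some
class, and this class is the phase. -/
theorem MPO.InPhase.isPureSPT (hρ : ρ.IsStrongInjectiveMPDO)
    (hs : ρ.StronglySymmetric) {e D : ℕ} {A : Fin ρ.d × Fin e → Matrix (Fin D) (Fin D) ℂ}
    (hA : ρ.IsLocalPurification A) {ω : Z2 G} (h : ρ.InPhase ω) :
    IsPureSPT A (ρ.purifiedRep e) ω := by
  obtain ⟨ω', h'⟩ := hA.exists_class hρ hs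
  exact hA.isPureSPT hρ hs (h'.congr ((hA.inPhase h').unique hρ h))

end Phase

/-! ### Purifications and onsite channels -/

/-- The matrix of the superoperator `krausMap K`. -/
def superOp {κ a b : Type} [Fintype κ] (K : κ → Matrix b a ℂ) : Matrix (b × b) (a × a) ℂ :=
  Matrix.of fun p q => ∑ k, K k p.1 q.1 * star (K k p.2 q.2)

theorem krausMap_apply {κ a b : Type} [Fintype κ] [Fintype a] (K : κ → Matrix b a ℂ)
    (X : Matrix a a ℂ) (i j : b) :
    krausMap K X i j = (superOp K).mulVec (fun p => X p.1 p.2) (i, j) := by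
  simp only [krausMap, superOp, Matrix.mulVec, dotProduct, Matrix.sum_apply, Matrix.mul_apply,
    Matrix.of_apply, Fintype.sum_prod_type, Finset.sum_mul, Matrix.conjTranspose_apply]
  conv_rhs => rw [Finset.sum_comm_cycle]
  refine Finset.sum_congr rfl fun k _ => ?_
  rw [Finset.sum_comm]
  refine Finset.sum_congr rfl fun j _ => Finset.sum_congr rfl fun i _ => ?_
  ring

theorem superOp_mulVec_injective {κ a b : Type} [Fintype κ] [Fintype a] {K : κ → Matrix b a ℂ} :
    Function.Injective (superOp K).mulVec ↔ Function.Injective (krausMap K) := by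
  have hk : ∀ X : Matrix a a ℂ, (superOp K).mulVec (fun p => X p.1 p.2)
      = fun p => krausMap K X p.1 p.2 := fun X => funext fun p => (krausMap_apply K X p.1 p.2).symm
  constructor
  · intro h X X' e
    have := h (a₁ := fun p => X p.1 p.2) (a₂ := fun p => X' p.1 p.2) (by rw [hk, hk, e])
    ext i j
    exact congrFun this (i, j)
  · intro h v w e
    have h1 := hk (Matrix.of fun i j => v (i, j))
    have h2 := hk (Matrix.of fun i j => w (i, j))
    have := h (a₁ := Matrix.of fun i j => v (i, j)) (a₂ := Matrix.of fun i j => w (i, j)) (by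
      ext i j
      have := congrFun (h1.symm.trans (e.trans h2)) (i, j)
      exact this)
    funext p
    exact congrFun (congrFun this p.1) p.2

/-- An injective map on the physical index preserves injectivity. -/
theorem Spans.act_of_injective {ι κ n : Type} [Fintype ι] {C : ι → Matrix n n ℂ} (hC : Spans C)
    {N : Matrix κ ι ℂ} (hN : Function.Injective N.mulVec) : Spans (act N C) := by
  by_contra hne
  obtain ⟨f, hf, hle⟩ := Submodule.exists_le_ker_of_lt_top _ (lt_top_iff_ne_top.2 hne)
  apply hf
  have h0 : N.mulVec (fun q => f (C q)) = N.mulVec 0 := by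
    funext p
    have : f (act N C p) = 0 := hle (Submodule.subset_span ⟨p, rfl⟩)
    simpa [act, Matrix.mulVec, dotProduct] using this
  exact hC.ext fun i => by simpa using congrFun (hN h0) i

theorem Spans.kronecker {ι n : Type} [Fintype n] [DecidableEq n] {B : ι → Matrix n n ℂ}
    (hB : Spans B) : Spans fun p : ι × ι => B p.1 ⊗ₖ (B p.2).map star := by
  by_contra hne
  obtain ⟨f, hf, hle⟩ := Submodule.exists_le_ker_of_lt_top _ (lt_top_iff_ne_top.2 hne)
  apply hf
  have hfB : ∀ i j, f (B i ⊗ₖ (B j).map star) = 0 :=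
    fun i j => hle (Submodule.subset_span ⟨(i, j), rfl⟩)
  have h1 : ∀ P j, f (P ⊗ₖ (B j).map star) = 0 := by
    intro P j
    let F : Matrix n n ℂ →ₗ[ℂ] ℂ :=
      { toFun := fun P => f (P ⊗ₖ (B j).map star)
        map_add' := fun P P' => by rw [Matrix.add_kronecker, map_add]
        map_smul' := fun c P => by rw [Matrix.smul_kronecker, map_smul]; rfl }
    have : F = 0 := hB.ext fun i => hfB i j
    exact LinearMap.congr_fun this P
  have h2 : ∀ P Q : Matrix n n ℂ, f (P ⊗ₖ Q) = 0 := by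
    intro P Q
    let F : Matrix n n ℂ →ₗ[ℂ] ℂ :=
      { toFun := fun Q => star (f (P ⊗ₖ Q.map star))
        map_add' := fun Q Q' => by
          rw [Matrix.map_add _ (fun a b => star_add a b), Matrix.kronecker_add, map_add, star_add]
        map_smul' := fun c Q => by
          have : (c • Q).map star = star c • Q.map star := by ext; simp
          rw [this, Matrix.kronecker_smul, map_smul, smul_eq_mul, star_mul', star_star]; rfl }
    have hF : F = 0 := hB.ext fun j => by
      change star (f (P ⊗ₖ (B j).map star)) = 0
      rw [h1, star_zero]
    have h3 : star (f (P ⊗ₖ (Q.map star).map star)) = 0 := LinearMap.congr_fun hF (Q.map star)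
    have h4 : (Q.map star).map star = Q := by ext; simp
    rw [h4] at h3
    exact star_eq_zero.1 h3
  ext M
  rw [Matrix.matrix_eq_sum_single M]
  simp only [map_sum, LinearMap.zero_apply, Finset.sum_const_zero]
  refine Finset.sum_eq_zero fun x _ => Finset.sum_eq_zero fun y _ => ?_
  have := h2 (Matrix.single x.1 y.1 (M x y)) (Matrix.single x.2 y.2 1)
  rw [Matrix.single_kronecker_single] at this
  simpa using this

/-- The tensor of `(K ⊗ K̄) (B ⊗ B̄)` as the partial trace of the tensor `A^{ik} = ∑_q (Kₖ)_{iq} B^q`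
over the Kraus index. -/
theorem act_superOp {κ a b n : Type} [Fintype κ] [Fintype a] (K : κ → Matrix b a ℂ)
    (B : a → Matrix n n ℂ) (p : b × b) :
    act (superOp K) (fun q : a × a => B q.1 ⊗ₖ (B q.2).map star) p
      = ∑ k, act (K k) B p.1 ⊗ₖ (act (K k) B p.2).map star := by
  ext ⟨x, y⟩ ⟨x', y'⟩
  simp only [act, superOp, Matrix.of_apply, Matrix.sum_apply, Matrix.smul_apply,
    Matrix.kroneckerMap_apply, Matrix.map_apply,
    smul_eq_mul, star_sum, star_mul', Finset.mul_sum, Finset.sum_mul, Fintype.sum_prod_type]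
  rw [Finset.sum_comm_cycle]
  refine Finset.sum_congr rfl fun k _ => ?_
  rw [Finset.sum_comm]
  refine Finset.sum_congr rfl fun j _ => Finset.sum_congr rfl fun i _ => ?_
  ring

/-- The onsite channel applied to a pure matrix product state is given by the tensors
`∑ₖ A^{ik} ⊗ (A^{jk})*` with `A^{ik} = ∑_q (Kₖ)_{iq} B^q`. -/
theorem onsiteChannel_mpsDensity {κ a b : Type} [Fintype κ] [Fintype a] {D : ℕ}
    (K : κ → Matrix b a ℂ) (B : a → Matrix (Fin D) (Fin D) ℂ) (L : ℕ) (s t : Fin L → b) :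
    onsiteChannel K L (mpsDensity B L) s t = (List.ofFn fun x =>
      ∑ k, act (K k) B (s x) ⊗ₖ (act (K k) B (t x)).map star).prod.trace := by
  rw [chain_sum_kronecker (fun i k => act (K k) B i) (fun i k => act (K k) B i)]
  simp only [onsiteChannel, krausMap, Matrix.sum_apply, mpsDensity]
  refine Finset.sum_congr rfl fun k _ => ?_
  have h1 : ∀ s : Fin L → b, (tensorOp fun x => K (k x)).mulVec (mps B L) s
      = chain (fun _ (i : b × κ) => act (K i.2) B i.1) (fun x => (s x, k x)) := fun s =>
    congrFun (siteOp_mulVec_chain (fun x : Fin L => K (k x)) fun _ => B) s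
  rw [← h1, ← h1, Matrix.mul_vecMulVec, Matrix.vecMulVec_mul, Matrix.vecMulVec_apply,
    ← Matrix.star_mulVec]
  rfl

/-! ### Pure SPT states and onsite channels -/

/-- A tensor on which the symmetry acts by gauge transformations and phases generates symmetric
states. -/
theorem symmetricMPS_of_gauge {H ι : Type} [Fintype ι] {D : ℕ}
    {A : ι → Matrix (Fin D) (Fin D) ℂ} {R : H → Matrix ι ι ℂ}
    {V : H → (Matrix (Fin D) (Fin D) ℂ)ˣ} {c : H → Circle}
    (h : ∀ g i, act (R g) A i = (c g : ℂ) • (((V g)⁻¹).val * A i * (V g).val)) :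
    SymmetricMPS A R := by
  intro L _ g
  refine ⟨c g ^ L, ?_⟩
  have h1 := siteOp_mulVec_chain (fun _ : Fin L => R g) fun _ => A
  have h2 : act (R g) A = fun i => (c g : ℂ) • (((V g)⁻¹).val * A i * (V g).val) := funext (h g)
  rw [h2, chain_smul (fun _ => (c g : ℂ)), chain_conj (Units.inv_mul _) (Units.mul_inv _)] at h1
  rw [Fin.prod_const] at h1
  rw [Circle.coe_pow]
  exact h1

/-- Polar decomposition of an injective tensor `A`, seen as a linear map from the virtual to the
physical space: `A = W ∘ B` with an isometry `W` and an invertible `B`. The functionals `f` are dual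
to the matrices of `B`. -/
theorem Spans.exists_isometry {p : Type} [Fintype p] {D : ℕ} {A : p → Matrix (Fin D) (Fin D) ℂ}
    (hA : Spans A) : ∃ (W : Matrix p (Fin (D * D)) ℂ) (B : Fin (D * D) → Matrix (Fin D) (Fin D) ℂ)
      (f : Fin (D * D) → Matrix (Fin D) (Fin D) ℂ →ₗ[ℂ] ℂ),
      W.conjTranspose * W = 1 ∧ act W B = A ∧ (∀ i m, W i m = f m (A i)) ∧
      ∀ q m, f m (B q) = (1 : Matrix (Fin (D * D)) (Fin (D * D)) ℂ) q m := by
  let e : Fin D × Fin D ≃ Fin (D * D) := finProdFinEquiv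
  let 𝒜 : Matrix p (Fin (D * D)) ℂ := Matrix.of fun i m => A i (e.symm m).1 (e.symm m).2
  have hinj : Function.Injective 𝒜.mulVec := by
    intro x y hxy
    have h1 := (injectiveTensor_iff_spans A).2 hA
    have : (Matrix.of fun α β => x (e (α, β)) : Matrix (Fin D) (Fin D) ℂ)
        = Matrix.of fun α β => y (e (α, β)) := by
      apply h1
      funext i
      have h2 := congrFun hxy i
      simp only [Matrix.mulVec, dotProduct] at h2
      rw [← e.sum_comp, ← e.sum_comp (fun m => 𝒜 i m * y m), Fintype.sum_prod_type,
        Fintype.sum_prod_type] at h2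
      simpa [𝒜] using h2
    funext m
    have h3 := congrFun (congrFun this (e.symm m).1) (e.symm m).2
    simpa using h3
  have hpd : (𝒜.conjTranspose * 𝒜).PosDef := Matrix.PosDef.conjTranspose_mul_self _ hinj
  -- with `A†A = S†S`, the isometry is `A S⁻¹` and the tensor `B` consists of the rows of `S`
  obtain ⟨S, hS, hSS⟩ : ∃ S : Matrix (Fin (D * D)) (Fin (D * D)) ℂ, IsUnit S ∧
      𝒜.conjTranspose * 𝒜 = S.conjTranspose * S := by
    open scoped MatrixOrder Matrix.Norms.L2Operator in
    obtain ⟨S, hS⟩ := CStarAlgebra.nonneg_iff_eq_star_mul_self.1 hpd.posSemidef.nonneg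
    refine ⟨S, ?_, hS⟩
    have h1 := hpd.isUnit
    rw [hS] at h1
    exact isUnit_of_mul_isUnit_right h1
  have hdet : IsUnit S.det := (Matrix.isUnit_iff_isUnit_det _).1 hS
  have h1 : S * S⁻¹ = 1 := Matrix.mul_nonsing_inv _ hdet
  have h2 : S⁻¹ * S = 1 := Matrix.nonsing_inv_mul _ hdet
  let f : Fin (D * D) → Matrix (Fin D) (Fin D) ℂ →ₗ[ℂ] ℂ := fun m =>
    { toFun := fun M => ∑ q, M (e.symm q).1 (e.symm q).2 * S⁻¹ q m
      map_add' := fun M N => by simp [add_mul, Finset.sum_add_distrib]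
      map_smul' := fun c M => by simp [Finset.mul_sum, mul_assoc] }
  refine ⟨𝒜 * S⁻¹, fun q => Matrix.of fun α β => S q (e (α, β)), f, ?_, ?_, ?_, ?_⟩
  · rw [Matrix.conjTranspose_mul, Matrix.mul_assoc, ← Matrix.mul_assoc 𝒜.conjTranspose, hSS,
      Matrix.mul_assoc, h1, Matrix.mul_one, ← Matrix.conjTranspose_mul, h1,
      Matrix.conjTranspose_one]
  · funext i
    ext α β
    have h3 : (𝒜 * S⁻¹ * S) i (e (α, β)) = A i α β := by
      rw [Matrix.mul_assoc, h2, Matrix.mul_one]; simp [𝒜]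
    rw [← h3]
    simp [act, Matrix.mul_apply, Matrix.sum_apply]
  · intro i m
    rfl
  · intro q m
    rw [← h1]
    simp [f, Matrix.mul_apply]

/-- A unitary representation restricted to an invariant subspace, given by an isometry `W`. -/
theorem exists_restrict_rep {G p m : Type} [Group G] [Fintype p] [DecidableEq p] [Fintype m]
    [DecidableEq m] (u : G → Matrix p p ℂ) (h1 : u 1 = 1) (hmul : ∀ g h, u (g * h) = u g * u h)
    (hu : ∀ g, (u g).conjTranspose * u g = 1)
    (W : Matrix p m ℂ) (hW : W.conjTranspose * W = 1) (T : G → Matrix m m ℂ)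
    (hT : ∀ g, u g * W = W * T g) :
    ∃ U' : G →* Matrix.unitaryGroup m ℂ, ∀ g, u g * W = W * (U' g).val := by
  have hT' : ∀ g, T g = W.conjTranspose * (u g * W) := fun g => by
    rw [hT, ← Matrix.mul_assoc, hW, Matrix.one_mul]
  refine ⟨⟨⟨fun g => ⟨T g, ?_⟩, ?_⟩, ?_⟩, hT⟩
  · rw [Matrix.mem_unitaryGroup_iff', Matrix.star_eq_conjTranspose]
    have : (T g).conjTranspose * W.conjTranspose = W.conjTranspose * (u g).conjTranspose := by
      rw [← Matrix.conjTranspose_mul, ← hT, Matrix.conjTranspose_mul]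
    calc (T g).conjTranspose * T g = (T g).conjTranspose * W.conjTranspose * (W * T g) := by
          rw [Matrix.mul_assoc, ← Matrix.mul_assoc W.conjTranspose, hW, Matrix.one_mul]
      _ = 1 := by
          rw [this, ← hT, Matrix.mul_assoc, ← Matrix.mul_assoc (u g).conjTranspose, hu,
            Matrix.one_mul, hW]
  · refine Subtype.ext ?_
    change T 1 = 1
    rw [hT', h1, Matrix.one_mul, hW]
  · intro g h
    refine Subtype.ext ?_
    change T (g * h) = T g * T h
    rw [hT', hmul, Matrix.mul_assoc, hT h, ← Matrix.mul_assoc (u g), hT g, Matrix.mul_assoc,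
      ← Matrix.mul_assoc, hW, Matrix.one_mul]

section

variable {G : Type} [Group G] {ρ : MPO G}

theorem MPO.rep_unitary (ρ : MPO G) (g : G) : (ρ.rep g).conjTranspose * ρ.rep g = 1 :=
  Matrix.mem_unitaryGroup_iff'.1 (ρ.U g).2

theorem MPO.purifiedRep_unitary (ρ : MPO G) (e : ℕ) (g : G) :
    (ρ.purifiedRep e g).conjTranspose * ρ.purifiedRep e g = 1 := by
  rw [MPO.purifiedRep, Matrix.conjTranspose_kronecker, ← Matrix.mul_kronecker_mul, ρ.rep_unitary]
  simp

/-- A local purification `A = W ∘ B` gives a pure state with tensor `B` and an onsite channel that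
applies the isometry `W` and traces out the ancilla. The channel is non-degenerate because the
tensor of the doubled state is injective. -/
theorem MPO.IsLocalPurification.exists_channel (hρ : InjectiveTensor ρ.doubledTensor) {e D : ℕ}
    {A : Fin ρ.d × Fin e → Matrix (Fin D) (Fin D) ℂ} (hA : ρ.IsLocalPurification A)
    {V : G → (Matrix (Fin D) (Fin D) ℂ)ˣ} {c : G → Circle}
    (hV : ∀ g i, act (ρ.purifiedRep e g) A i = (c g : ℂ) • (((V g)⁻¹).val * A i * (V g).val)) :
    ∃ (U' : G →* Matrix.unitaryGroup (Fin (D * D)) ℂ)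
      (B : Fin (D * D) → Matrix (Fin D) (Fin D) ℂ) (K : Fin e → Matrix (Fin ρ.d) (Fin (D * D)) ℂ),
      (∀ g i, act (U' g).val B i = (c g : ℂ) • (((V g)⁻¹).val * B i * (V g).val)) ∧
      Spans B ∧ IsSymNondegChannel (fun g => (U' g).val) ρ.rep K ∧
      ∀ k i, act (K k) B i = A (i, k) := by
  have hsp := hA.spans hρ
  obtain ⟨W, B, f, hW, hWB, hf, hfB⟩ := hsp.exists_isometry
  -- the gauge transformation keeps the range of `W` invariant, and acts on it by `T g`
  let T : G → Matrix (Fin (D * D)) (Fin (D * D)) ℂ := fun g => Matrix.of fun q m =>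
    f m ((c g : ℂ) • (((V g)⁻¹).val * B q * (V g).val))
  have hT : ∀ g, ρ.purifiedRep e g * W = W * T g := by
    intro g
    ext i m
    have h1 : (ρ.purifiedRep e g * W) i m = f m (act (ρ.purifiedRep e g) A i) := by
      simp [Matrix.mul_apply, act, hf]
    have h2 : A i = ∑ q, W i q • B q := by rw [← hWB]; rfl
    rw [h1, hV, h2]
    simp only [Matrix.mul_sum, Matrix.sum_mul, Matrix.mul_smul, Matrix.smul_mul, Finset.smul_sum,
      map_sum, Matrix.mul_apply, T, Matrix.of_apply]
    refine Finset.sum_congr rfl fun q _ => ?_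
    rw [smul_comm, map_smul, smul_eq_mul]
  obtain ⟨U', hU'⟩ := exists_restrict_rep _ (ρ.purifiedRep_one e) (ρ.purifiedRep_mul e)
    (ρ.purifiedRep_unitary e) W hW T hT
  have hB : act W.conjTranspose A = B := by rw [← hWB, act_act, hW, act_one]
  have hBA : ∀ g, act (U' g).val B = act W.conjTranspose (act (ρ.purifiedRep e g) A) := by
    intro g
    rw [← hWB, act_act, act_act, Matrix.mul_assoc, hU', ← Matrix.mul_assoc, hW, Matrix.one_mul]
  have hK : ∀ k i, act (Matrix.of fun i q => W (i, k) q : Matrix (Fin ρ.d) (Fin (D * D)) ℂ) B i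
      = A (i, k) := fun k i => by rw [← hWB]; rfl
  refine ⟨U', B, fun k => Matrix.of fun i q => W (i, k) q, ?_, ?_, ⟨?_, ?_, ?_⟩, hK⟩
  · intro g i
    have h1 : act (ρ.purifiedRep e g) A
        = fun i => (c g : ℂ) • (((V g)⁻¹).val * A i * (V g).val) := funext (hV g)
    rw [hBA, h1, act_smul, act_mul_mul, hB]
  · have : ∀ i, A i ∈ Submodule.span ℂ (Set.range B) := fun i => by
      rw [← hWB]
      exact Submodule.sum_mem _ fun j _ => Submodule.smul_mem _ _ (Submodule.subset_span ⟨j, rfl⟩)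
    unfold Spans at hsp ⊢
    rw [eq_top_iff, ← hsp, Submodule.span_le]
    rintro _ ⟨i, rfl⟩
    exact this i
  · rw [← hW]
    ext q m
    simp only [Matrix.sum_apply, Matrix.mul_apply, Matrix.conjTranspose_apply, Matrix.of_apply,
      Fintype.sum_prod_type]
    rw [Finset.sum_comm]
  · rw [← superOp_mulVec_injective]
    -- a vector `x` in the kernel gives a functional that vanishes on the doubled tensor
    obtain ⟨X, Y, hXY, hYX, hT⟩ := hA
    have hspan := ((injectiveTensor_iff_spans _).1 hρ).conj hXY
    rw [← Matrix.coe_mulVecLin, ← LinearMap.ker_eq_bot, LinearMap.ker_eq_bot']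
    intro x hx
    let F : Fin (D * D) → Matrix (Fin D × Fin D) (Fin D × Fin D) ℂ →ₗ[ℂ] Matrix (Fin D) (Fin D) ℂ :=
      fun q => {
        toFun := fun M => Matrix.of fun α β =>
          star (f q (Matrix.of fun γ δ => star (M (α, γ) (β, δ))))
        map_add' := fun M N => by
          ext α β
          simp only [Matrix.of_apply, Matrix.add_apply, star_add]
          rw [← star_add, ← map_add]; rfl
        map_smul' := fun a M => by
          ext α β
          simp only [Matrix.of_apply, Matrix.smul_apply, smul_eq_mul, star_mul', RingHom.id_apply]
          have : (Matrix.of fun γ δ => star a * star (M (α, γ) (β, δ)))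
              = star a • Matrix.of fun γ δ => star (M (α, γ) (β, δ)) := rfl
          rw [this, map_smul, smul_eq_mul, star_mul', star_star] }
    have hF : ∀ q P Q, F q (P ⊗ₖ Q.map star) = star (f q Q) • P := by
      intro q P Q
      ext α β
      have : (Matrix.of fun γ δ => star ((P ⊗ₖ Q.map star) (α, γ) (β, δ))) = star (P α β) • Q := by
        ext γ δ; simp
      change star (f q (Matrix.of fun γ δ => star ((P ⊗ₖ Q.map star) (α, γ) (β, δ)))) = _
      rw [this, map_smul, smul_eq_mul, star_mul', star_star, Matrix.smul_apply, smul_eq_mul,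
        mul_comm]
    let φ : Matrix (Fin D × Fin D) (Fin D × Fin D) ℂ →ₗ[ℂ] ℂ :=
      ∑ q, ∑ q', x (q, q') • (f q ∘ₗ F q')
    have hφ : ∀ P Q, φ (P ⊗ₖ Q.map star) = ∑ q, ∑ q', x (q, q') * (f q P * star (f q' Q)) := by
      intro P Q
      simp only [φ, LinearMap.sum_apply, LinearMap.smul_apply, LinearMap.comp_apply, hF, map_smul,
        smul_eq_mul]
      exact Finset.sum_congr rfl fun _ _ => Finset.sum_congr rfl fun _ _ => by ring
    have hφ0 : φ = 0 := hspan.ext fun p => by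
      have h1 := congrFun hx p
      simp only [Matrix.mulVecLin_apply, Matrix.mulVec, dotProduct, superOp, Matrix.of_apply,
        Fintype.sum_prod_type, Pi.zero_apply, Finset.sum_mul] at h1
      change φ (X * ρ.tensor p.1 p.2 * Y) = 0
      rw [hT, map_sum, ← h1]
      simp only [hφ, ← hf]
      conv_rhs => rw [Finset.sum_comm_cycle]
      exact Finset.sum_congr rfl fun k _ => Finset.sum_congr rfl fun q _ =>
        Finset.sum_congr rfl fun q' _ => by ring
    funext ⟨q, q'⟩
    have h1 := hφ (B q) (B q')
    rw [hφ0] at h1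
    simp only [hfB, Matrix.one_apply, LinearMap.zero_apply] at h1
    simpa [apply_ite] using h1.symm
  · refine ⟨fun _ => 1, fun g k => ?_⟩
    have h1 : ρ.rep g * (Matrix.of fun i q => W (i, k) q)
        = (Matrix.of fun i q => W (i, k) q) * (U' g).val := by
      ext i q
      have := congrFun (congrFun (hU' g) (i, k)) q
      simp only [Matrix.mul_apply, Matrix.of_apply, MPO.purifiedRep, Matrix.kroneckerMap_apply,
        Matrix.one_apply, Fintype.sum_prod_type] at this ⊢
      simpa using this
    rw [h1, Matrix.mul_assoc, ← Matrix.star_eq_conjTranspose,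
      Matrix.mem_unitaryGroup_iff.1 (U' g).2, Matrix.mul_one]
    simp

theorem MPO.fromPureSPT_of_isPureSPT (hρ : InjectiveTensor ρ.doubledTensor) {e D : ℕ}
    {A : Fin ρ.d × Fin e → Matrix (Fin D) (Fin D) ℂ} (hA : ρ.IsLocalPurification A) {ω : Z2 G}
    (h : IsPureSPT A (ρ.purifiedRep e) ω) : ρ.FromPureSPT ω := by
  obtain ⟨V, c, ω', hV, hm, hω⟩ := h.sptClass
  obtain ⟨U', B, K, hB, hsp, hK, hKB⟩ := hA.exists_channel hρ hV
  refine ⟨D * D, D, e, U', B, K, ⟨h.bond_pos, (injectiveTensor_iff_spans _).2 hsp,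
    symmetricMPS_of_gauge hB, ⟨V, c, ω', hB, hm, hω⟩⟩, hK, fun L _ => ⟨1, one_pos, ?_⟩⟩
  ext s t
  rw [Complex.ofReal_one, one_smul, onsiteChannel_mpsDensity, ρ.state_eq_sum hA]
  simp only [hKB]
  rw [chain_sum_kronecker (fun i k => A (i, k)) (fun i k => A (i, k))]
  rfl

/-- Two injective operator tensors that generate proportional states on all rings are related by a
gauge transformation, so the image of a pure SPT state under a non-degenerate onsite channel is the
local purification by the Kraus index, up to normalization. -/
theorem MPO.FromPureSPT.exists_purification (hρ : ρ.IsStrongInjectiveMPDO)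
    (hs : ρ.StronglySymmetric) {ω : Z2 G} (h : ρ.FromPureSPT ω) :
    ∃ (e D : ℕ) (A : Fin ρ.d × Fin e → Matrix (Fin D) (Fin D) ℂ),
      ρ.IsLocalPurification A ∧ IsPureSPT A (ρ.purifiedRep e) ω := by
  obtain ⟨m, D, e, U', B, K, hB, hK, hst⟩ := h
  let A₀ : Fin ρ.d × Fin e → Matrix (Fin D) (Fin D) ℂ := fun p => act (K p.2) B p.1
  have hBsp := (injectiveTensor_iff_spans _).1 hB.injective
  have hsp₀ : Spans fun p : Fin ρ.d × Fin ρ.d => ∑ k, A₀ (p.1, k) ⊗ₖ (A₀ (p.2, k)).map star := by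
    have := hBsp.kronecker.act_of_injective (superOp_mulVec_injective.2 hK.nondegenerate)
    have e : act (superOp K) (fun q : Fin m × Fin m => B q.1 ⊗ₖ (B q.2).map star)
      = fun p : Fin ρ.d × Fin ρ.d => ∑ k, A₀ (p.1, k) ⊗ₖ (A₀ (p.2, k)).map star :=
      funext fun p => act_superOp K B p
    rwa [e] at this
  have hc : ∀ L : ℕ, 0 < L → ∃ r : ℝ, 0 < r ∧ ∀ p : Fin L → Fin ρ.d × Fin ρ.d,
      (List.ofFn fun x => ∑ k, A₀ ((p x).1, k) ⊗ₖ (A₀ ((p x).2, k)).map star).prod.trace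
        = (r : ℂ) * (List.ofFn fun x => ρ.doubledTensor (p x)).prod.trace := by
    intro L hL
    obtain ⟨r, hr, hrX⟩ := hst L hL
    refine ⟨r⁻¹, inv_pos.2 hr, fun p => ?_⟩
    have h1 := congrFun (congrFun hrX fun x => (p x).1) fun x => (p x).2
    rw [Matrix.smul_apply, onsiteChannel_mpsDensity, ρ.state_eq_mps] at h1
    change (List.ofFn fun x => ρ.doubledTensor (p x)).prod.trace = _ at h1
    rw [h1]
    have : (r : ℂ) ≠ 0 := by exact_mod_cast hr.ne'
    push_cast
    rw [smul_eq_mul, inv_mul_cancel_left₀ this]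
  obtain ⟨t₂, h₂, h₂'⟩ := hc 2 two_pos
  obtain ⟨t₃, h₃, h₃'⟩ := hc 3 three_pos
  have c₂ : (t₂ : ℂ) ≠ 0 := by exact_mod_cast h₂.ne'
  have c₃ : (t₃ : ℂ) ≠ 0 := by exact_mod_cast h₃.ne'
  obtain ⟨X, Y, hXY, hYX, hX⟩ := exists_conj_of_trace_eq
    ((injectiveTensor_iff_spans _).1 hρ.injective) hsp₀ c₂ c₃
    (fun i j => by simpa using h₂' ![i, j]) (fun i j k => by simpa [mul_assoc] using h₃' ![i, j, k])
  -- the normalization is absorbed in the purification, whose tensor enters quadratically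
  set r : ℝ := Real.sqrt (t₃ / t₂)⁻¹ with hr
  have hrr : (r : ℂ) * r = ((t₃ : ℂ) / t₂)⁻¹ := by
    rw [← Complex.ofReal_mul, hr, Real.mul_self_sqrt (by positivity)]
    push_cast; rfl
  have hA : ρ.IsLocalPurification fun p => (r : ℂ) • A₀ p := by
    refine ⟨X, Y, hXY, hYX, fun i j => ?_⟩
    have h1 := hX (i, j)
    have h2 : X * ρ.tensor i j * Y
        = ((r : ℂ) * r) • ∑ k, A₀ (i, k) ⊗ₖ (A₀ (j, k)).map star := by
      rw [h1, hrr, smul_smul, inv_mul_cancel₀ (div_ne_zero c₃ c₂), one_smul]; rfl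
    rw [h2, Finset.smul_sum]
    refine Finset.sum_congr rfl fun k _ => ?_
    ext ⟨x, y⟩ ⟨x', y'⟩
    simp only [Matrix.kroneckerMap_apply, Matrix.smul_apply, Matrix.map_apply, smul_eq_mul,
        Complex.star_def, map_mul, Complex.conj_ofReal]
    ring
  refine ⟨e, D, _, hA, hA.isPureSPT hρ hs ?_⟩
  obtain ⟨V, c, ω', hV, hm, hω⟩ := hB.sptClass
  obtain ⟨θ, hθ⟩ := hK.stronglySymmetric
  refine ⟨V, fun g => θ g * c g, ω', fun g i => ?_, hm, hω⟩
  change act (ρ.purifiedRep e g) (fun p => (r : ℂ) • A₀ p) i = _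
  obtain ⟨i, k⟩ := i
  rw [act_smul]
  change (r : ℂ) • act (ρ.purifiedRep e g) A₀ (i, k)
    = ((θ g * c g : Circle) : ℂ) • (((V g)⁻¹).val * ((r : ℂ) • act (K k) B i) * (V g).val)
  have h1 : act (ρ.purifiedRep e g) A₀ (i, k) = act (ρ.rep g * K k) B i := by
    rw [← act_act]
    simp [act, MPO.purifiedRep, Fintype.sum_prod_type, Matrix.one_apply, ite_smul, A₀]
  have h2 : ρ.rep g * K k = (θ g : ℂ) • (K k * (U' g).val) := by
    rw [← Matrix.smul_mul, ← hθ, Matrix.mul_assoc, ← Matrix.star_eq_conjTranspose,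
      Matrix.mem_unitaryGroup_iff'.1 (U' g).2, Matrix.mul_one]
  have h3 : act (U' g).val B = fun i => (c g : ℂ) • (((V g)⁻¹).val * B i * (V g).val) :=
    funext (hV g)
  rw [h1, h2, smul_act, ← act_act, h3, act_smul, act_mul_mul]
  simp only [Matrix.mul_smul, Matrix.smul_mul, smul_smul, Circle.coe_mul]
  congr 1
  ring

/-- The four characterizations of a mixed-state SPT phase. -/
theorem MPO.tfae (hρ : ρ.IsStrongInjectiveMPDO) (hs : ρ.StronglySymmetric) (ω : Z2 G) :
    List.TFAE [
        ρ.InPhase ω ∧ ρ.LocallyPurifiable,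
        ∃ (e D : ℕ) (A : Fin ρ.d × Fin e → Matrix (Fin D) (Fin D) ℂ),
          ρ.IsLocalPurification A ∧ SPT.IsPureSPT A (ρ.purifiedRep e) ω,
        ρ.LocallyPurifiable ∧
          ∀ (e D : ℕ) (A : Fin ρ.d × Fin e → Matrix (Fin D) (Fin D) ℂ),
            ρ.IsLocalPurification A → SPT.IsPureSPT A (ρ.purifiedRep e) ω,
        ρ.FromPureSPT ω] := by
  tfae_have 1 → 3 := fun ⟨h, hl⟩ => ⟨hl, fun e D A hA => h.isPureSPT hρ hs hA⟩
  tfae_have 3 → 2 := fun ⟨⟨e, D, A, hA⟩, h⟩ => ⟨e, D, A, hA, h e D A hA⟩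
  tfae_have 2 → 1 := fun ⟨e, D, A, hA, h⟩ => ⟨hA.inPhase h.sptClass, e, D, A, hA⟩
  tfae_have 2 → 4 := fun ⟨e, D, A, hA, h⟩ => MPO.fromPureSPT_of_isPureSPT hρ.injective hA h
  tfae_have 4 → 2 := fun h => h.exists_purification hρ hs
  tfae_finish

end

/-! ### Local operators and truncated symmetries -/

section Local

variable {ι a b : Type} [DecidableEq ι]

/-- Configurations as pairs of configurations inside and outside of the region `S`. -/
abbrev splitAt (S : Finset ι) (a : Type) :
    (ι → a) ≃ ({x // x ∈ S} → a) × ({x // x ∉ S} → a) :=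
  Equiv.piEquivPiSubtypeProd (fun x => x ∈ S) fun _ => a

/-- The operator `L` on the region `S`, acting trivially on the other sites. -/
def liftOp [Fintype ι] [DecidableEq a] (S : Finset ι)
    (L : Matrix ({x // x ∈ S} → a) ({x // x ∈ S} → a) ℂ) : Matrix (ι → a) (ι → a) ℂ :=
  (L ⊗ₖ (1 : Matrix ({x // x ∉ S} → a) ({x // x ∉ S} → a) ℂ)).submatrix (splitAt S a) (splitAt S a)

/-- The operator `O` acts on the region `S` only. -/
def IsLocal [Fintype ι] [DecidableEq a] (S : Finset ι) (O : Matrix (ι → a) (ι → a) ℂ) : Prop :=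
  ∃ L, O = liftOp S L

variable [Fintype ι] [DecidableEq a] [DecidableEq b]

theorem liftOp_apply (S : Finset ι) (L : Matrix ({x // x ∈ S} → a) ({x // x ∈ S} → a) ℂ)
    (s t : ι → a) [Decidable (∀ x, x ∉ S → s x = t x)] : liftOp S L s t =
      if ∀ x, x ∉ S → s x = t x then L (fun x => s x) (fun x => t x) else 0 := by
  simp only [liftOp, Matrix.submatrix_apply, Matrix.kroneckerMap_apply, Matrix.one_apply, mul_ite,
    mul_one, mul_zero]
  congr 1
  simp [Equiv.piEquivPiSubtypeProd, funext_iff]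

/-- The configuration that agrees with `u` on `S` and with `s` elsewhere. -/
def glue (S : Finset ι) (u : {x // x ∈ S} → a) (s : ι → a) : ι → a :=
  fun x => if h : x ∈ S then u ⟨x, h⟩ else s x

omit [Fintype ι] [DecidableEq a] in
theorem glue_of_mem {S : Finset ι} (u : {x // x ∈ S} → a) (s : ι → a) {x : ι} (h : x ∈ S) :
    glue S u s x = u ⟨x, h⟩ := dif_pos h

omit [Fintype ι] [DecidableEq a] in
theorem glue_of_notMem {S : Finset ι} (u : {x // x ∈ S} → a) (s : ι → a) {x : ι} (h : x ∉ S) :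
    glue S u s x = s x := dif_neg h

variable [Fintype a] [Fintype b]

theorem liftOp_mulVec (S : Finset ι) (L : Matrix ({x // x ∈ S} → a) ({x // x ∈ S} → a) ℂ)
    (ψ : (ι → a) → ℂ) (s : ι → a) :
    (liftOp S L).mulVec ψ s = ∑ u, L (fun x => s x) u * ψ (glue S u s) := by
  classical
  simp only [Matrix.mulVec, dotProduct]
  rw [← (splitAt S a).symm.sum_comp, Fintype.sum_prod_type]
  refine Finset.sum_congr rfl fun u _ => ?_
  refine (Finset.sum_eq_single (fun x : {x // x ∉ S} => s x) ?_ ?_).trans ?_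
  rotate_left 2
  · have h1 : (splitAt S a).symm (u, fun x => s x) = glue S u s := by
      funext x
      simp [Equiv.piEquivPiSubtypeProd, glue]
    rw [h1, liftOp_apply, if_pos fun x hx => (glue_of_notMem u s hx).symm]
    congr 2
    funext x
    exact glue_of_mem u s x.2
  · intro v _ hv
    rw [liftOp_apply, if_neg, zero_mul]
    intro h
    apply hv
    funext x
    have := h x x.2
    simp only [Equiv.piEquivPiSubtypeProd, Equiv.coe_fn_symm_mk, dif_neg x.2] at this
    exact this.symm
  · exact fun h => absurd (Finset.mem_univ _) h

theorem liftOp_mul (S : Finset ι) (L M : Matrix ({x // x ∈ S} → a) ({x // x ∈ S} → a) ℂ) :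
    liftOp S L * liftOp S M = liftOp S (L * M) := by
  simp only [liftOp]
  rw [Matrix.submatrix_mul_equiv, ← Matrix.mul_kronecker_mul, Matrix.one_mul]

theorem IsLocal.mul {S : Finset ι} {O O' : Matrix (ι → a) (ι → a) ℂ} (h : IsLocal S O)
    (h' : IsLocal S O') : IsLocal S (O * O') := by
  obtain ⟨L, rfl⟩ := h
  obtain ⟨L', rfl⟩ := h'
  exact ⟨L * L', liftOp_mul S L L'⟩

omit [Fintype a] in
theorem IsLocal.smul {S : Finset ι} {O : Matrix (ι → a) (ι → a) ℂ} (h : IsLocal S O) (c : ℂ) :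
    IsLocal S (c • O) := by
  obtain ⟨L, rfl⟩ := h
  refine ⟨c • L, ?_⟩
  simp [liftOp, Matrix.smul_kronecker, Matrix.submatrix_smul]

omit [Fintype a] in
theorem IsLocal.mono {S S' : Finset ι} (hS : S ⊆ S') {O : Matrix (ι → a) (ι → a) ℂ}
    (h : IsLocal S O) : IsLocal S' O := by
  classical
  obtain ⟨L, rfl⟩ := h
  refine ⟨Matrix.of fun u v => if ∀ x : {x // x ∈ S'}, x.1 ∉ S → u x = v x then
    L (fun x => u ⟨x, hS x.2⟩) (fun x => v ⟨x, hS x.2⟩) else 0, ?_⟩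
  ext s t
  rw [liftOp_apply, liftOp_apply, Matrix.of_apply]
  by_cases h1 : ∀ x, x ∉ S' → s x = t x
  · rw [if_pos h1]
    congr 1
    refine propext ⟨fun h x hx => h x hx, fun h x hx => ?_⟩
    by_cases hx' : x ∈ S'
    · exact h ⟨x, hx'⟩ hx
    · exact h1 x hx'
  · rw [if_neg h1, if_neg fun h => h1 fun x hx => h x fun hxS => hx (hS hxS)]

omit [DecidableEq a] [DecidableEq b] [Fintype a] [Fintype b] in
theorem siteOp_eq_submatrix (S : Finset ι) (K : ι → Matrix b a ℂ) :
    siteOp K = (siteOp (fun x : {x // x ∈ S} => K x) ⊗ₖ siteOp (fun x : {x // x ∉ S} => K x)).submatrix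
      (splitAt S b) (splitAt S a) := by
  ext s t
  simp only [siteOp, Matrix.of_apply, Matrix.submatrix_apply, Matrix.kroneckerMap_apply]
  rw [← Fintype.prod_subtype_mul_prod_subtype (fun x => x ∈ S) fun x => K x (s x) (t x)]
  congr!

omit [Fintype a] in
theorem isLocal_siteOp {S : Finset ι} {K : ι → Matrix a a ℂ} (h : ∀ x, x ∉ S → K x = 1) :
    IsLocal S (siteOp K) := by
  refine ⟨siteOp fun x : {x // x ∈ S} => K x, ?_⟩
  have : (fun x : {x // x ∉ S} => K x) = fun _ => 1 := funext fun x => h x x.2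
  rw [siteOp_eq_submatrix S, this, siteOp_one, liftOp]

/-- Operators on disjoint regions commute. -/
theorem IsLocal.commute_siteOp {S : Finset ι} {O : Matrix (ι → a) (ι → a) ℂ} (h : IsLocal S O)
    {K : ι → Matrix a a ℂ} (hK : ∀ x, x ∈ S → K x = 1) : O * siteOp K = siteOp K * O := by
  obtain ⟨L, rfl⟩ := h
  have : (fun x : {x // x ∈ S} => K x) = fun _ => 1 := funext fun x => hK x x.2
  rw [siteOp_eq_submatrix S, this, siteOp_one, liftOp, Matrix.submatrix_mul_equiv,
    Matrix.submatrix_mul_equiv, ← Matrix.mul_kronecker_mul, ← Matrix.mul_kronecker_mul,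
    Matrix.one_mul, Matrix.one_mul, Matrix.mul_one, Matrix.mul_one]

/-- A product of an injective operator on `S` and an operator on the complement of `S` maps
operators on `S` to operators on `S`. -/
theorem IsLocal.exists_intertwine {S : Finset ι} {N : Matrix (ι → b) (ι → a) ℂ}
    {N₁ : Matrix ({x // x ∈ S} → b) ({x // x ∈ S} → a) ℂ}
    {N₂ : Matrix ({x // x ∉ S} → b) ({x // x ∉ S} → a) ℂ}
    (hN : N = (N₁ ⊗ₖ N₂).submatrix (splitAt S b) (splitAt S a))
    {N₁' : Matrix ({x // x ∈ S} → a) ({x // x ∈ S} → b) ℂ} (h₁ : N₁' * N₁ = 1)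
    {O : Matrix (ι → a) (ι → a) ℂ} (h : IsLocal S O) :
    ∃ O' : Matrix (ι → b) (ι → b) ℂ, IsLocal S O' ∧ N * O = O' * N := by
  obtain ⟨L, rfl⟩ := h
  refine ⟨_, ⟨N₁ * L * N₁', rfl⟩, ?_⟩
  rw [hN, liftOp, liftOp, Matrix.submatrix_mul_equiv, Matrix.submatrix_mul_equiv,
    ← Matrix.mul_kronecker_mul, ← Matrix.mul_kronecker_mul, Matrix.mul_one, Matrix.one_mul,
    Matrix.mul_assoc, h₁, Matrix.mul_one]

/-- The onsite operator `u` on all sites of `S`. -/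
def onSites (S : Finset ι) (u : Matrix a a ℂ) : Matrix (ι → a) (ι → a) ℂ :=
  siteOp fun x => if x ∈ S then u else 1

theorem onSites_mul (S : Finset ι) (u v : Matrix a a ℂ) :
    onSites S u * onSites S v = onSites S (u * v) := by
  rw [onSites, onSites, siteOp_mul, onSites]
  congr 1
  funext x
  split_ifs <;> simp

omit [Fintype a] in
theorem onSites_one (S : Finset ι) : onSites S (1 : Matrix a a ℂ) = 1 := by
  rw [onSites, ← siteOp_one]
  congr 1
  funext x
  simp

theorem onSites_union {S S' : Finset ι} (h : Disjoint S S') (u : Matrix a a ℂ) :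
    onSites (S ∪ S') u = onSites S u * onSites S' u := by
  rw [onSites, onSites, onSites, siteOp_mul]
  congr 1
  funext x
  by_cases h1 : x ∈ S
  · simp [h1, Finset.disjoint_left.1 h h1]
  · simp [h1]

omit [Fintype a] in
theorem isLocal_onSites {S S' : Finset ι} (h : S ⊆ S') (u : Matrix a a ℂ) :
    IsLocal S' (onSites S u) :=
  isLocal_siteOp fun _ hx => if_neg fun hxS => hx (h hxS)

theorem IsLocal.commute_onSites {S S' : Finset ι} {O : Matrix (ι → a) (ι → a) ℂ} (h : IsLocal S O)
    (hS : Disjoint S S') (u : Matrix a a ℂ) : O * onSites S' u = onSites S' u * O :=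
  h.commute_siteOp fun _ hx => if_neg (Finset.disjoint_left.1 hS hx)

variable {G : Type} [Group G]

/-- On the state `ψ`, the symmetry truncated to the region `I` acts as a product of operators near
the two ends of `I`, in the regions `P` and `Q`, and the operators near the first end compose
projectively, with the cocycle `ω`. This is a property of a state with a symmetry that makes no
reference to a matrix product representation, and it is transported by circuits. -/
def HasStrings (R : G → Matrix a a ℂ) (ω : Z2 G) (I P Q : Finset ι) (ψ : (ι → a) → ℂ) : Prop :=
  ∃ L M : G → Matrix (ι → a) (ι → a) ℂ, (∀ g, IsLocal P (L g)) ∧ (∀ g, IsLocal Q (M g)) ∧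
    (∀ g, (onSites I (R g)).mulVec ψ = (L g * M g).mulVec ψ) ∧
    ∀ g h, (onSites I (R g) * L h * onSites I (R g⁻¹) * L g).mulVec ψ
      = (phase ω g h)⁻¹ • (L (g * h)).mulVec ψ

/-- Transport of the truncated symmetries by an operator `N`. -/
theorem HasStrings.map {R : G → Matrix a a ℂ} {R' : G → Matrix b b ℂ} {ω : Z2 G} {I P Q : Finset ι}
    {ψ : (ι → a) → ℂ} (h : HasStrings R ω I P Q ψ) {N : Matrix (ι → b) (ι → a) ℂ}
    (hR : ∀ g, R g * R g⁻¹ = 1) (hR' : ∀ g, R' g⁻¹ * R' g = 1)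
    (hP : ∀ O : Matrix (ι → a) (ι → a) ℂ, IsLocal P O →
      ∃ O' : Matrix (ι → b) (ι → b) ℂ, IsLocal P O' ∧ N * O = O' * N)
    (hQ : ∀ O : Matrix (ι → a) (ι → a) ℂ, IsLocal Q O →
      ∃ O' : Matrix (ι → b) (ι → b) ℂ, IsLocal Q O' ∧ N * O = O' * N)
    {θ : G → ℂ} (h0 : ∀ g, θ g ≠ 0)
    (hN : ∀ g, N * onSites I (R g) = θ g • (onSites I (R' g) * N)) :
    HasStrings R' ω I P Q (N.mulVec ψ) := by
  obtain ⟨L, M, hL, hM, h1, h2⟩ := h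
  choose L' hL' hLN using fun g => hP (L g) (hL g)
  choose M' hM' hMN using fun g => hQ (M g) (hM g)
  -- in the projective relation, the phase of `R g` cancels against that of `R g⁻¹`
  have hN' : ∀ g, onSites I (R' g⁻¹) * N = θ g • (N * onSites I (R g⁻¹)) := by
    intro g
    have e1 : onSites I (R g) * onSites I (R g⁻¹) = 1 := by rw [onSites_mul, hR, onSites_one]
    have e2 : onSites I (R' g⁻¹) * onSites I (R' g) = 1 := by rw [onSites_mul, hR', onSites_one]
    calc onSites I (R' g⁻¹) * N
        = onSites I (R' g⁻¹) * (N * onSites I (R g)) * onSites I (R g⁻¹) := by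
          rw [Matrix.mul_assoc, Matrix.mul_assoc, e1, Matrix.mul_one]
      _ = _ := by
          rw [hN, Matrix.mul_smul, ← Matrix.mul_assoc, e2, Matrix.one_mul, Matrix.smul_mul]
  have hN'' : ∀ g, onSites I (R' g) * N = (θ g)⁻¹ • (N * onSites I (R g)) := by
    intro g
    rw [hN, smul_smul, inv_mul_cancel₀ (h0 g), one_smul]
  refine ⟨L', fun g => (θ g)⁻¹ • M' g, hL', fun g => (hM' g).smul _, fun g => ?_, fun g h => ?_⟩
  · rw [Matrix.mulVec_mulVec, hN'', Matrix.smul_mulVec, ← Matrix.mulVec_mulVec, h1,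
      Matrix.mulVec_mulVec, Matrix.mulVec_mulVec, Matrix.mul_smul, Matrix.smul_mul,
      Matrix.smul_mulVec, Matrix.mul_assoc, ← hMN, ← Matrix.mul_assoc, ← Matrix.mul_assoc, hLN]
  · have : onSites I (R' g) * L' h * onSites I (R' g⁻¹) * L' g * N
        = N * (onSites I (R g) * L h * onSites I (R g⁻¹) * L g) := by
      rw [Matrix.mul_assoc _ (L' g), ← hLN, ← Matrix.mul_assoc, Matrix.mul_assoc _ _ N, hN',
        Matrix.mul_smul, Matrix.smul_mul, ← Matrix.mul_assoc _ N, Matrix.mul_assoc _ (L' h), ← hLN,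
        ← Matrix.mul_assoc, hN'', Matrix.smul_mul, Matrix.smul_mul, Matrix.smul_mul, smul_smul,
        mul_inv_cancel₀ (h0 g), one_smul]
      simp only [Matrix.mul_assoc]
    rw [Matrix.mulVec_mulVec, this, ← Matrix.mulVec_mulVec, h2, Matrix.mulVec_smul,
      Matrix.mulVec_mulVec, Matrix.mulVec_mulVec, hLN]

theorem HasStrings.smul {R : G → Matrix a a ℂ} {ω : Z2 G} {I P Q : Finset ι}
    {ψ : (ι → a) → ℂ} (h : HasStrings R ω I P Q ψ) (c : ℂ) :
    HasStrings R ω I P Q (c • ψ) := by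
  obtain ⟨L, M, hL, hM, h1, h2⟩ := h
  refine ⟨L, M, hL, hM, fun g => ?_, fun g h => ?_⟩
  · rw [Matrix.mulVec_smul, h1, Matrix.mulVec_smul]
  · rw [Matrix.mulVec_smul, h2, Matrix.mulVec_smul, smul_comm]

/-- The region of the truncated symmetry can be enlarged by sites near its ends. -/
theorem HasStrings.enlarge {R : G → Matrix a a ℂ} {ω : Z2 G} {I P Q : Finset ι}
    {ψ : (ι → a) → ℂ} (h : HasStrings R ω I P Q ψ) (hmul : ∀ g h, R (g * h) = R g * R h)
    (h1 : R 1 = 1)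
    {I' P' Q' J K : Finset ι} (hI : I' = J ∪ (K ∪ I)) (hJI : Disjoint J I) (hKI : Disjoint K I)
    (hJK : Disjoint J K) (hP : P ⊆ P') (hQ : Q ⊆ Q') (hJ : J ⊆ P') (hK : K ⊆ Q')
    (hPK : Disjoint P K) : HasStrings R ω I' P' Q' ψ := by
  obtain ⟨L, M, hL, hM, e1, e2⟩ := h
  have hd : Disjoint J (K ∪ I) := Finset.disjoint_union_right.2 ⟨hJK, hJI⟩
  have hI' : ∀ g, onSites I' (R g) = onSites J (R g) * (onSites K (R g) * onSites I (R g)) :=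
    fun g => by rw [hI, onSites_union hd, onSites_union hKI]
  have hcan : ∀ (S : Finset ι) g, onSites S (R g⁻¹) * onSites S (R g) = 1 := fun S g => by
    rw [onSites_mul, ← hmul, inv_mul_cancel, h1, onSites_one]
  have hcan' : ∀ (S : Finset ι) g, onSites S (R g) * onSites S (R g⁻¹) = 1 := fun S g => by
    rw [onSites_mul, ← hmul, mul_inv_cancel, h1, onSites_one]
  have cJK : ∀ g h, onSites J (R g) * onSites K (R h) = onSites K (R h) * onSites J (R g) :=
    fun g h => (isLocal_onSites subset_rfl _).commute_onSites hJK _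
  have cJI : ∀ g h, onSites J (R g) * onSites I (R h) = onSites I (R h) * onSites J (R g) :=
    fun g h => (isLocal_onSites subset_rfl _).commute_onSites hJI _
  have cKI : ∀ g h, onSites K (R g) * onSites I (R h) = onSites I (R h) * onSites K (R g) :=
    fun g h => (isLocal_onSites subset_rfl _).commute_onSites hKI _
  have cLK : ∀ g h, L g * onSites K (R h) = onSites K (R h) * L g :=
    fun g h => (hL g).commute_onSites hPK _
  refine ⟨fun g => onSites J (R g) * L g, fun g => onSites K (R g) * M g,
    fun g => (isLocal_onSites hJ _).mul ((hL g).mono hP),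
    fun g => (isLocal_onSites hK _).mul ((hM g).mono hQ), fun g => ?_, fun g h => ?_⟩
  · rw [hI', ← Matrix.mul_assoc, ← Matrix.mulVec_mulVec, e1, Matrix.mulVec_mulVec]
    congr 1
    rw [Matrix.mul_assoc, Matrix.mul_assoc, ← Matrix.mul_assoc (L g), cLK]
    simp only [Matrix.mul_assoc]
  · have h3 : onSites I' (R g⁻¹) * (onSites J (R g) * L g)
        = onSites K (R g⁻¹) * (onSites I (R g⁻¹) * L g) := by
      rw [hI', ← Matrix.mul_assoc, Matrix.mul_assoc (onSites J _),
        Matrix.mul_assoc (onSites K _) (onSites I _), ← cJI, ← Matrix.mul_assoc (onSites K _), ← cJK,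
        ← Matrix.mul_assoc, ← Matrix.mul_assoc, hcan, Matrix.one_mul, Matrix.mul_assoc]
    have h4 : onSites I' (R g) * (onSites J (R h) * L h) * onSites I' (R g⁻¹)
          * (onSites J (R g) * L g)
        = onSites J (R (g * h)) * (onSites I (R g) * L h * onSites I (R g⁻¹) * L g) := by
      calc _ = onSites I' (R g) * (onSites J (R h) * (L h * onSites K (R g⁻¹)))
              * (onSites I (R g⁻¹) * L g) := by
            rw [Matrix.mul_assoc _ (onSites I' _), h3]
            simp only [Matrix.mul_assoc]
        _ = onSites J (R g) * onSites K (R g) * (onSites I (R g) * onSites J (R h))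
              * onSites K (R g⁻¹) * L h * (onSites I (R g⁻¹) * L g) := by
            rw [cLK, hI']
            simp only [Matrix.mul_assoc]
        _ = onSites J (R g) * (onSites K (R g) * onSites J (R h)) * (onSites I (R g)
              * onSites K (R g⁻¹)) * L h * (onSites I (R g⁻¹) * L g) := by
            rw [← cJI]
            simp only [Matrix.mul_assoc]
        _ = onSites J (R g) * onSites J (R h) * (onSites K (R g) * onSites K (R g⁻¹))
              * onSites I (R g) * L h * (onSites I (R g⁻¹) * L g) := by
            rw [← cKI, ← cJK]
            simp only [Matrix.mul_assoc]
        _ = _ := by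
            rw [hcan', onSites_mul, ← hmul, Matrix.mul_one]
            simp only [Matrix.mul_assoc]
    rw [h4, ← Matrix.mulVec_mulVec, e2, Matrix.mulVec_smul, Matrix.mulVec_mulVec]

end Local

/-! ### Truncated symmetries of matrix product states -/

section Insertions

/-- The tensors `T`, with the matrix `Y` inserted on the virtual bond to the left of site `p`. -/
def insertAt {a m : Type} [Fintype m] {n : ℕ} (p : Fin n) (Y : Matrix m m ℂ)
    (T : Fin n → a → Matrix m m ℂ) : Fin n → a → Matrix m m ℂ :=
  Function.update T p fun i => Y * T p i

/-- The sites `x` with `p ≤ x < q`. -/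
def segment (n p q : ℕ) : Finset (Fin n) :=
  Finset.univ.filter fun x => p ≤ x.val ∧ x.val < q

theorem mem_segment {n p q : ℕ} {x : Fin n} : x ∈ segment n p q ↔ p ≤ x.val ∧ x.val < q := by
  simp [segment]

variable {a m : Type} [Fintype m] {n : ℕ} {p q : Fin n}

theorem insertAt_self (p : Fin n) (Y : Matrix m m ℂ) (T : Fin n → a → Matrix m m ℂ) :
    insertAt p Y T p = fun i => Y * T p i := Function.update_self ..

theorem insertAt_of_ne {x : Fin n} (h : x ≠ p) (Y : Matrix m m ℂ) (T : Fin n → a → Matrix m m ℂ) :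
    insertAt p Y T x = T x := Function.update_of_ne h ..

theorem insertAt_insertAt (p : Fin n) (Y Z : Matrix m m ℂ) (T : Fin n → a → Matrix m m ℂ) :
    insertAt p Y (insertAt p Z T) = insertAt p (Y * Z) T := by
  funext x i
  by_cases h : x = p
  · subst h; simp [insertAt_self, Matrix.mul_assoc]
  · simp [insertAt_of_ne h]

theorem insertAt_comm (h : p ≠ q) (Y Z : Matrix m m ℂ) (T : Fin n → a → Matrix m m ℂ) :
    insertAt p Y (insertAt q Z T) = insertAt q Z (insertAt p Y T) := by
  funext x i
  by_cases hp : x = p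
  · subst hp
    rw [insertAt_self, insertAt_of_ne h, insertAt_of_ne h, insertAt_self]
  · by_cases hq : x = q
    · subst hq
      rw [insertAt_self, insertAt_of_ne hp, insertAt_self, insertAt_of_ne hp]
    · rw [insertAt_of_ne hp, insertAt_of_ne hq, insertAt_of_ne hq, insertAt_of_ne hp]

variable [DecidableEq m]

theorem insertAt_one (p : Fin n) (T : Fin n → a → Matrix m m ℂ) : insertAt p 1 T = T := by
  funext x i
  by_cases h : x = p
  · subst h; simp [insertAt_self]
  · simp [insertAt_of_ne h]

theorem chain_insertAt_smul (p : Fin n) (c : ℂ) (Y : Matrix m m ℂ) (T : Fin n → a → Matrix m m ℂ) :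
    chain (insertAt p (c • Y) T) = c • chain (insertAt p Y T) := by
  have : insertAt p (c • Y) T
      = fun x i => (if x = p then c else 1) • insertAt p Y T x i := by
    funext x i
    by_cases h : x = p
    · subst h; simp [insertAt_self]
    · simp [insertAt_of_ne h, h]
  rw [this, chain_smul, Finset.prod_ite_eq' _ p fun _ => c, if_pos (Finset.mem_univ p)]

/-- Gauge transformations that vary along the chain cancel, except at the two ends. -/
theorem prod_ofFn_gauge {n : ℕ} {W W' : ℕ → Matrix m m ℂ} (h : ∀ x, W' x * W x = 1)
    (M : Fin n → Matrix m m ℂ) :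
    (List.ofFn fun x : Fin n => W x * M x * W' (x + 1)).prod * W n = W 0 * (List.ofFn M).prod := by
  induction n generalizing W W' with
  | zero => simp
  | succ n ih =>
    have := ih (W := fun x => W (x + 1)) (W' := fun x => W' (x + 1)) (fun x => h _) (fun x => M x.succ)
    simp only [List.ofFn_succ, List.prod_cons, Matrix.mul_assoc, Fin.val_succ] at this ⊢
    rw [this]
    simp only [Fin.val_zero, zero_add]
    rw [← Matrix.mul_assoc (W' 1), h, Matrix.one_mul]

variable [Fintype a] [DecidableEq a]

/-- The symmetry on a segment of sites with equal tensors inserts gauge transformations at the ends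
of the segment. -/
theorem onSites_mulVec_chain {u : Matrix a a ℂ} {A : a → Matrix m m ℂ} {V V' : Matrix m m ℂ} {c : ℂ}
    (hV : V' * V = 1) (hV' : V * V' = 1) (h : ∀ i, act u A i = c • (V' * A i * V)) (hpq : p < q)
    {T : Fin n → a → Matrix m m ℂ} (hT : ∀ x ∈ segment n p q, T x = A) (Y : Matrix m m ℂ) :
    (onSites (segment n p q) u).mulVec (chain (insertAt p Y T))
      = c ^ (segment n p q).card • chain (insertAt q V (insertAt p (Y * V') T)) := by
  -- gauge transformation by `V` on the bonds strictly after `p` and up to `q`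
  let W : ℕ → Matrix m m ℂ := fun x => if p.1 < x ∧ x ≤ q.1 then V' else 1
  let W' : ℕ → Matrix m m ℂ := fun x => if p.1 < x ∧ x ≤ q.1 then V else 1
  have hW : ∀ x, W' x * W x = 1 := fun x => by
    simp only [W, W']; split_ifs <;> simp [hV']
  set S := insertAt q V (insertAt p (Y * V') T) with hS
  have key : chain S = chain fun x i => W x * S x i * W' (x + 1) := by
    funext s
    have := prod_ofFn_gauge hW fun x : Fin n => S x (s x)
    have e0 : W 0 = 1 := if_neg (by omega)
    have en : W n = 1 := if_neg (by omega)
    rw [e0, en, Matrix.mul_one, Matrix.one_mul] at this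
    simp only [chain, this]
  have hp : p ∈ segment n p q := mem_segment.2 ⟨le_rfl, hpq⟩
  have hc : c ^ (segment n p q).card = ∏ x, if x ∈ segment n p q then c else 1 := by
    rw [Finset.prod_ite_mem, Finset.univ_inter, Finset.prod_const]
  rw [onSites, siteOp_mulVec_chain, key, hc, ← chain_smul]
  congr 1
  funext x i
  by_cases hx : x ∈ segment n p q
  · have hx' := mem_segment.1 hx
    have hxq : x ≠ q := fun h => by rw [h] at hx'; exact lt_irrefl _ hx'.2
    have e1 : W' (x + 1) = V := if_pos (by omega)
    rw [if_pos hx, if_pos hx, e1, hS, insertAt_of_ne hxq]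
    by_cases hxp : x = p
    · subst hxp
      have e2 : W x = 1 := if_neg (by omega)
      have e3 : act u (fun i => Y * A i) i = Y * act u A i := by
        simp [act, Finset.mul_sum]
      rw [insertAt_self, insertAt_self, hT _ hx, e2, e3, h]
      simp [Matrix.mul_assoc]
    · have e2 : W x = V' := if_pos (by have := Fin.val_ne_of_ne hxp; omega)
      rw [insertAt_of_ne hxp, insertAt_of_ne hxp, hT _ hx, e2, h]
  · have hxp : x ≠ p := fun h => hx (h ▸ hp)
    rw [if_neg hx, if_neg hx, act_one, one_smul, hS, insertAt_of_ne hxp]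
    have hx' : ¬ (p.1 ≤ x.1 ∧ x.1 < q.1) := fun h => hx (mem_segment.2 h)
    have hxp' := Fin.val_ne_of_ne hxp
    have e1 : W' (x + 1) = 1 := if_neg (by omega)
    by_cases hxq : x = q
    · subst hxq
      have e2 : W x = V' := if_pos (by omega)
      rw [insertAt_self, insertAt_of_ne hxp, e1, e2, ← Matrix.mul_assoc, hV, Matrix.one_mul,
        Matrix.mul_one]
    · have e2 : W x = 1 := if_neg (by have := Fin.val_ne_of_ne hxq; omega)
      rw [insertAt_of_ne hxq, insertAt_of_ne hxp, e1, e2, Matrix.one_mul, Matrix.mul_one]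

end Insertions

section Strings

variable {G : Type} [Group G] {ι : Type} [Fintype ι] [DecidableEq ι] {n D : ℕ} {p q : Fin n}
  {A : ι → Matrix (Fin D) (Fin D) ℂ} {R : G → Matrix ι ι ℂ} {ω : Z2 G}
  {V : G → (Matrix (Fin D) (Fin D) ℂ)ˣ} {c : G → Circle}

/-- Operators that insert the gauge transformation `V⁻¹` on one virtual bond compose like `V⁻¹`,
in the sense that enters the definition of `HasStrings`. -/
theorem mulVec_mps_of_insert (hR : ∀ g h, R (g * h) = R g * R h) (hR1 : R 1 = 1)
    (hV : ∀ g i, act (R g) A i = (c g : ℂ) • ((V g)⁻¹.val * A i * (V g).val))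
    (hω : ∀ g h, (V g).val * (V h).val = phase ω g h • (V (g * h)).val) (hpq : p < q)
    {P : Finset (Fin n)} (hqP : q ∉ P) {L : G → Matrix (Fin n → ι) (Fin n → ι) ℂ} {lam : G → ℂ}
    (hL : ∀ g (T : Fin n → ι → Matrix (Fin D) (Fin D) ℂ), (∀ x ∈ P, T x = A) →
      (L g).mulVec (chain T) = lam g • chain (insertAt p (V g)⁻¹.val T)) (g h : G) :
    (onSites (segment n p q) (R g) * L h * onSites (segment n p q) (R g⁻¹) * L g).mulVec (mps A n)
      = (lam g * lam h * (phase ω g h)⁻¹) • chain (insertAt p (V (g * h))⁻¹.val fun _ => A) := by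
  have hV' : ∀ i, act (R g⁻¹) A i = (c g : ℂ)⁻¹ • ((V g).val * A i * (V g)⁻¹.val) := by
    have e1 : act (R g⁻¹) (act (R g) A) = A := by
      rw [act_act, ← hR, inv_mul_cancel, hR1, act_one]
    have e2 : act (R g) A = fun i => (c g : ℂ) • ((V g)⁻¹.val * A i * (V g).val) := funext (hV g)
    rw [e2, act_smul, act_mul_mul] at e1
    intro i
    have e3 := congrFun e1 i
    simp only at e3
    rw [← e3]
    simp [Matrix.mul_assoc, smul_smul]
  have hA : ∀ x ∈ segment n p q, (fun _ => A : Fin n → ι → Matrix (Fin D) (Fin D) ℂ) x = A :=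
    fun _ _ => rfl
  rw [← Matrix.mulVec_mulVec, ← Matrix.mulVec_mulVec, ← Matrix.mulVec_mulVec, mps_eq_chain,
    hL g _ fun _ _ => rfl, Matrix.mulVec_smul, onSites_mulVec_chain (by simp) (by simp) hV' hpq hA]
  have e4 : (V g)⁻¹.val * (V g).val = 1 := by simp
  have e5 : ∀ x ∈ segment n p q, insertAt q (V g)⁻¹.val (fun _ => A) x = A := fun x hx =>
    insertAt_of_ne (fun e => by have := (mem_segment.1 hx).2; rw [e] at this; exact lt_irrefl _ this)
      _ _
  have e9 : ∀ x ∈ P, insertAt q (V g)⁻¹.val (fun _ => A) x = A := fun x hx =>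
    insertAt_of_ne (fun e => by rw [e] at hx; exact hqP hx) _ _
  rw [e4, insertAt_one, Matrix.mulVec_smul, Matrix.mulVec_smul, Matrix.mulVec_smul, hL h _ e9,
    Matrix.mulVec_smul, Matrix.mulVec_smul,
    onSites_mulVec_chain (by simp) (by simp) (hV g) hpq e5]
  have e6 : (V g).val * (V g)⁻¹.val = 1 := by simp
  have e7 : (V h)⁻¹.val * (V g)⁻¹.val = (phase ω g h)⁻¹ • (V (g * h))⁻¹.val := by
    have e8 : (V g).val * (V h).val * ((phase ω g h)⁻¹ • (V (g * h))⁻¹.val) = 1 := by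
      rw [hω, Matrix.smul_mul, Matrix.mul_smul, smul_smul, mul_inv_cancel₀ (phase_ne_zero _ _ _),
        one_smul]
      simp
    calc _ = ((V h)⁻¹.val * (V g)⁻¹.val) *
          ((V g).val * (V h).val * ((phase ω g h)⁻¹ • (V (g * h))⁻¹.val)) := by rw [e8, mul_one]
      _ = _ := by simp only [mul_assoc, Units.inv_mul_cancel_left]
  rw [insertAt_comm hpq.ne, insertAt_insertAt, e6, insertAt_one, e7, chain_insertAt_smul]
  simp only [smul_smul]
  congr 1
  have e10 : (c g : ℂ)⁻¹ ^ (segment n p q).card * (c g : ℂ) ^ (segment n p q).card = 1 := by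
    rw [← mul_pow, inv_mul_cancel₀ (Circle.coe_ne_zero _), one_pow]
  linear_combination (lam g * lam h * (phase ω g h)⁻¹) * e10

/-- A symmetric matrix product state has string operators with the cocycle of its gauge
transformations. -/
theorem hasStrings_mps (hA : Spans A) (hR : ∀ g h, R (g * h) = R g * R h) (hR1 : R 1 = 1)
    (hV : ∀ g i, act (R g) A i = (c g : ℂ) • ((V g)⁻¹.val * A i * (V g).val))
    (hω : ∀ g h, (V g).val * (V h).val = phase ω g h • (V (g * h)).val) (hpq : p < q)
    {P Q : Finset (Fin n)} (hp : p ∈ P) (hq : q ∈ Q) (hqP : q ∉ P) :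
    HasStrings R ω (segment n p q) P Q (mps A n) := by
  -- an injective tensor turns any virtual insertion into an onsite operator
  have hO : ∀ Y : Matrix (Fin D) (Fin D) ℂ, ∃ O : Matrix ι ι ℂ, act O A = fun i => Y * A i :=
    fun Y => (hA.exists_coeff fun i => Y * A i).imp fun O h => funext h
  have key : ∀ Y : Matrix (Fin D) (Fin D) ℂ, ∃ O : Matrix ι ι ℂ, ∀ (x : Fin n)
      (T : Fin n → ι → Matrix (Fin D) (Fin D) ℂ), T x = A →
      (onSites {x} O).mulVec (chain T) = chain (insertAt x Y T) := by
    intro Y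
    obtain ⟨O, hO⟩ := hO Y
    refine ⟨O, fun x T hT => ?_⟩
    rw [onSites, siteOp_mulVec_chain]
    congr 1
    funext y
    by_cases h : y = x
    · subst h; rw [if_pos (Finset.mem_singleton_self _), insertAt_self, hT, hO]
    · rw [if_neg (by simpa using h), act_one, insertAt_of_ne h]
  choose O hO using key
  have hL : ∀ g (T : Fin n → ι → Matrix (Fin D) (Fin D) ℂ), (∀ x ∈ P, T x = A) →
      (onSites {p} (O (V g)⁻¹.val)).mulVec (chain T)
        = (fun _ => 1 : G → ℂ) g • chain (insertAt p (V g)⁻¹.val T) := fun g T hT => by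
    rw [hO _ _ _ (hT p hp), one_smul]
  refine ⟨fun g => onSites {p} (O (V g)⁻¹.val), fun g => (c g : ℂ) ^ (segment n p q).card •
    onSites {q} (O (V g).val), fun g => isLocal_onSites (by simpa using hp) _,
    fun g => (isLocal_onSites (by simpa using hq) _).smul _, fun g => ?_, fun g h => ?_⟩
  · have := onSites_mulVec_chain (Y := 1) (T := fun _ => A) (by simp) (by simp) (hV g) hpq
      (fun _ _ => rfl)
    rw [insertAt_one, Matrix.one_mul] at this
    rw [mps_eq_chain, this, Matrix.mul_smul, Matrix.smul_mulVec, ← Matrix.mulVec_mulVec,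
      hO _ _ _ rfl, hO _ _ _ (insertAt_of_ne hpq.ne _ _), insertAt_comm hpq.ne]
  · rw [mulVec_mps_of_insert hR hR1 hV hω hpq hqP hL, mps_eq_chain, hO _ _ _ rfl, one_mul, one_mul]

end Strings

/-! ### String operators determine the class of a matrix product state -/

section OrderedSplit

variable {m : Type} [Fintype m] [DecidableEq m]

/-- If all factors `g` before position `k` and all factors `f` from position `k` on are trivial, the
ordered product of `f x * g x` splits. -/
theorem prod_ofFn_split {n : ℕ} (k : ℕ) (f g : Fin n → Matrix m m ℂ)
    (hf : ∀ x, k ≤ x.val → f x = 1) (hg : ∀ x : Fin n, x.val < k → g x = 1) :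
    (List.ofFn fun x => f x * g x).prod = (List.ofFn f).prod * (List.ofFn g).prod := by
  induction n generalizing k with
  | zero => simp
  | succ n ih =>
    rcases k with _ | k
    · have : f = fun _ => 1 := funext fun x => hf x (Nat.zero_le _)
      subst this
      simp [List.ofFn_const]
    · have := ih k (fun x => f x.succ) (fun x => g x.succ)
        (fun x hx => hf _ (by simpa using hx)) (fun x hx => hg _ (by simpa using hx))
      simp only [List.ofFn_succ, List.prod_cons, this, hg 0 (Nat.succ_pos k), Matrix.one_mul,
        Matrix.mul_one, Matrix.mul_assoc]

theorem prod_ofFn_single {n : ℕ} (k : Fin n) (Y : Matrix m m ℂ) :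
    (List.ofFn fun x => if x = k then Y else 1).prod = Y := by
  induction n with
  | zero => exact k.elim0
  | succ n ih =>
    rw [List.ofFn_succ, List.prod_cons]
    refine Fin.cases ?_ (fun k => ?_) k
    · simp [List.ofFn_const, (Fin.succ_ne_zero _)]
    · have := ih k
      simp only [Fin.succ_inj, this]
      simp [(Fin.succ_ne_zero k).symm]

/-- A matrix product state does not vanish if the identity matrix is in the span of every tensor. -/
theorem chain_ne_zero {a : Type} [Fintype a] [Nonempty m] {n : ℕ} {T : Fin n → a → Matrix m m ℂ}
    (h : ∀ x, ∃ w : a → ℂ, ∑ i, w i • T x i = 1) : ∃ s, chain T s ≠ 0 := by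
  by_contra! h0
  choose w hw using h
  have h1 : (List.ofFn fun x => ∑ i, w x i • T x i).prod.trace = 0 := by
    rw [prod_ofFn_sum, Matrix.trace_sum]
    refine Finset.sum_eq_zero fun s _ => ?_
    rw [prod_ofFn_smul (fun x => w x (s x)) fun x => T x (s x), Matrix.trace_smul]
    exact (congrArg _ (h0 s)).trans (smul_zero _)
  simp [hw, List.ofFn_const] at h1

end OrderedSplit

section SegProd

variable {ι m : Type} [Fintype m] [DecidableEq m] {n : ℕ}

/-- The ordered product of the matrices `B x (u x)` over the sites `x` of a region. -/
def regionProd (P : Finset (Fin n)) (B : Fin n → ι → Matrix m m ℂ) (u : {x // x ∈ P} → ι) :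
    Matrix m m ℂ :=
  (List.ofFn fun x => if h : x ∈ P then B x (u ⟨x, h⟩) else 1).prod

theorem regionProd_restrict (P : Finset (Fin n)) (B : Fin n → ι → Matrix m m ℂ) (s : Fin n → ι) :
    regionProd P B (fun x => s x) = (List.ofFn fun x => if x ∈ P then B x (s x) else 1).prod := by
  simp only [regionProd, dite_eq_ite]

theorem exists_regionProd_ne_zero [Fintype ι] [Nonempty ι] [Nonempty m] (P : Finset (Fin n))
    {B : Fin n → ι → Matrix m m ℂ} (h : ∀ x, ∃ w : ι → ℂ, ∑ i, w i • B x i = 1) :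
    ∃ s : Fin n → ι, regionProd P B (fun x => s x) ≠ 0 := by
  classical
  obtain ⟨s, hs⟩ := chain_ne_zero (T := fun x i => if x ∈ P then B x i else 1) fun x => by
    by_cases hx : x ∈ P
    · simpa only [if_pos hx] using h x
    · refine ⟨Pi.single (Classical.arbitrary ι) 1, ?_⟩
      simp [hx, Pi.single_apply]
  refine ⟨s, fun h0 => hs ?_⟩
  rw [regionProd_restrict] at h0
  rw [chain, h0, Matrix.trace_zero]

/-- Outside of a segment, a matrix product state is a fixed environment of the segment. -/
theorem exists_environment {l r : ℕ} (hlr : l ≤ r) (T : Fin n → ι → Matrix m m ℂ) (s : Fin n → ι) :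
    ∃ E : Matrix m m ℂ, ∀ (B : Fin n → ι → Matrix m m ℂ) (u : {x // x ∈ segment n l r} → ι),
      (∀ x ∉ segment n l r, B x = T x) →
      chain B (glue (segment n l r) u s) = (regionProd (segment n l r) B u * E).trace := by
  refine ⟨(List.ofFn fun x : Fin n => if r ≤ x.val then T x (s x) else 1).prod *
    (List.ofFn fun x : Fin n => if x.val < l then T x (s x) else 1).prod, fun B u hB => ?_⟩
  rw [← Matrix.mul_assoc, Matrix.trace_mul_comm, regionProd, ← prod_ofFn_split r, ← prod_ofFn_split l]
  · rw [chain]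
    congr 3
    funext x
    by_cases hx : x ∈ segment n l r
    · have := mem_segment.1 hx
      rw [dif_pos hx, if_neg (by omega), if_neg (by omega), glue_of_mem _ _ hx, Matrix.mul_one,
        Matrix.one_mul]
    · have h2 : ¬ (l ≤ x.1 ∧ x.1 < r) := fun h => hx (mem_segment.2 h)
      rw [dif_neg hx, glue_of_notMem _ _ hx, hB x hx]
      by_cases h3 : r ≤ x.val
      · rw [if_pos h3, if_neg (by omega), Matrix.one_mul, Matrix.one_mul]
      · rw [if_neg h3, if_pos (by omega), Matrix.one_mul, Matrix.mul_one]
  · intro x hx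
    rw [if_neg (by omega)]
  · intro x hx
    rw [dif_neg (fun h => by have := mem_segment.1 h; omega), if_neg (by omega), Matrix.one_mul]
  · intro x hx
    exact dif_neg fun h => by have := mem_segment.1 h; omega
  · intro x hx
    rw [if_neg (by omega)]

/-- A matrix product state made of two segments and two insertions. -/
theorem chain_two_segments {l r l' r' : ℕ} (hr : r < l') (hr' : l' ≤ r') (hn : r' < n)
    (B : Fin n → ι → Matrix m m ℂ) (Y Z : Matrix m m ℂ) (s : Fin n → ι) :
    chain (fun x i => if x ∈ segment n l r ∨ x ∈ segment n l' r' then B x i else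
        if x.val = r then Y else if x.val = r' then Z else 1) s
      = (regionProd (segment n l r) B (fun x => s x) * Y
          * (regionProd (segment n l' r') B (fun x => s x) * Z)).trace := by
  have hY := prod_ofFn_single (⟨r, by omega⟩ : Fin n) Y
  have hZ := prod_ofFn_single (⟨r', hn⟩ : Fin n) Z
  rw [regionProd_restrict, regionProd_restrict, chain]
  conv_rhs => rw [← hY, ← hZ]
  rw [← prod_ofFn_split r, ← prod_ofFn_split r', ← prod_ofFn_split (r + 1)]
  · congr 3
    funext x
    simp only [mem_segment, Fin.ext_iff]
    by_cases h1 : l ≤ x.val ∧ x.val < r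
    · simp [h1, show ¬ (l' ≤ x.val ∧ x.val < r') by omega, show x.val ≠ r by omega,
        show x.val ≠ r' by omega]
    · by_cases h2 : l' ≤ x.val ∧ x.val < r'
      · simp [h1, h2, show x.val ≠ r by omega, show x.val ≠ r' by omega]
      · by_cases h3 : x.val = r
        · simp [h3, show ¬ (l' ≤ r ∧ r < r') by omega, show r ≠ r' by omega]
        · simp [h1, h2, h3]
  all_goals
    intro x hx
    simp only [mem_segment, Fin.ext_iff]
  · rw [if_neg (by omega), if_neg (by omega), Matrix.one_mul]
  · rw [if_neg (by omega), if_neg (by omega), Matrix.one_mul]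
  · rw [if_neg (by omega)]
  · rw [if_neg (by omega)]
  · rw [if_neg (by omega)]
  · rw [if_neg (by omega)]

end SegProd

section Recover

variable {G : Type} [Group G] {ι : Type} [Fintype ι] [DecidableEq ι] {n D : ℕ}

omit [Fintype ι] [DecidableEq ι] in
theorem regionProd_congr {m : Type} [Fintype m] [DecidableEq m] {P : Finset (Fin n)}
    {B B' : Fin n → ι → Matrix m m ℂ} (h : ∀ x ∈ P, B x = B' x) (u : {x // x ∈ P} → ι) :
    regionProd P B u = regionProd P B' u := by
  unfold regionProd
  congr 2
  funext x
  split_ifs with hx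
  · rw [h x hx]
  · rfl

/-- Free insertions `Y` and `Z` between `X` and `W` on a ring cut the trace open into matrix
entries. -/
theorem entry_mul_entry_eq {m : Type} [Fintype m] [DecidableEq m] {X X' W W' : Matrix m m ℂ} {c : ℂ}
    (h : ∀ Y Z, (X * Y * (W * Z)).trace = c * (X' * Y * (W' * Z)).trace) (i j k l : m) :
    X i j * W k l = c * (X' i j * W' k l) := by
  have e : ∀ X W : Matrix m m ℂ, (X * Matrix.single j k (1 : ℂ) * (W * Matrix.single l i (1 : ℂ))).trace
      = X i j * W k l := by
    intro X W
    rw [← Matrix.mul_assoc, Matrix.trace_mul_comm, Matrix.mul_assoc]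
    simp [Matrix.trace_single_mul, Matrix.mul_apply, Matrix.single_apply, ite_and]
  rw [← e, h, e]

omit [DecidableEq ι] in
theorem Spans.exists_weights {m : Type} [Fintype m] [DecidableEq m] {A : ι → Matrix m m ℂ}
    (hA : Spans A) {Y Y' : Matrix m m ℂ} (hY : Y * Y' = 1) :
    ∃ w : ι → ℂ, ∑ i, w i • (Y * A i) = 1 := by
  obtain ⟨O, hO⟩ := hA.exists_coeff fun _ : Unit => Y'
  refine ⟨O (), ?_⟩
  have := hO ()
  rw [← hY, ← this, Finset.mul_sum]
  exact Finset.sum_congr rfl fun i _ => by rw [Matrix.mul_smul]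

/-- An operator on the segment `P` that, together with an operator on a distant segment, inserts
gauge transformations in a matrix product state, inserts a multiple of one of them by itself. -/
theorem insert_of_insert_insert [NeZero D] {A : ι → Matrix (Fin D) (Fin D) ℂ} (hA : Spans A)
    {V : (Matrix (Fin D) (Fin D) ℂ)ˣ} {κ : ℂ} (hκ : κ ≠ 0) {l r l' r' : ℕ} (hr : r < l')
    (hn : r' < n) {p q : Fin n} (hp : p ∈ segment n l r) (hq : q ∈ segment n l' r')
    {L M : Matrix (Fin n → ι) (Fin n → ι) ℂ} (hL : IsLocal (segment n l r) L)
    (hM : IsLocal (segment n l' r') M)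
    (h : (L * M).mulVec (mps A n)
      = κ • chain (insertAt q V.val (insertAt p (V⁻¹).val fun _ => A))) :
    ∃ lam : ℂ, lam ≠ 0 ∧ ∀ T : Fin n → ι → Matrix (Fin D) (Fin D) ℂ,
      (∀ x ∈ segment n l r, T x = A) →
        L.mulVec (chain T) = lam • chain (insertAt p (V⁻¹).val T) := by
  classical
  set P := segment n l r with hPdef
  set Q := segment n l' r' with hQdef
  have hlr := mem_segment.1 hp
  have hlr' := mem_segment.1 hq
  have hdisj : ∀ x ∈ P, x ∉ Q := fun x h1 h2 => by
    have := mem_segment.1 h1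
    have := mem_segment.1 h2
    omega
  have hqP : q ∉ P := fun h => hdisj q h hq
  have hpQ : p ∉ Q := hdisj p hp
  have hpq : p ≠ q := fun h => hqP (h ▸ hp)
  set ins : (Fin n → ι → Matrix (Fin D) (Fin D) ℂ) → Fin n → ι → Matrix (Fin D) (Fin D) ℂ :=
    fun T => insertAt q V.val (insertAt p (V⁻¹).val T) with hins
  have insp : ∀ T, ins T p = fun i => (V⁻¹).val * T p i := fun T => by
    rw [hins]; simp only; rw [insertAt_of_ne hpq, insertAt_self]
  have insq : ∀ T, ins T q = fun i => V.val * T q i := fun T => by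
    rw [hins]; simp only; rw [insertAt_self, insertAt_of_ne hpq.symm]
  have insx : ∀ T x, x ≠ p → x ≠ q → ins T x = T x := fun T x h1 h2 => by
    rw [hins]; simp only; rw [insertAt_of_ne h2, insertAt_of_ne h1]
  -- the relation extends to all states whose tensors agree with `A` on the two segments
  have step1 : ∀ T : Fin n → ι → Matrix (Fin D) (Fin D) ℂ, (∀ x, x ∈ P ∨ x ∈ Q → T x = A) →
      (L * M).mulVec (chain T) = κ • chain (ins T) := by
    intro T hT
    choose O hO using fun x => hA.exists_coeff (T x)
    let K : Fin n → Matrix ι ι ℂ := fun x => if x ∈ P ∨ x ∈ Q then 1 else O x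
    have hK : ∀ x, act (K x) A = T x := fun x => by
      by_cases hx : x ∈ P ∨ x ∈ Q
      · simp only [K, if_pos hx, act_one, hT x hx]
      · simp only [K, if_neg hx]
        exact funext (hO x)
    have e1 : (siteOp K).mulVec (mps A n) = chain T := by
      rw [mps_eq_chain, siteOp_mulVec_chain]
      exact congrArg chain (funext hK)
    have e2 : (siteOp K).mulVec (chain (ins fun _ => A)) = chain (ins T) := by
      rw [siteOp_mulVec_chain]
      congr 1
      funext x
      by_cases h1 : x = p
      · subst h1
        rw [insp, insp, hT x (Or.inl hp)]
        simp only [K, if_pos (Or.inl hp : x ∈ P ∨ x ∈ Q), act_one]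
      · by_cases h2 : x = q
        · subst h2
          rw [insq, insq, hT x (Or.inr hq)]
          simp only [K, if_pos (Or.inr hq : x ∈ P ∨ x ∈ Q), act_one]
        · rw [insx _ _ h1 h2, insx _ _ h1 h2, hK]
    have e3 : L * M * siteOp K = siteOp K * (L * M) := by
      rw [Matrix.mul_assoc, hM.commute_siteOp fun x hx => if_pos (Or.inr hx), ← Matrix.mul_assoc,
        hL.commute_siteOp fun x hx => if_pos (Or.inl hx), Matrix.mul_assoc]
    rw [← e1, Matrix.mulVec_mulVec, e3, ← Matrix.mulVec_mulVec, h, Matrix.mulVec_smul, e2]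
  obtain ⟨L₀, rfl⟩ := hL
  obtain ⟨M₀, rfl⟩ := hM
  set E : ({x // x ∈ P} → ι) → Matrix (Fin D) (Fin D) ℂ :=
    fun u => ∑ v, L₀ u v • regionProd P (fun _ => A) v with hE
  set F : ({x // x ∈ Q} → ι) → Matrix (Fin D) (Fin D) ℂ :=
    fun u => ∑ v, M₀ u v • regionProd Q (fun _ => A) v with hF
  set B := ins fun _ => A with hB
  -- free insertions outside of the segments show that the operators factorize
  have step2 : ∀ (s : Fin n → ι) i j k l, E (fun x => s x) i j * F (fun x => s x) k l
      = κ * (regionProd P B (fun x => s x) i j * regionProd Q B (fun x => s x) k l) := by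
    intro s
    apply entry_mul_entry_eq
    intro Y Z
    have e1 := fun B => chain_two_segments (ι := ι) (l := l) hr (by omega) hn B Y Z
    have e2 := congrFun (step1 (fun x i => if x ∈ P ∨ x ∈ Q then A i else
        if x.val = r then Y else if x.val = r' then Z else 1) fun x hx => by
          funext i; rw [if_pos hx]) s
    have e3 : ins (fun x i => if x ∈ P ∨ x ∈ Q then A i else
        if x.val = r then Y else if x.val = r' then Z else 1)
        = fun x i => if x ∈ P ∨ x ∈ Q then B x i else
        if x.val = r then Y else if x.val = r' then Z else 1 := by
      funext x i
      by_cases h1 : x = p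
      · subst h1
        rw [insp, hB, insp]
        simp only [if_pos (Or.inl hp : x ∈ P ∨ x ∈ Q)]
      · by_cases h2 : x = q
        · subst h2
          rw [insq, hB, insq]
          simp only [if_pos (Or.inr hq : x ∈ P ∨ x ∈ Q)]
        · rw [insx _ _ h1 h2, hB, insx _ _ h1 h2]
    rw [e3, Pi.smul_apply, e1, ← Matrix.mulVec_mulVec, liftOp_mulVec] at e2
    rw [smul_eq_mul] at e2
    have t1 : ∀ W : Matrix (Fin D) (Fin D) ℂ, (E (fun x => s x) * Y * W).trace
        = ∑ u, L₀ (fun x => s x) u * (regionProd P (fun _ => A) u * Y * W).trace := fun W => by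
      simp only [hE, Finset.sum_mul, Matrix.smul_mul, Matrix.trace_sum, Matrix.trace_smul,
        smul_eq_mul]
    have t2 : ∀ W : Matrix (Fin D) (Fin D) ℂ, (W * (F (fun x => s x) * Z)).trace
        = ∑ u, M₀ (fun x => s x) u * (W * (regionProd Q (fun _ => A) u * Z)).trace := fun W => by
      simp only [hF, Finset.sum_mul, Finset.mul_sum, Matrix.smul_mul, Matrix.mul_smul,
        Matrix.trace_sum, Matrix.trace_smul, smul_eq_mul]
    rw [← e2, t1]
    refine Finset.sum_congr rfl fun u _ => ?_
    rw [liftOp_mulVec, t2]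
    congr 1
    have g1 : (fun x : {x // x ∈ Q} => glue P u s x) = fun x : {x // x ∈ Q} => s x :=
      funext fun x => glue_of_notMem _ _ fun hx => hdisj x hx x.2
    rw [g1]
    refine Finset.sum_congr rfl fun v _ => ?_
    rw [e1 fun _ => A]
    have g2 : (fun x : {x // x ∈ Q} => glue Q v (glue P u s) x) = v := funext fun x =>
      glue_of_mem _ _ x.2
    have g3 : (fun x : {x // x ∈ P} => glue Q v (glue P u s) x) = u := funext fun x => by
      rw [glue_of_notMem _ _ (hdisj x x.2), glue_of_mem _ _ x.2]
    rw [g2, g3]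
  have hw : ∀ x, ∃ w : ι → ℂ, ∑ i, w i • B x i = 1 := fun x => by
    by_cases h1 : x = p
    · subst h1
      rw [hB, insp]
      exact hA.exists_weights (Y' := V.val) (by simp)
    · by_cases h2 : x = q
      · subst h2
        rw [hB, insq]
        exact hA.exists_weights (Y' := (V⁻¹).val) (by simp)
      · rw [hB, insx _ _ h1 h2]
        simpa using hA.exists_weights (Y := 1) (Y' := 1) (by simp)
  have hι : Nonempty ι := by
    by_contra hι
    rw [not_nonempty_iff] at hι
    obtain ⟨w, hw⟩ := hw p
    simp at hw
  obtain ⟨s₀, h0⟩ := exists_regionProd_ne_zero Q hw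
  obtain ⟨s₁, h1⟩ := exists_regionProd_ne_zero P hw
  obtain ⟨k, l₀, hkl⟩ : ∃ k l, regionProd Q B (fun x => s₀ x) k l ≠ 0 := by
    by_contra! h; exact h0 (Matrix.ext h)
  obtain ⟨i₁, j₁, hij⟩ : ∃ k l, regionProd P B (fun x => s₁ x) k l ≠ 0 := by
    by_contra! h; exact h1 (Matrix.ext h)
  -- at a configuration of `Q` and an entry where the right-hand side does not vanish, the operator on
  -- `P` acts as a multiple of the insertion
  have step3 : ∀ u i j, E u i j * F (fun x : {x // x ∈ Q} => s₀ x) k l₀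
      = κ * (regionProd P B u i j * regionProd Q B (fun x => s₀ x) k l₀) := by
    intro u i j
    have g1 : (fun x : {x // x ∈ Q} => glue P u s₀ x) = fun x : {x // x ∈ Q} => s₀ x :=
      funext fun x => glue_of_notMem _ _ fun hx => hdisj x hx x.2
    have g2 : (fun x : {x // x ∈ P} => glue P u s₀ x) = u := funext fun x => glue_of_mem _ _ x.2
    have := step2 (glue P u s₀) i j k l₀
    rwa [g1, g2] at this
  set f := F (fun x : {x // x ∈ Q} => s₀ x) k l₀ with hf
  set b := regionProd Q B (fun x => s₀ x) k l₀ with hb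
  have hf0 : f ≠ 0 := by
    intro h
    have := step3 (fun x => s₁ x) i₁ j₁
    rw [h, mul_zero] at this
    exact mul_ne_zero hκ (mul_ne_zero hij hkl) this.symm
  have step4 : ∀ u, E u = (κ * b / f) • regionProd P B u := by
    intro u
    ext i j
    rw [Matrix.smul_apply, smul_eq_mul, ← mul_right_inj' hf0, mul_comm, step3]
    field_simp
  refine ⟨κ * b / f, div_ne_zero (mul_ne_zero hκ hkl) hf0, fun T hT => ?_⟩
  funext s
  obtain ⟨Ev, hEv⟩ := exists_environment (hlr.1.trans hlr.2.le) T s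
  have hs : glue P (fun x => s x) s = s := funext fun x => by
    by_cases hx : x ∈ P
    · rw [glue_of_mem _ _ hx]
    · rw [glue_of_notMem _ _ hx]
  have e1 : chain (insertAt p (V⁻¹).val T) s = (regionProd P B (fun x => s x) * Ev).trace := by
    have := hEv (insertAt p (V⁻¹).val T) (fun x => s x) fun x hx =>
      insertAt_of_ne (fun e => hx (by rw [e]; exact hp)) _ _
    rw [hs] at this
    rw [this, regionProd_congr]
    intro x hx
    by_cases h1 : x = p
    · subst h1
      rw [hB, insp, insertAt_self, hT _ hp]
    · rw [hB, insx _ _ h1 (fun h2 => hqP (by rw [← h2]; exact hx)), insertAt_of_ne h1, hT _ hx]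
  rw [liftOp_mulVec, Pi.smul_apply, e1, smul_eq_mul, ← smul_eq_mul, ← Matrix.trace_smul,
    ← Matrix.smul_mul, ← step4, hE]
  simp only [Finset.sum_mul, Matrix.trace_sum, Matrix.smul_mul, Matrix.trace_smul, smul_eq_mul]
  refine Finset.sum_congr rfl fun u _ => ?_
  rw [hEv T u fun _ _ => rfl, regionProd_congr hT]

/-- The cocycle of the string operators of a matrix product state is determined, up to a
coboundary, by the gauge transformations. -/
theorem HasStrings.cohClass_eq {A : ι → Matrix (Fin D) (Fin D) ℂ} (hD : 0 < D) (hA : Spans A)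
    {R : G → Matrix ι ι ℂ} {ω ω' : Z2 G} {V : G → (Matrix (Fin D) (Fin D) ℂ)ˣ} {c : G → Circle}
    (hR : ∀ g h, R (g * h) = R g * R h) (hR1 : R 1 = 1)
    (hV : ∀ g i, act (R g) A i = (c g : ℂ) • ((V g)⁻¹.val * A i * (V g).val))
    (hω : ∀ g h, (V g).val * (V h).val = phase ω' g h • (V (g * h)).val)
    {l r l' r' : ℕ} (hr : r < l') (hn : r' < n) {p q : Fin n} (hp : p ∈ segment n l r)
    (hq : q ∈ segment n l' r')
    (h : HasStrings R ω (segment n p q) (segment n l r) (segment n l' r') (mps A n)) :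
    cohClass ω' = cohClass ω := by
  have : NeZero D := ⟨hD.ne'⟩
  obtain ⟨L, M, hL, hM, h1, h2⟩ := h
  have hlr := mem_segment.1 hp
  have hlr' := mem_segment.1 hq
  have hpq : p < q := by rw [Fin.lt_def]; omega
  have hqP : q ∉ segment n l r := fun h => by have := mem_segment.1 h; omega
  have key : ∀ g, ∃ lam : ℂ, lam ≠ 0 ∧ ∀ T : Fin n → ι → Matrix (Fin D) (Fin D) ℂ,
      (∀ x ∈ segment n l r, T x = A) →
        (L g).mulVec (chain T) = lam • chain (insertAt p (V g)⁻¹.val T) := by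
    intro g
    refine insert_of_insert_insert hA (κ := (c g : ℂ) ^ (segment n p q).card)
      (pow_ne_zero _ (Circle.coe_ne_zero _)) hr hn hp hq (hL g) (hM g) ?_
    have := onSites_mulVec_chain (Y := 1) (T := fun _ => A) (by simp) (by simp) (hV g) hpq
      (fun _ _ => rfl)
    rw [insertAt_one, Matrix.one_mul] at this
    rw [← h1, mps_eq_chain, this]
  choose lam hlam hins using key
  refine cohClass_eq_of_phase lam hlam fun g h => ?_
  have e1 := h2 g h
  rw [mulVec_mps_of_insert hR hR1 hV hω hpq hqP hins, mps_eq_chain, hins _ _ fun _ _ => rfl,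
    smul_smul] at e1
  obtain ⟨s, hs⟩ := chain_ne_zero (T := insertAt p (V (g * h))⁻¹.val fun _ : Fin n => A) fun x => by
    by_cases h1 : x = p
    · subst h1
      rw [insertAt_self]
      exact hA.exists_weights (Y' := (V (g * h)).val) (by simp)
    · rw [insertAt_of_ne h1]
      simpa using hA.exists_weights (Y := 1) (Y' := 1) (by simp)
  have e2 := mul_right_cancel₀ hs (congrFun e1 s)
  have := phase_ne_zero ω g h
  have := phase_ne_zero ω' g h
  field_simp at e2
  linear_combination -e2

end Recover

/-! ### Layers of brickwork circuits -/

section Layers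

theorem sitePair_injective {M : ℕ} (t : ℕ) :
    Function.Injective (Sum.elim (pairFst (M := M) t) (pairSnd t)) := by
  have hs : ∀ x : Fin M, 2 * x.val + t % 2 + 1 < 2 * M ∧ (pairSnd t x).val = 2 * x.val + t % 2 + 1 ∨
      (2 * x.val + t % 2 + 1 = 2 * M ∧ (pairSnd t x).val = 0) := by
    intro x
    have := x.isLt
    have := Nat.mod_lt t (by norm_num : 0 < 2)
    rcases Nat.lt_or_ge (2 * x.val + t % 2 + 1) (2 * M) with h | h
    · exact Or.inl ⟨h, Nat.mod_eq_of_lt h⟩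
    · have h' : 2 * x.val + t % 2 + 1 = 2 * M := by omega
      refine Or.inr ⟨h', ?_⟩
      simp only [pairSnd]
      rw [h', Nat.mod_self]
  have hf : ∀ x : Fin M, (pairFst t x).val = 2 * x.val + t % 2 := fun _ => rfl
  rintro (x | x) (y | y) h
  all_goals
    simp only [Sum.elim_inl, Sum.elim_inr, Fin.ext_iff] at h
    have := x.isLt
    have := y.isLt
    have := hf x
    have := hf y
    have := hs x
    have := hs y
  · congr 1; ext; omega
  · exfalso; omega
  · exfalso; omega
  · congr 1; ext; omega

/-- The sites of a ring of even length, as first and second sites of the pairs of layer `t`. -/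
def sitePair {M : ℕ} (t : ℕ) : Fin M ⊕ Fin M ≃ Fin (2 * M) :=
  Equiv.ofBijective _ ((Fintype.bijective_iff_injective_and_card _).2
    ⟨sitePair_injective t, by simp [two_mul]⟩)

/-- Configurations of the sites as configurations of the pairs of layer `t`. -/
def pairConf {M : ℕ} (t : ℕ) (a : Type) : (Fin (2 * M) → a) ≃ (Fin M → a × a) where
  toFun s x := (s (pairFst t x), s (pairSnd t x))
  invFun r y := Sum.elim (fun x => (r x).1) (fun x => (r x).2) ((sitePair t).symm y)
  left_inv s := by
    funext y
    obtain ⟨x, rfl⟩ := (sitePair t).surjective y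
    simp only [Equiv.symm_apply_apply]
    rcases x with x | x <;> rfl
  right_inv r := by
    funext x
    have h1 : (sitePair t).symm (pairFst t x) = Sum.inl x := (Equiv.symm_apply_eq _).2 rfl
    have h2 : (sitePair t).symm (pairSnd t x) = Sum.inr x := (Equiv.symm_apply_eq _).2 rfl
    simp [h1, h2]

/-- The operator that acts by `F x` on the `x`-th pair of layer `t`. -/
def pairOp {M : ℕ} (t : ℕ) {a b : Type} (F : Fin M → Matrix (b × b) (a × a) ℂ) :
    Matrix (Fin (2 * M) → b) (Fin (2 * M) → a) ℂ :=
  (siteOp F).submatrix (pairConf t b) (pairConf t a)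

variable {M : ℕ} {a b c : Type}

theorem pairOp_mul [Fintype b] (t : ℕ) (F : Fin M → Matrix (c × c) (b × b) ℂ)
    (F' : Fin M → Matrix (b × b) (a × a) ℂ) :
    pairOp t F * pairOp t F' = pairOp t fun x => F x * F' x := by
  rw [pairOp, pairOp, Matrix.submatrix_mul_equiv, siteOp_mul, pairOp]

theorem pairOp_one [DecidableEq a] (t : ℕ) :
    pairOp t (fun _ : Fin M => (1 : Matrix (a × a) (a × a) ℂ)) = 1 := by
  rw [pairOp, siteOp_one, Matrix.submatrix_one_equiv]

theorem pairOp_smul (t : ℕ) (r : Fin M → ℂ) (F : Fin M → Matrix (b × b) (a × a) ℂ) :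
    pairOp t (fun x => r x • F x) = (∏ x, r x) • pairOp t F := by
  rw [pairOp, siteOp_smul, Matrix.submatrix_smul]; rfl

theorem prod_pairs {M : ℕ} (t : ℕ) (f : Fin (2 * M) → ℂ) :
    ∏ y, f y = ∏ x : Fin M, f (pairFst t x) * f (pairSnd t x) := by
  rw [← (sitePair t).prod_comp, Fintype.prod_sum_type, ← Finset.prod_mul_distrib]
  rfl

theorem onSites_eq_pairOp [DecidableEq a] (t : ℕ) {S : Finset (Fin (2 * M))}
    (hS : ∀ x : Fin M, pairFst t x ∈ S ↔ pairSnd t x ∈ S) (u : Matrix a a ℂ) :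
    onSites S u = pairOp t fun x : Fin M => if pairFst t x ∈ S then u ⊗ₖ u else 1 := by
  ext s r
  simp only [onSites, siteOp, pairOp, Matrix.of_apply, Matrix.submatrix_apply]
  rw [prod_pairs t]
  refine Finset.prod_congr rfl fun x _ => ?_
  by_cases h : pairFst t x ∈ S
  · rw [if_pos h, if_pos h, if_pos ((hS x).1 h)]
    rfl
  · rw [if_neg h, if_neg h, if_neg fun h' => h ((hS x).2 h'), ← Matrix.one_kronecker_one]
    rfl

/-- A layer of gates splits across the boundary of a region that is a union of pairs. -/
theorem pairOp_eq_submatrix (t : ℕ) {S : Finset (Fin (2 * M))}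
    (hS : ∀ x : Fin M, pairFst t x ∈ S ↔ pairSnd t x ∈ S) (a b : Type) :
    ∃ (f : (Fin M → Matrix (b × b) (a × a) ℂ) →
        Matrix ({x // x ∈ S} → b) ({x // x ∈ S} → a) ℂ)
      (g : (Fin M → Matrix (b × b) (a × a) ℂ) →
        Matrix ({x // x ∉ S} → b) ({x // x ∉ S} → a) ℂ),
      ∀ F, pairOp t F = (f F ⊗ₖ g F).submatrix (splitAt S b) (splitAt S a) := by
  refine ⟨fun F => Matrix.of fun s r => ∏ x : {x : Fin M // pairFst t x ∈ S},
      F x (s ⟨_, x.2⟩, s ⟨_, (hS x).1 x.2⟩) (r ⟨_, x.2⟩, r ⟨_, (hS x).1 x.2⟩),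
    fun F => Matrix.of fun s r => ∏ x : {x : Fin M // pairFst t x ∉ S},
      F x (s ⟨_, x.2⟩, s ⟨_, fun h => x.2 ((hS x).2 h)⟩)
        (r ⟨_, x.2⟩, r ⟨_, fun h => x.2 ((hS x).2 h)⟩), fun F => ?_⟩
  ext s r
  simp only [pairOp, siteOp, Matrix.of_apply, Matrix.submatrix_apply, Matrix.kroneckerMap_apply]
  rw [← Fintype.prod_subtype_mul_prod_subtype (fun x => pairFst t x ∈ S)]
  congr!

theorem exists_leftInverse [Fintype a] [Fintype b] [DecidableEq a] {N : Matrix b a ℂ}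
    (hN : Function.Injective N.mulVec) : ∃ N' : Matrix a b ℂ, N' * N = 1 := by
  classical
  obtain ⟨f, hf⟩ := LinearMap.exists_leftInverse_of_injective (Matrix.toLin' N)
    (LinearMap.ker_eq_bot.2 hN)
  refine ⟨LinearMap.toMatrix' f, ?_⟩
  apply Matrix.toLin'.injective
  rw [Matrix.toLin'_mul, Matrix.toLin'_toMatrix', hf, Matrix.toLin'_one]

/-- A layer of injective gates maps operators on a union of pairs to operators on the same
region. -/
theorem IsLocal.exists_intertwine_pairOp [Fintype a] [Fintype b] [DecidableEq a] [DecidableEq b]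
    (t : ℕ) {S : Finset (Fin (2 * M))}
    (hS : ∀ x : Fin M, pairFst t x ∈ S ↔ pairSnd t x ∈ S) {F : Fin M → Matrix (b × b) (a × a) ℂ}
    {F' : Fin M → Matrix (a × a) (b × b) ℂ} (hF : ∀ x, F' x * F x = 1)
    {O : Matrix (Fin (2 * M) → a) (Fin (2 * M) → a) ℂ} (h : IsLocal S O) :
    ∃ O' : Matrix (Fin (2 * M) → b) (Fin (2 * M) → b) ℂ,
      IsLocal S O' ∧ pairOp t F * O = O' * pairOp t F := by
  obtain ⟨f, g, hfg⟩ := pairOp_eq_submatrix t hS a b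
  obtain ⟨f', g', hfg'⟩ := pairOp_eq_submatrix t hS b a
  have h1 : pairOp t F' * pairOp t F = 1 := by
    rw [pairOp_mul]
    simp only [hF]
    exact pairOp_one t
  rw [hfg, hfg', Matrix.submatrix_mul_equiv, ← Matrix.mul_kronecker_mul] at h1
  rcases isEmpty_or_nonempty ({x // x ∉ S} → a) with hE | ⟨⟨v⟩⟩
  · have : IsEmpty (Fin (2 * M) → a) := ⟨fun s => hE.false fun x => s x⟩
    refine ⟨0, ⟨0, ?_⟩, Matrix.ext fun _ s => isEmptyElim s⟩
    simp [liftOp]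
  · -- the two tensor factors of an identity operator are multiples of identity operators
    have h2 : (((g' F' * g F) v v) • f' F') * f F = 1 := by
      ext i j
      have h3 := congrFun (congrFun h1 ((splitAt S a).symm (i, v))) ((splitAt S a).symm (j, v))
      simp only [Matrix.submatrix_apply, Equiv.apply_symm_apply, Matrix.kroneckerMap_apply,
        Matrix.one_apply, Equiv.apply_eq_iff_eq, Prod.mk.injEq, and_true] at h3
      rw [Matrix.smul_mul, Matrix.smul_apply, smul_eq_mul, mul_comm, h3, Matrix.one_apply]
    exact h.exists_intertwine (hfg F) h2

end Layers

/-! ### String operators under brickwork circuits -/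

section Circuits

variable {G : Type} [Group G]

/-- An operator on a ring as a state of the doubled local space. -/
def vectorize {n : ℕ} {a : Type} (X : Matrix (Fin n → a) (Fin n → a) ℂ) : (Fin n → a × a) → ℂ :=
  fun s => X (fun x => (s x).1) fun x => (s x).2

/-- The symmetry on the ket space of the doubled local space. -/
def ketRep {d : ℕ} (U : G →* Matrix.unitaryGroup (Fin d) ℂ) (g : G) :
    Matrix (Fin d × Fin d) (Fin d × Fin d) ℂ :=
  (U g).val ⊗ₖ (1 : Matrix (Fin d) (Fin d) ℂ)

theorem ketRep_mul {d : ℕ} (U : G →* Matrix.unitaryGroup (Fin d) ℂ) (g h : G) :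
    ketRep U (g * h) = ketRep U g * ketRep U h := by
  simp [ketRep, ← Matrix.mul_kronecker_mul]

theorem ketRep_one {d : ℕ} (U : G →* Matrix.unitaryGroup (Fin d) ℂ) : ketRep U 1 = 1 := by
  simp [ketRep]

/-- The superoperator of a two-site channel, as an operator on two sites of the doubled space. -/
def gateOp {κ a b : Type} [Fintype κ] (K : κ → Matrix (b × b) (a × a) ℂ) :
    Matrix ((b × b) × (b × b)) ((a × a) × (a × a)) ℂ :=
  (superOp K).submatrix (Equiv.prodProdProdComm b b b b) (Equiv.prodProdProdComm a a a a)

theorem vectorize_layerChannel {M e d d' : ℕ} (t : ℕ)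
    (K : Fin M → Fin e → Matrix (Fin d' × Fin d') (Fin d × Fin d) ℂ)
    (X : Matrix (Fin (2 * M) → Fin d) (Fin (2 * M) → Fin d) ℂ) :
    vectorize (layerChannel t K X) = (pairOp t fun x => gateOp (K x)).mulVec (vectorize X) := by
  funext s
  rw [vectorize, layerChannel, krausMap_apply, Matrix.mulVec, Matrix.mulVec, dotProduct, dotProduct,
    ← (Equiv.arrowProdEquivProdArrow (Fin (2 * M)) (fun _ => Fin d) fun _ => Fin d).sum_comp]
  refine Finset.sum_congr rfl fun r _ => ?_
  congr 1
  simp only [superOp, pairOp, gateOp, siteOp, Matrix.of_apply, Matrix.submatrix_apply, star_prod,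
    ← Finset.prod_mul_distrib]
  rw [Finset.prod_univ_sum, Fintype.piFinset_univ]
  rfl

theorem gateOp_intertwine {d d' e : ℕ} {U : G →* Matrix.unitaryGroup (Fin d) ℂ}
    {U' : G →* Matrix.unitaryGroup (Fin d') ℂ}
    {K : Fin e → Matrix (Fin d' × Fin d') (Fin d × Fin d) ℂ}
    (hK : IsSymNondegChannel (pairRep U) (pairRep U') K) :
    ∃ θ : G → ℂ, (∀ g, θ g ≠ 0) ∧ ∀ g, gateOp K * (ketRep U g ⊗ₖ ketRep U g)
      = θ g • ((ketRep U' g ⊗ₖ ketRep U' g) * gateOp K) := by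
  obtain ⟨θ, hθ⟩ := hK.stronglySymmetric
  refine ⟨fun g => (θ g : ℂ)⁻¹, fun g => inv_ne_zero (Circle.coe_ne_zero _), fun g => ?_⟩
  have h1 : ∀ {d : ℕ} (U : G →* Matrix.unitaryGroup (Fin d) ℂ), ketRep U g ⊗ₖ ketRep U g
      = (pairRep U g ⊗ₖ (1 : Matrix (Fin d × Fin d) (Fin d × Fin d) ℂ)).submatrix
        (Equiv.prodProdProdComm _ _ _ _) (Equiv.prodProdProdComm _ _ _ _) := by
    intro d U
    ext ⟨⟨i, i'⟩, ⟨j, j'⟩⟩ ⟨⟨k, k'⟩, ⟨l, l'⟩⟩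
    simp only [ketRep, pairRep, ← Matrix.one_kronecker_one, Matrix.submatrix_apply,
      Matrix.kroneckerMap_apply, Equiv.prodProdProdComm_apply]
    ring
  have hu : (pairRep U g).conjTranspose * pairRep U g = 1 := by
    have := Matrix.mem_unitaryGroup_iff'.1 (U g).2
    rw [Matrix.star_eq_conjTranspose] at this
    rw [pairRep, Matrix.conjTranspose_kronecker, ← Matrix.mul_kronecker_mul, this,
      Matrix.one_kronecker_one]
  have h2 : ∀ k, K k * pairRep U g = (θ g : ℂ)⁻¹ • (pairRep U' g * K k) := by
    intro k
    have := congrArg (· * pairRep U g) (hθ g k)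
    simp only [Matrix.mul_assoc, hu, Matrix.mul_one, Matrix.smul_mul] at this
    rw [this, smul_smul, inv_mul_cancel₀ (Circle.coe_ne_zero _), one_smul]
  have h3 : superOp K = ∑ k, K k ⊗ₖ (K k).map star := by
    ext p q
    simp [superOp, Matrix.sum_apply]
  rw [h1, h1, gateOp, Matrix.submatrix_mul_equiv, Matrix.submatrix_mul_equiv, h3, Matrix.sum_mul,
    Matrix.mul_sum]
  simp only [← Matrix.mul_kronecker_mul, h2, Matrix.mul_one, Matrix.one_mul,
    Matrix.smul_kronecker, ← Finset.smul_sum]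
  rfl

theorem gateOp_injective {κ a b : Type} [Fintype κ] [Fintype a]
    {K : κ → Matrix (b × b) (a × a) ℂ} (hK : Function.Injective (krausMap K)) :
    Function.Injective (gateOp K).mulVec := by
  have h := superOp_mulVec_injective.2 hK
  intro v w e
  have key : ∀ v, (gateOp K).mulVec v = (superOp K).mulVec (v ∘ (Equiv.prodProdProdComm a a a a).symm)
      ∘ Equiv.prodProdProdComm b b b b := fun v => by
    rw [gateOp, Matrix.submatrix_mulVec_equiv]
  rw [key, key] at e
  have e' := h ((Equiv.surjective _).injective_comp_right e)
  exact (Equiv.surjective _).injective_comp_right e'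

theorem pair_mem_segment_iff {M : ℕ} {t l r : ℕ} (hl : l % 2 = t % 2) (hr : r % 2 = t % 2)
    (hM : r ≤ 2 * M) (x : Fin M) :
    pairFst t x ∈ segment (2 * M) l r ↔ pairSnd t x ∈ segment (2 * M) l r := by
  rw [mem_segment, mem_segment]
  simp only [pairFst, pairSnd]
  have := x.isLt
  rcases Nat.lt_or_ge (2 * x.val + t % 2 + 1) (2 * M) with h | h
  · rw [Nat.mod_eq_of_lt h]; omega
  · have h' : 2 * x.val + t % 2 + 1 = 2 * M := by omega
    rw [h', Nat.mod_self]
    omega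

/-- The string operators of a state survive a brickwork circuit of strongly symmetric channels. In
each layer, their supports grow by one site in both directions. -/
theorem HasStrings.brickwork {M d₀ : ℕ} {U₀ : G →* Matrix.unitaryGroup (Fin d₀) ℂ}
    {X₀ : Matrix (Fin (2 * M) → Fin d₀) (Fin (2 * M) → Fin d₀) ℂ} {ω : Z2 G} {p q T : ℕ}
    (hp : p % 2 = 0) (hq : q % 2 = 0) (hTp : T ≤ p) (hpq : p + 2 * T + 4 ≤ q)
    (hqM : q + T + 3 ≤ 2 * M)
    (h₀ : HasStrings (ketRep U₀) ω (segment (2 * M) p q) (segment (2 * M) p (p + 2))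
      (segment (2 * M) q (q + 2)) (vectorize X₀)) {t d : ℕ}
    {U : G →* Matrix.unitaryGroup (Fin d) ℂ}
    {X : Matrix (Fin (2 * M) → Fin d) (Fin (2 * M) → Fin d) ℂ}
    (hX : BrickworkImage U₀ X₀ t d U X) (ht : t ≤ T) :
    HasStrings (ketRep U) ω (segment (2 * M) (p - t) (q + t))
      (segment (2 * M) (p - t) (p + 2 + t)) (segment (2 * M) (q - t) (q + 2 + t)) (vectorize X) := by
  induction hX with
  | nil => exact h₀
  | @layer t d d' e U X U' K hX hK ih =>
    have ih := ih (by omega)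
    rw [vectorize_layerChannel]
    choose F' hF' using fun x => exists_leftInverse (gateOp_injective (hK x).nondegenerate)
    choose θ hθ0 hθ using fun x => gateOp_intertwine (hK x)
    have hI := pair_mem_segment_iff (M := M) (t := t) (l := p - t) (r := q + t) (by omega) (by omega)
      (by omega)
    have hP := pair_mem_segment_iff (M := M) (t := t) (l := p - t) (r := p + 2 + t) (by omega)
      (by omega) (by omega)
    have hQ := pair_mem_segment_iff (M := M) (t := t) (l := q - t) (r := q + 2 + t) (by omega)
      (by omega) (by omega)
    have hinv : ∀ {d : ℕ} (U : G →* Matrix.unitaryGroup (Fin d) ℂ) g,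
        ketRep U g * ketRep U g⁻¹ = 1 := fun U g => by
      rw [← ketRep_mul, mul_inv_cancel, ketRep_one]
    have hinv' : ∀ {d : ℕ} (U : G →* Matrix.unitaryGroup (Fin d) ℂ) g,
        ketRep U g⁻¹ * ketRep U g = 1 := fun U g => by
      rw [← ketRep_mul, inv_mul_cancel, ketRep_one]
    have h1 := ih.map (N := pairOp t fun x => gateOp (K x)) (hinv U) (hinv' U')
      (fun O hO => hO.exists_intertwine_pairOp t hP hF')
      (fun O hO => hO.exists_intertwine_pairOp t hQ hF')
      (θ := fun g => ∏ x : Fin M, if pairFst t x ∈ segment (2 * M) (p - t) (q + t) then θ x g else 1)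
      (fun g => Finset.prod_ne_zero_iff.2 fun x _ => by
        split_ifs
        · exact hθ0 x g
        · exact one_ne_zero)
      (fun g => by
        rw [onSites_eq_pairOp t hI, onSites_eq_pairOp t hI, pairOp_mul, pairOp_mul, ← pairOp_smul]
        congr 1
        funext x
        split_ifs
        · exact hθ x g
        · rw [one_smul, Matrix.mul_one, Matrix.one_mul])
    refine h1.enlarge (J := segment (2 * M) (p - t - 1) (p - t))
      (K := segment (2 * M) (q + t) (q + t + 1)) (ketRep_mul U') (ketRep_one U') ?_ ?_ ?_ ?_ ?_ ?_ ?_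
      ?_ ?_
    · ext x
      simp only [Finset.mem_union, mem_segment]
      omega
    all_goals
      first
      | rw [Finset.disjoint_left]
        intro x hx
        simp only [mem_segment] at hx ⊢
        omega
      | intro x hx
        simp only [mem_segment] at hx ⊢
        omega

/-- One-way connected density operators are in the same phase: the circuit transports the string
operators of the symmetry on the ket index, and these determine the class. -/
theorem MapsTo.cohClass_eq {ρ ρ' : MPO G} (hρ : ρ.IsStrongInjectiveMPDO)
    (hρ' : ρ'.IsStrongInjectiveMPDO) (h : MapsTo ρ ρ') {ω ω' : Z2 G} (hω : ρ.InPhase ω)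
    (hω' : ρ'.InPhase ω') : cohClass ω' = cohClass ω := by
  obtain ⟨T, hT⟩ := h
  -- on a ring of `8 T + 8` sites, the supports of the string operators with ends near `2 T` and
  -- `6 T + 4` grow by one site per layer and do not meet within `T` layers
  obtain ⟨Y, hY, r, -, hr⟩ := hT (4 * T + 4) (by omega)
  obtain ⟨V, c, ω₁, hV, hm, hc⟩ := hω.leftClass
  obtain ⟨V', c', ω₁', hV', hm', hc'⟩ := hω'.leftClass
  have hn : ∀ k, k ≤ 8 * T + 7 → k < 2 * (4 * T + 4) := fun k hk => by omega
  have h0 := hasStrings_mps (n := 2 * (4 * T + 4)) (R := ketRep ρ.U)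
    (p := ⟨2 * T, hn _ (by omega)⟩) (q := ⟨6 * T + 4, hn _ (by omega)⟩)
    (P := segment _ (2 * T) (2 * T + 2)) (Q := segment _ (6 * T + 4) (6 * T + 4 + 2))
    ((injectiveTensor_iff_spans _).1 hρ.injective) (ketRep_mul ρ.U) (ketRep_one ρ.U) hV hm
    (by rw [Fin.lt_def]; simp only; omega) (mem_segment.2 (by simp)) (mem_segment.2 (by simp))
    (fun h => by have := mem_segment.1 h; simp only at this; omega)
  have h1 := HasStrings.brickwork (T := T) (p := 2 * T) (q := 6 * T + 4)
    (X₀ := ρ.state (2 * (4 * T + 4))) (by omega) (by omega) (by omega) (by omega) (by omega) h0 hY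
    le_rfl
  have h2 := h1.smul r
  have h3 : (r : ℂ) • vectorize Y = mps ρ'.doubledTensor (2 * (4 * T + 4)) := by
    funext s
    have := congrFun (congrFun hr fun x => (s x).1) fun x => (s x).2
    rw [ρ'.state_eq_mps] at this
    exact this.symm
  rw [h3] at h2
  have := HasStrings.cohClass_eq (p := ⟨2 * T - T, hn _ (by omega)⟩)
    (q := ⟨6 * T + 4 + T, hn _ (by omega)⟩) hρ'.bond_pos
    ((injectiveTensor_iff_spans _).1 hρ'.injective) (ketRep_mul ρ'.U) (ketRep_one ρ'.U) hV' hm'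
    (by omega) (by omega) (mem_segment.2 (by simp only; omega)) (mem_segment.2 (by simp only; omega))
    h2
  rw [← hc', this, hc]

end Circuits

/-! ### Deformations of pure states -/

section Deformation

open scoped Matrix.Norms.Elementwise Topology

variable {d D : ℕ}

/-- The triples `(s, u, V)` such that `V` implements the unitary `u` on the virtual space of the
tensor `A s`, up to a phase. The condition is written without inverse, so that it is closed; it admits
`V = 0`. -/
def gaugeSet (A : unitInterval → Fin d → Matrix (Fin D) (Fin D) ℂ) :
    Set (unitInterval × Matrix (Fin d) (Fin d) ℂ × Matrix (Fin D) (Fin D) ℂ) :=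
  {z | z.2.1 ∈ Matrix.unitaryGroup (Fin d) ℂ ∧
    ∃ c : Circle, ∀ i, z.2.2 * act z.2.1 (A z.1) i = (c : ℂ) • (A z.1 i * z.2.2)}

variable {A : unitInterval → Fin d → Matrix (Fin D) (Fin D) ℂ}

theorem isClosed_gaugeSet (hA : Continuous A) : IsClosed (gaugeSet A) := by
  have hA' : ∀ i, Continuous fun s => A s i := fun i => (continuous_apply i).comp hA
  have h1 : IsClosed {z : (unitInterval × Matrix (Fin d) (Fin d) ℂ × Matrix (Fin D) (Fin D) ℂ)
      × Circle | ∀ i, z.1.2.2 * act z.1.2.1 (A z.1.1) i = (z.2 : ℂ) • (A z.1.1 i * z.1.2.2)} := by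
    have k1 : Continuous fun z : (unitInterval × Matrix (Fin d) (Fin d) ℂ × Matrix (Fin D) (Fin D) ℂ)
      × Circle => z.1.2.2 := by fun_prop
    have k2 : Continuous fun z : (unitInterval × Matrix (Fin d) (Fin d) ℂ × Matrix (Fin D) (Fin D) ℂ)
      × Circle => (z.2 : ℂ) := by fun_prop
    have k3 : ∀ i, Continuous fun z : (unitInterval × Matrix (Fin d) (Fin d) ℂ
      × Matrix (Fin D) (Fin D) ℂ) × Circle => A z.1.1 i := fun i => (hA' i).comp (by fun_prop)
    have k4 : ∀ i j, Continuous fun z : (unitInterval × Matrix (Fin d) (Fin d) ℂ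
      × Matrix (Fin D) (Fin D) ℂ) × Circle => z.1.2.1 i j := fun i j => by fun_prop
    simp only [Set.ofPred_forall]
    refine isClosed_iInter fun i => isClosed_eq ?_ (k2.smul ((k3 i).matrix_mul k1))
    exact k1.matrix_mul (continuous_finsetSum _ fun j _ => (k4 i j).smul (k3 j))
  have h2 := isClosedMap_fst_of_compactSpace _ h1
  have h3 : IsClosed {z : unitInterval × Matrix (Fin d) (Fin d) ℂ × Matrix (Fin D) (Fin D) ℂ |
      z.2.1 ∈ Matrix.unitaryGroup (Fin d) ℂ} := by
    simp only [Matrix.mem_unitaryGroup_iff]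
    exact isClosed_eq (by fun_prop) (by fun_prop)
  convert h3.inter h2 using 1
  ext z
  simp [gaugeSet]

theorem act_unitary_spans {u : Matrix (Fin d) (Fin d) ℂ} (hu : u ∈ Matrix.unitaryGroup (Fin d) ℂ)
    {B : Fin d → Matrix (Fin D) (Fin D) ℂ} (hB : Spans B) : Spans (act u B) := by
  refine hB.act_of_injective fun v w h => ?_
  have := congrArg (star u).mulVec h
  rwa [Matrix.mulVec_mulVec, Matrix.mulVec_mulVec, Matrix.mem_unitaryGroup_iff'.1 hu,
    Matrix.one_mulVec, Matrix.one_mulVec] at this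

/-- Nonzero intertwiners of injective tensors are invertible: the kernel is invariant under all
matrices. -/
theorem det_ne_zero_of_intertwine {n : Type} [Fintype n] [DecidableEq n] {ι : Type}
    {B C : ι → Matrix n n ℂ} (hB : Spans B) {V : Matrix n n ℂ} (hV : V ≠ 0) {c : ℂ}
    (h : ∀ i, V * B i = c • (C i * V)) : V.det ≠ 0 := by
  intro h0
  obtain ⟨x, hx, hVx⟩ := Matrix.exists_mulVec_eq_zero_iff.2 h0
  apply hV
  let F : Matrix n n ℂ →ₗ[ℂ] (n → ℂ) :=
    { toFun := fun Y => (V * Y).mulVec x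
      map_add' := fun Y Z => by rw [Matrix.mul_add, Matrix.add_mulVec]
      map_smul' := fun r Y => by rw [Matrix.mul_smul, Matrix.smul_mulVec]; rfl }
  have hF : F = 0 := hB.ext fun i => by
    change (V * B i).mulVec x = 0
    rw [h, Matrix.smul_mulVec, ← Matrix.mulVec_mulVec, hVx, Matrix.mulVec_zero, smul_zero]
  obtain ⟨j, hj⟩ := Function.ne_iff.1 hx
  have hj' : x j ≠ 0 := hj
  ext i k
  have h1 : (V * Matrix.single k j (1 : ℂ)).mulVec x = 0 :=
    LinearMap.congr_fun hF (Matrix.single k j 1)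
  have h2 := congrFun h1 i
  rw [← Matrix.mulVec_mulVec] at h2
  simpa [Matrix.mulVec, dotProduct, Matrix.single_apply, ite_and, hj'] using h2

/-- The matrices of determinant one in `gaugeSet` are bounded: by compactness, the determinants of
those of norm one are bounded away from zero. -/
theorem exists_bound_gaugeSet (hA : Continuous A) (hs : ∀ s, Spans (A s)) (hD : 0 < D) :
    ∃ C : ℝ, ∀ z ∈ gaugeSet A, z.2.2.det = 1 → ‖z.2.2‖ ≤ C := by
  have : ProperSpace (Matrix (Fin d) (Fin d) ℂ) :=
    inferInstanceAs (ProperSpace (Fin d → Fin d → ℂ))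
  have : ProperSpace (Matrix (Fin D) (Fin D) ℂ) :=
    inferInstanceAs (ProperSpace (Fin D → Fin D → ℂ))
  set S := gaugeSet A ∩ {z | ‖z.2.2‖ = 1} with hS
  have hc : IsCompact S := by
    refine ((isCompact_univ (X := unitInterval)).prod ((isCompact_closedBall
      (0 : Matrix (Fin d) (Fin d) ℂ) 1).prod (isCompact_closedBall
      (0 : Matrix (Fin D) (Fin D) ℂ) 1))).of_isClosed_subset ((isClosed_gaugeSet hA).inter
      (isClosed_eq (by fun_prop) (by fun_prop))) ?_
    rintro ⟨s, u, V⟩ ⟨⟨hu, -⟩, hV⟩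
    refine ⟨trivial, ?_, ?_⟩
    · rw [mem_closedBall_zero_iff]; exact entrywise_sup_norm_bound_of_unitary hu
    · rw [mem_closedBall_zero_iff]; exact le_of_eq hV
  have hdet : ∀ z ∈ S, z.2.2.det ≠ 0 := by
    rintro ⟨s, u, V⟩ ⟨⟨hu, c, h⟩, hV⟩
    refine det_ne_zero_of_intertwine (act_unitary_spans hu (hs s)) ?_ h
    rintro rfl
    simp at hV
  obtain ⟨δ, hδ, hle⟩ : ∃ δ : ℝ, 0 < δ ∧ ∀ z ∈ S, δ ≤ ‖z.2.2.det‖ := by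
    rcases S.eq_empty_or_nonempty with he | hne
    · exact ⟨1, one_pos, by simp [he]⟩
    · obtain ⟨z, hz, hmin⟩ := hc.exists_isMinOn hne
        (f := fun z => ‖z.2.2.det‖) (Continuous.continuousOn (by fun_prop))
      exact ⟨_, norm_pos_iff.2 (hdet z hz), fun y hy => hmin hy⟩
  refine ⟨max 1 δ⁻¹, ?_⟩
  rintro ⟨s, u, V⟩ ⟨hu, c, h⟩ hV
  simp only at h hV ⊢
  have : Nonempty (Fin D) := ⟨⟨0, hD⟩⟩
  have hV0 : ‖V‖ ≠ 0 := by
    rw [norm_ne_zero_iff]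
    rintro rfl
    simp [Matrix.det_zero] at hV
  set r := ‖V‖ with hr
  have hmem : ((s, u, ((r⁻¹ : ℝ) : ℂ) • V) :
      unitInterval × Matrix (Fin d) (Fin d) ℂ × Matrix (Fin D) (Fin D) ℂ) ∈ S := by
    refine ⟨⟨hu, c, fun i => ?_⟩, ?_⟩
    · simp only [Matrix.smul_mul, Matrix.mul_smul]
      rw [h, smul_comm]
    · change ‖((r⁻¹ : ℝ) : ℂ) • V‖ = 1
      rw [norm_smul, Complex.norm_real, norm_inv, hr, norm_norm, inv_mul_cancel₀ hV0]
  have h1 := hle _ hmem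
  simp only [Matrix.det_smul, Fintype.card_fin, hV, mul_one, norm_pow, Complex.norm_real, norm_inv]
    at h1
  have hr0 : 0 ≤ r := norm_nonneg V
  rw [Real.norm_of_nonneg hr0] at h1
  by_contra! hcon
  have h2 : 1 < r := (le_max_left _ _).trans_lt hcon
  have h3 : δ⁻¹ < r := (le_max_right _ _).trans_lt hcon
  have h4 : (r⁻¹) ^ D ≤ r⁻¹ := pow_le_of_le_one (by positivity) (inv_le_one_of_one_le₀ h2.le) hD.ne'
  have h5 : r⁻¹ < δ := inv_lt_of_inv_lt₀ hδ h3
  linarith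

/-- Gauge transformations of determinant one are unique up to roots of unity. -/
theorem eq_smul_of_mem_gaugeSet (hs : ∀ s, Spans (A s)) (hD : 0 < D) {s : unitInterval}
    {u : Matrix (Fin d) (Fin d) ℂ} {V W : Matrix (Fin D) (Fin D) ℂ} (hV : (s, u, V) ∈ gaugeSet A)
    (hW : (s, u, W) ∈ gaugeSet A) (hV1 : V.det = 1) (hW1 : W.det = 1) :
    ∃ ζ : ℂ, ζ ^ D = 1 ∧ V = ζ • W := by
  have : Nonempty (Fin D) := ⟨⟨0, hD⟩⟩
  obtain ⟨-, c, hc⟩ := hV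
  obtain ⟨-, c', hc'⟩ := hW
  simp only at hc hc'
  have hunit : ∀ V : Matrix (Fin D) (Fin D) ℂ, V.det = 1 → ∃ v : (Matrix (Fin D) (Fin D) ℂ)ˣ,
      v.val = V := fun V h => (Matrix.isUnit_iff_isUnit_det V).2 (by rw [h]; exact isUnit_one)
  obtain ⟨v, rfl⟩ := hunit V hV1
  obtain ⟨w, rfl⟩ := hunit W hW1
  have key : ∀ {v : (Matrix (Fin D) (Fin D) ℂ)ˣ} {c : Circle},
      (∀ i, v.val * act u (A s) i = (c : ℂ) • (A s i * v.val)) →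
      ∀ i, act u (A s) i = (c : ℂ) • ((v⁻¹).val * A s i * v.val) := fun {v c} h i => by
    rw [mul_assoc, ← Matrix.mul_smul, ← h]
    simp
  obtain ⟨-, k, -, hk⟩ := (hs s).gauge_unique (V := w) (W := v) (Circle.coe_ne_zero c')
    fun i => (key hc' i).symm.trans (key hc i)
  refine ⟨k, ?_, hk⟩
  have := congrArg Matrix.det hk
  rw [Matrix.det_smul, hV1, hW1] at this
  simpa using this.symm

/-- Close to a given parameter, the gauge transformations are close to those at the parameter, up to
a root of unity and uniformly in the symmetry operation. The exceptions form a compact set, which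
misses the given parameter by uniqueness of the gauge transformations. -/
theorem eventually_gauge_close (hA : Continuous A) (hs : ∀ s, Spans (A s)) (hD : 0 < D)
    (σ : unitInterval) {ε : ℝ} (hε : 0 < ε) :
    ∀ᶠ s in 𝓝 σ, ∀ (u : Matrix (Fin d) (Fin d) ℂ) (V W : Matrix (Fin D) (Fin D) ℂ),
      (s, u, V) ∈ gaugeSet A → V.det = 1 → (σ, u, W) ∈ gaugeSet A → W.det = 1 →
      ∃ ζ : ℂ, ζ ^ D = 1 ∧ ‖V - ζ • W‖ < ε := by
  have : ProperSpace (Matrix (Fin d) (Fin d) ℂ) :=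
    inferInstanceAs (ProperSpace (Fin d → Fin d → ℂ))
  have : ProperSpace (Matrix (Fin D) (Fin D) ℂ) :=
    inferInstanceAs (ProperSpace (Fin D → Fin D → ℂ))
  obtain ⟨C, hC⟩ := exists_bound_gaugeSet hA hs hD
  let Z := unitInterval × Matrix (Fin d) (Fin d) ℂ × Matrix (Fin D) (Fin D) ℂ
    × Matrix (Fin D) (Fin D) ℂ
  let S : Set Z := {z | (z.1, z.2.1, z.2.2.1) ∈ gaugeSet A ∧ (σ, z.2.1, z.2.2.2) ∈ gaugeSet A ∧
    z.2.2.1.det = 1 ∧ z.2.2.2.det = 1 ∧ ∀ ζ : ℂ, ζ ^ D = 1 → ε ≤ ‖z.2.2.1 - ζ • z.2.2.2‖}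
  have hcl : IsClosed S := by
    have hg := isClosed_gaugeSet hA
    have h1 : IsClosed {z : Z | ∀ ζ : ℂ, ζ ^ D = 1 → ε ≤ ‖z.2.2.1 - ζ • z.2.2.2‖} := by
      simp only [Set.ofPred_forall]
      exact isClosed_iInter fun ζ => isClosed_iInter fun _ =>
        isClosed_le (by fun_prop) (by fun_prop)
    have h2 : IsClosed {z : Z | z.2.2.1.det = 1} := isClosed_eq (by fun_prop) (by fun_prop)
    have h3 : IsClosed {z : Z | z.2.2.2.det = 1} := isClosed_eq (by fun_prop) (by fun_prop)
    have k1 : Continuous fun z : Z => (z.1, z.2.1, z.2.2.1) := by fun_prop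
    have k2 : Continuous fun z : Z => (σ, z.2.1, z.2.2.2) := by fun_prop
    exact (hg.preimage k1).inter ((hg.preimage k2).inter (h2.inter (h3.inter h1)))
  have hcomp : IsCompact S := by
    refine ((isCompact_univ (X := unitInterval)).prod ((isCompact_closedBall
      (0 : Matrix (Fin d) (Fin d) ℂ) 1).prod ((isCompact_closedBall
      (0 : Matrix (Fin D) (Fin D) ℂ) C).prod (isCompact_closedBall
      (0 : Matrix (Fin D) (Fin D) ℂ) C)))).of_isClosed_subset hcl ?_
    rintro ⟨s, u, V, W⟩ ⟨hV, hW, hV1, hW1, -⟩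
    refine ⟨trivial, ?_, ?_, ?_⟩
    · rw [mem_closedBall_zero_iff]; exact entrywise_sup_norm_bound_of_unitary hV.1
    · rw [mem_closedBall_zero_iff]; exact hC (s, u, V) hV hV1
    · rw [mem_closedBall_zero_iff]; exact hC (σ, u, W) hW hW1
  have hS : σ ∉ Prod.fst '' S := by
    rintro ⟨⟨s, u, V, W⟩, ⟨hV, hW, hV1, hW1, h⟩, rfl⟩
    obtain ⟨ζ, hζ, hVW⟩ := eq_smul_of_mem_gaugeSet hs hD hV hW hV1 hW1
    have := h ζ hζ
    rw [hVW, sub_self, norm_zero] at this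
    exact absurd this (not_le.2 hε)
  filter_upwards [(hcomp.image continuous_fst).isClosed.isOpen_compl.mem_nhds hS] with s hs' u V W
    hV hV1 hW hW1
  by_contra! hcon
  exact hs' ⟨(s, u, V, W), ⟨hV, hW, hV1, hW1, hcon⟩, rfl⟩

/-- Distinct roots of unity of a given order have a minimal distance. -/
theorem exists_gap_rootsOfUnity (hD : 0 < D) :
    ∃ δ : ℝ, 0 < δ ∧ ∀ z w : ℂ, z ^ D = 1 → w ^ D = 1 → ‖z - w‖ < δ → z = w := by
  have hfin : {z : ℂ | z ^ D = 1 ∧ z ≠ 1}.Finite := by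
    refine (Polynomial.nthRoots D (1 : ℂ)).toFinset.finite_toSet.subset fun z hz => ?_
    simp [Polynomial.mem_nthRoots hD, hz.1]
  obtain ⟨δ, hδ, h⟩ := Metric.isOpen_iff.1 hfin.isClosed.isOpen_compl 1 (fun h => h.2 rfl)
  refine ⟨δ, hδ, fun z w hz hw hzw => ?_⟩
  have hw0 : w ≠ 0 := fun h => by rw [h, zero_pow hD.ne'] at hw; exact zero_ne_one hw
  have hwn : ‖w‖ = 1 := Complex.norm_eq_one_of_pow_eq_one hw hD.ne'
  by_contra hne
  refine h (a := z / w) ?_ ⟨by rw [div_pow, hz, hw, div_one], fun h => hne ((div_eq_one_iff_eq hw0).1 h)⟩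
  rw [Metric.mem_ball, dist_eq_norm]
  have : z / w - 1 = (z - w) / w := by field_simp
  rw [this, norm_div, hwn, div_one]
  exact hzw

variable {G : Type} [Group G]

/-- Rescale a virtual symmetry to determinant one. -/
theorem exists_det_one (hD : 0 < D) (V : (Matrix (Fin D) (Fin D) ℂ)ˣ) :
    ∃ a : ℂ, a ≠ 0 ∧ (a • V.val).det = 1 := by
  have hV : V.val.det ≠ 0 := ((Matrix.isUnit_iff_isUnit_det _).1 V.isUnit).ne_zero
  obtain ⟨a, ha⟩ := IsAlgClosed.exists_pow_nat_eq (V.val.det)⁻¹ hD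
  refine ⟨a, ?_, ?_⟩
  · rintro rfl
    rw [zero_pow hD.ne'] at ha
    exact inv_ne_zero hV ha.symm
  · rw [Matrix.det_smul, Fintype.card_fin, ha, inv_mul_cancel₀ hV]

/-- The class of a matrix product state is locally constant along continuous paths of symmetric
injective tensors: rescaled to determinant one, the virtual symmetries multiply up to roots of unity,
which cannot jump. -/
theorem eventually_cohClass_eq {U : G →* Matrix.unitaryGroup (Fin d) ℂ} (hA : Continuous A)
    (hs : ∀ s, Spans (A s)) (hD : 0 < D) (ω : unitInterval → Z2 G)
    (hω : ∀ s, HasSPTClass (A s) (fun g => (U g).val) (ω s)) (σ : unitInterval) :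
    ∀ᶠ s in 𝓝 σ, cohClass (ω s) = cohClass (ω σ) := by
  have : ProperSpace (Matrix (Fin D) (Fin D) ℂ) :=
    inferInstanceAs (ProperSpace (Fin D → Fin D → ℂ))
  obtain ⟨δ, hδ, hgap⟩ := exists_gap_rootsOfUnity hD
  obtain ⟨C, hC⟩ := exists_bound_gaugeSet hA hs hD
  -- the phase in `V₁ V₂ = φ V₃`, as a continuous function of three matrices of determinant one
  let f : Matrix (Fin D) (Fin D) ℂ × Matrix (Fin D) (Fin D) ℂ × Matrix (Fin D) (Fin D) ℂ → ℂ :=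
    fun z => (z.1 * z.2.1 * z.2.2.adjugate).trace / D
  have hf : Continuous f := by fun_prop
  have hf' : ∀ {V₁ V₂ V₃ : Matrix (Fin D) (Fin D) ℂ} {φ : ℂ}, V₃.det = 1 → V₁ * V₂ = φ • V₃ →
      f (V₁, V₂, V₃) = φ := by
    intro V₁ V₂ V₃ φ h1 h
    have : (D : ℂ) ≠ 0 := Nat.cast_ne_zero.2 hD.ne'
    simp only [f, h, Matrix.smul_mul, Matrix.mul_adjugate, h1, one_smul, Matrix.trace_smul,
      Matrix.trace_one, Fintype.card_fin, smul_eq_mul]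
    field_simp
  let B := (Metric.closedBall (0 : Matrix (Fin D) (Fin D) ℂ) C) ×ˢ
    (Metric.closedBall (0 : Matrix (Fin D) (Fin D) ℂ) C) ×ˢ
    (Metric.closedBall (0 : Matrix (Fin D) (Fin D) ℂ) C)
  have hB : IsCompact B :=
    (isCompact_closedBall _ _).prod ((isCompact_closedBall _ _).prod (isCompact_closedBall _ _))
  obtain ⟨ε, hε, hunif⟩ := Metric.uniformContinuousOn_iff.1
    (hB.uniformContinuousOn_of_continuous hf.continuousOn) δ hδ
  filter_upwards [eventually_gauge_close hA hs hD σ hε] with s hclose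
  obtain ⟨V, c, ω₁, hV, hm, h₁⟩ := hω s
  obtain ⟨W, c', ω₂, hW, hm', h₂⟩ := hω σ
  have hmem : ∀ {s : unitInterval} {V : (Matrix (Fin D) (Fin D) ℂ)ˣ} {g : G} {c : Circle},
      (∀ i, ∑ j, (U g).val i j • A s j = (c : ℂ) • ((V⁻¹).val * A s i * V.val)) →
      ∀ a : ℂ, (s, (U g).val, a • V.val) ∈ gaugeSet A := fun {s V g c} h a =>
    ⟨(U g).2, c, fun i => by
      have h' : act (U g).val (A s) i = (c : ℂ) • ((V⁻¹).val * A s i * V.val) := h i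
      simp only [h', Matrix.smul_mul, Matrix.mul_smul, ← mul_assoc, Units.mul_inv, one_mul]⟩
  choose a ha0 ha using fun g => exists_det_one hD (V g)
  choose b hb0 hb using fun g => exists_det_one hD (W g)
  choose ζ hζ hζc using fun g => hclose (U g).val _ _ (hmem (hV g) (a g)) (ha g)
    (hmem (hW g) (b g)) (hb g)
  have hζ0 : ∀ g, ζ g ≠ 0 := fun g h => by
    have := hζ g
    rw [h, zero_pow hD.ne'] at this
    exact zero_ne_one this
  have hdet : ∀ g, ((ζ g * b g) • (W g).val).det = 1 := fun g => by
    rw [← smul_smul, Matrix.det_smul, hb, Fintype.card_fin, hζ, mul_one]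
  simp only [smul_smul] at hζc
  have hprod : ∀ {V : G → (Matrix (Fin D) (Fin D) ℂ)ˣ} {ω : Z2 G} {a : G → ℂ},
      (∀ g, a g ≠ 0) → (∀ g h, (V g).val * (V h).val = phase ω g h • (V (g * h)).val) →
      ∀ g h, (a g • (V g).val) * (a h • (V h).val)
        = (a g * a h * (a (g * h))⁻¹ * phase ω g h) • (a (g * h) • (V (g * h)).val) := by
    intro V ω a ha hm g h
    rw [smul_mul_smul_comm, hm, smul_smul, smul_smul]
    rw [mul_right_comm _ (phase ω g h) (a (g * h)), inv_mul_cancel_right₀ (ha _)]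
  have hroot : ∀ {V₁ V₂ V₃ : Matrix (Fin D) (Fin D) ℂ} {φ : ℂ}, V₁.det = 1 → V₂.det = 1 →
      V₃.det = 1 → V₁ * V₂ = φ • V₃ → φ ^ D = 1 := by
    intro V₁ V₂ V₃ φ h1 h2 h3 h
    have := congrArg Matrix.det h
    rw [Matrix.det_mul, Matrix.det_smul, h1, h2, h3, Fintype.card_fin] at this
    simpa using this.symm
  rw [← h₁, ← h₂]
  refine cohClass_eq_of_phase (fun g => ζ g * b g / a g)
    (fun g => div_ne_zero (mul_ne_zero (hζ0 g) (hb0 g)) (ha0 g)) fun g h => ?_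
  have e1 := hprod ha0 hm g h
  have e2 := hprod (a := fun g => ζ g * b g) (fun g => mul_ne_zero (hζ0 g) (hb0 g)) hm' g h
  -- both sides are roots of unity, and they are close to each other
  have e3 : a g * a h * (a (g * h))⁻¹ * phase ω₁ g h
      = ζ g * b g * (ζ h * b h) * (ζ (g * h) * b (g * h))⁻¹ * phase ω₂ g h := by
    apply hgap _ _ (hroot (ha g) (ha h) (ha (g * h)) e1) (hroot (hdet g) (hdet h) (hdet (g * h)) e2)
    rw [← hf' (ha (g * h)) e1, ← hf' (hdet (g * h)) e2, ← dist_eq_norm]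
    have hVC : ∀ g, a g • (V g).val ∈ Metric.closedBall (0 : Matrix (Fin D) (Fin D) ℂ) C :=
      fun g => mem_closedBall_zero_iff.2 (hC (s, (U g).val, a g • (V g).val) (hmem (hV g) (a g)) (ha g))
    have hWC : ∀ g, (ζ g * b g) • (W g).val ∈ Metric.closedBall (0 : Matrix (Fin D) (Fin D) ℂ) C :=
      fun g => mem_closedBall_zero_iff.2 (hC (σ, (U g).val, (ζ g * b g) • (W g).val) (hmem (hW g) _) (hdet g))
    have m1 : (a g • (V g).val, a h • (V h).val, a (g * h) • (V (g * h)).val) ∈ B :=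
      ⟨hVC g, hVC h, hVC _⟩
    have m2 : ((ζ g * b g) • (W g).val, (ζ h * b h) • (W h).val,
      (ζ (g * h) * b (g * h)) • (W (g * h)).val) ∈ B := ⟨hWC g, hWC h, hWC _⟩
    apply hunif _ m1 _ m2
    rw [Prod.dist_eq, Prod.dist_eq, dist_eq_norm, dist_eq_norm, dist_eq_norm]
    exact max_lt (hζc g) (max_lt (hζc h) (hζc _))
  have := ha0 g
  have := ha0 h
  have := ha0 (g * h)
  have := hb0 (g * h)
  have := hζ0 (g * h)
  field_simp at e3 ⊢
  linear_combination e3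

/-- The class is constant along continuous paths of symmetric injective tensors. -/
theorem cohClass_eq_of_path {U : G →* Matrix.unitaryGroup (Fin d) ℂ} (hA : Continuous A)
    (hinj : ∀ s, InjectiveTensor (A s) ∧ SymmetricMPS (A s) fun g => (U g).val) (hD : 0 < D)
    {ω ω' : Z2 G} (h₀ : HasSPTClass (A 0) (fun g => (U g).val) ω)
    (h₁ : HasSPTClass (A 1) (fun g => (U g).val) ω') : cohClass ω = cohClass ω' := by
  have hs : ∀ s, Spans (A s) := fun s => (injectiveTensor_iff_spans _).1 (hinj s).1
  have hmul : ∀ g h, (U (g * h)).val = (U g).val * (U h).val := fun g h => by rw [map_mul]; rfl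
  have hex : ∀ s, ∃ ω, HasSPTClass (A s) (fun g => (U g).val) ω := fun s =>
    exists_hasSPTClass hD (hs s) hmul fun g => (hs s).exists_gauge (v := (U g⁻¹).val)
      (by rw [← hmul, inv_mul_cancel, map_one]; rfl) fun L hL => (hinj s).2 L hL g
  choose W hW using hex
  have hloc : IsLocallyConstant fun s => cohClass (W s) :=
    (IsLocallyConstant.iff_eventually_eq _).2 fun σ => eventually_cohClass_eq hA hs hD W hW σ
  rw [HasSPTClass.unique hD (hs 0) h₀ (hW 0), HasSPTClass.unique hD (hs 1) h₁ (hW 1)]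
  exact hloc.apply_eq_of_preconnectedSpace 0 1

end Deformation

/-! ### Unitary virtual symmetries -/

open scoped MatrixOrder in
theorem exists_eq_conjTranspose_mul {n : Type} [Fintype n] [DecidableEq n] {Q : Matrix n n ℂ}
    (hQ : Q.PosSemidef) : ∃ T : Matrix n n ℂ, Q = T.conjTranspose * T :=
  CStarAlgebra.nonneg_iff_eq_star_mul_self.mp hQ.nonneg

section Perron

open scoped Matrix.Norms.Elementwise

variable {n ι : Type} [Fintype n] [DecidableEq n] [Fintype ι]

omit [DecidableEq n] in
theorem isClosed_posSemidef : IsClosed {X : Matrix n n ℂ | X.PosSemidef} := by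
  simp only [Matrix.posSemidef_iff_dotProduct_mulVec, Set.ofPred_and, Set.ofPred_forall]
  refine IsClosed.inter (isClosed_eq (by fun_prop) (by fun_prop)) (isClosed_iInter fun x => ?_)
  exact isClosed_le (by fun_prop) (by fun_prop)

omit [DecidableEq n] in
/-- A positive definite matrix stays positive semidefinite after subtraction of a small multiple of a
Hermitian matrix. -/
theorem exists_posSemidef_sub_smul {P Q : Matrix n n ℂ} (hP : P.PosDef) (hQ : Q.IsHermitian) :
    ∃ ε : ℝ, 0 < ε ∧ (P - (ε : ℂ) • Q).PosSemidef := by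
  rcases isEmpty_or_nonempty n with hn | hn
  · exact ⟨1, one_pos, by rw [Subsingleton.elim (P - _ • Q) 0]; exact Matrix.PosSemidef.zero⟩
  have hcont : ∀ X : Matrix n n ℂ, Continuous fun x : n → ℂ => (star x ⬝ᵥ X.mulVec x).re :=
    fun X => by fun_prop
  have hS := isCompact_sphere (0 : n → ℂ) 1
  have hne : (Metric.sphere (0 : n → ℂ) 1).Nonempty := ⟨fun _ => 1, by simp⟩
  obtain ⟨x₀, hx₀, hmin⟩ := hS.exists_isMinOn hne (hcont P).continuousOn
  obtain ⟨x₁, hx₁, hmax⟩ := hS.exists_isMaxOn hne (hcont Q).continuousOn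
  have h0 : x₀ ≠ 0 := fun h => by rw [h] at hx₀; simp at hx₀
  set m := (star x₀ ⬝ᵥ P.mulVec x₀).re with hm
  set M := (star x₁ ⬝ᵥ Q.mulVec x₁).re with hM
  have hm0 : 0 < m := (Complex.pos_iff.1 (hP.dotProduct_mulVec_pos h0)).1
  have hMp : 0 < |M| + 1 := by positivity
  refine ⟨m / (|M| + 1), by positivity, ?_⟩
  set ε := m / (|M| + 1) with hε
  have hε0 : 0 < ε := by positivity
  have hH : (P - (ε : ℂ) • Q).IsHermitian := by
    refine hP.isHermitian.sub ?_
    rw [Matrix.IsHermitian, Matrix.conjTranspose_smul, hQ]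
    simp
  refine Matrix.PosSemidef.of_dotProduct_mulVec_nonneg hH fun x => ?_
  have him : (star x ⬝ᵥ (P - (ε : ℂ) • Q).mulVec x).im = 0 := hH.im_star_dotProduct_mulVec_self x
  refine Complex.nonneg_iff.2 ⟨?_, him.symm⟩
  by_cases hx : x = 0
  · simp [hx]
  have hr : ‖x‖ ≠ 0 := norm_ne_zero_iff.2 hx
  set y : n → ℂ := ((‖x‖⁻¹ : ℝ) : ℂ) • x with hy
  have hxy : x = ((‖x‖ : ℝ) : ℂ) • y := by
    rw [hy, smul_smul, ← Complex.ofReal_mul, mul_inv_cancel₀ hr, Complex.ofReal_one, one_smul]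
  have hyS : y ∈ Metric.sphere (0 : n → ℂ) 1 := by
    rw [mem_sphere_zero_iff_norm, hy, norm_smul, Complex.norm_real, norm_inv, norm_norm,
      inv_mul_cancel₀ hr]
  have h1 : m ≤ (star y ⬝ᵥ P.mulVec y).re := hmin hyS
  have h2 : (star y ⬝ᵥ Q.mulVec y).re ≤ M := hmax hyS
  have h3 : (star x ⬝ᵥ (P - (ε : ℂ) • Q).mulVec x).re
      = ‖x‖ ^ 2 * ((star y ⬝ᵥ P.mulVec y).re - ε * (star y ⬝ᵥ Q.mulVec y).re) := by
    conv_lhs => rw [hxy]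
    simp only [Matrix.sub_mulVec, Matrix.smul_mulVec, Matrix.mulVec_smul, dotProduct_sub,
      dotProduct_smul, star_smul, smul_dotProduct, smul_eq_mul, Complex.sub_re, Complex.star_def,
      Complex.conj_ofReal, Complex.re_ofReal_mul]
    ring
  rw [h3]
  have h4 : ε * M ≤ m := by
    calc ε * M ≤ ε * (|M| + 1) := by gcongr; linarith [le_abs_self M]
      _ = m := by rw [hε]; field_simp
  have h5 : ε * (star y ⬝ᵥ Q.mulVec y).re ≤ ε * M := by gcongr
  exact mul_nonneg (by positivity) (by linarith)

/-- The completely positive map with Kraus operators `A`. -/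
def cpMap (A : ι → Matrix n n ℂ) (X : Matrix n n ℂ) : Matrix n n ℂ :=
  ∑ i, A i * X * (A i).conjTranspose

theorem cpMap_smul (A : ι → Matrix n n ℂ) (c : ℂ) (X : Matrix n n ℂ) :
    cpMap A (c • X) = c • cpMap A X := by
  simp [cpMap, Finset.smul_sum]

omit [DecidableEq n] in
theorem cpMap_sub (A : ι → Matrix n n ℂ) (X Y : Matrix n n ℂ) :
    cpMap A (X - Y) = cpMap A X - cpMap A Y := by
  simp [cpMap, Matrix.mul_sub, Matrix.sub_mul]

/-- The completely positive map of an injective tensor is positivity improving. -/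
theorem Spans.cpMap_posDef {A : ι → Matrix n n ℂ} (hA : Spans A) {X : Matrix n n ℂ}
    (hX : X.PosSemidef) (h0 : X ≠ 0) : (cpMap A X).PosDef := by
  have hsum : (cpMap A X).PosSemidef :=
    Matrix.posSemidef_sum _ fun i _ => hX.mul_mul_conjTranspose_same (A i)
  refine Matrix.PosDef.of_dotProduct_mulVec_pos hsum.isHermitian fun v hv => ?_
  refine lt_of_le_of_ne (hsum.dotProduct_mulVec_nonneg v) fun h => h0 ?_
  have h1 : ∀ i, 0 ≤ star v ⬝ᵥ (A i * X * (A i).conjTranspose).mulVec v := fun i =>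
    (hX.mul_mul_conjTranspose_same (A i)).dotProduct_mulVec_nonneg v
  have h2 : ∑ i, star v ⬝ᵥ (A i * X * (A i).conjTranspose).mulVec v = 0 := by
    rw [h, cpMap, Matrix.sum_mulVec, dotProduct_sum]
  have h3 : ∀ i, X.mulVec ((A i).conjTranspose.mulVec v) = 0 := fun i => by
    have h4 := (Finset.sum_eq_zero_iff_of_nonneg fun i _ => h1 i).1 h2 i (Finset.mem_univ i)
    rw [← hX.dotProduct_mulVec_zero_iff, Matrix.star_mulVec, Matrix.conjTranspose_conjTranspose,
      ← Matrix.dotProduct_mulVec, Matrix.mulVec_mulVec, Matrix.mulVec_mulVec]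
    exact h4
  let F : Matrix n n ℂ →ₗ[ℂ] (n → ℂ) :=
    { toFun := fun Y => star (X.mulVec (Y.conjTranspose.mulVec v))
      map_add' := fun Y Z => by
        rw [Matrix.conjTranspose_add, Matrix.add_mulVec, Matrix.mulVec_add, star_add]
      map_smul' := fun c Y => by
        rw [Matrix.conjTranspose_smul, Matrix.smul_mulVec, Matrix.mulVec_smul, star_smul, star_star]
        rfl }
  have hF : F = 0 := hA.ext fun i => by
    change star (X.mulVec _) = 0
    rw [h3, star_zero]
  obtain ⟨k, hk⟩ := Function.ne_iff.1 hv
  have hk' : v k ≠ 0 := hk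
  ext i j
  have h4 : star (X.mulVec ((Matrix.single k j (1 : ℂ)).conjTranspose.mulVec v)) = 0 :=
    LinearMap.congr_fun hF (Matrix.single k j 1)
  rw [star_eq_zero] at h4
  have h5 := congrFun h4 i
  rw [Matrix.mulVec_mulVec] at h5
  simpa [Matrix.mulVec, dotProduct, Matrix.mul_apply, Matrix.single_apply, ite_and, hk'] using h5

/-- The completely positive map of an injective tensor has a positive definite eigenvector: it
maximizes `λ` in `cpMap A P ≥ λ P`. -/
theorem Spans.exists_posDef_eigenvector [Nonempty n] {A : ι → Matrix n n ℂ} (hA : Spans A) :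
    ∃ (P : Matrix n n ℂ) (lam : ℝ), P.PosDef ∧ cpMap A P = (lam : ℂ) • P := by
  have : ProperSpace (Matrix n n ℂ) := inferInstanceAs (ProperSpace (n → n → ℂ))
  have hcont' : Continuous fun S : Matrix n n ℂ => S * S.conjTranspose :=
    continuous_id.matrix_mul continuous_id.matrix_conjTranspose
  have hcont : Continuous fun S : Matrix n n ℂ => cpMap A (S * S.conjTranspose) :=
    continuous_finsetSum _ fun i _ =>
      (continuous_const.matrix_mul hcont').matrix_mul continuous_const
  -- positive semidefinite matrices of trace one, parametrized as `S S†`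
  let B : Set (Matrix n n ℂ) := {S | (S * S.conjTranspose).trace = 1}
  have hBcl : IsClosed B := isClosed_eq hcont'.matrix_trace continuous_const
  have hBb : B ⊆ Metric.closedBall (0 : Matrix n n ℂ) 1 := by
    intro S hS
    rw [mem_closedBall_zero_iff, Matrix.norm_le_iff zero_le_one]
    intro i j
    have h1 : ∑ i, ∑ j, ‖S i j‖ ^ 2 = 1 := by
      have : (S * S.conjTranspose).trace = 1 := hS
      simp only [Matrix.trace, Matrix.diag_apply, Matrix.mul_apply, Matrix.conjTranspose_apply,
        Complex.star_def, Complex.mul_conj, Complex.normSq_eq_norm_sq] at this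
      exact_mod_cast this
    have h2 : ‖S i j‖ ^ 2 ≤ 1 := by
      rw [← h1]
      exact (Finset.single_le_sum (f := fun j => ‖S i j‖ ^ 2) (fun _ _ => by positivity)
        (Finset.mem_univ j)).trans (Finset.single_le_sum (f := fun i => ∑ j, ‖S i j‖ ^ 2)
        (fun _ _ => Finset.sum_nonneg fun _ _ => by positivity) (Finset.mem_univ i))
    exact (sq_le_one_iff₀ (norm_nonneg _)).1 h2
  have hBc : IsCompact B := (isCompact_closedBall _ _).of_isClosed_subset hBcl hBb
  obtain ⟨C, hC⟩ := hBc.exists_bound_of_continuousOn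
    (f := fun S => (cpMap A (S * S.conjTranspose)).trace) hcont.matrix_trace.continuousOn
  -- a compact set, because the trace bounds `λ`
  let 𝒮 : Set (Matrix n n ℂ × ℝ) := {z | z.1 ∈ B ∧ 0 ≤ z.2 ∧
    (cpMap A (z.1 * z.1.conjTranspose) - (z.2 : ℂ) • (z.1 * z.1.conjTranspose)).PosSemidef}
  have hclosed : IsClosed 𝒮 := by
    have k1 : Continuous fun z : Matrix n n ℂ × ℝ =>
        cpMap A (z.1 * z.1.conjTranspose) - (z.2 : ℂ) • (z.1 * z.1.conjTranspose) :=
      (hcont.comp continuous_fst).sub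
        ((Complex.continuous_ofReal.comp continuous_snd).smul (hcont'.comp continuous_fst))
    exact (hBc.isClosed.preimage continuous_fst).inter ((isClosed_le continuous_const
      continuous_snd).inter (isClosed_posSemidef.preimage k1))
  have hcomp : IsCompact 𝒮 := by
    refine (hBc.prod (isCompact_Icc (a := (0 : ℝ)) (b := C))).of_isClosed_subset hclosed ?_
    rintro ⟨S, lam⟩ ⟨hS, h0, hpos⟩
    refine ⟨hS, h0, ?_⟩
    have h1 := (Complex.nonneg_iff.1 hpos.trace_nonneg).1
    have hS' : (S * S.conjTranspose).trace = 1 := hS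
    simp only [Matrix.trace_sub, Matrix.trace_smul, hS', smul_eq_mul, mul_one, Complex.sub_re,
      Complex.ofReal_re] at h1
    have h2 := (Complex.re_le_norm _).trans (hC S hS)
    simp only at h2 ⊢
    linarith
  have hnorm : ∀ Q : Matrix n n ℂ, Q.PosSemidef → Q ≠ 0 →
      ∃ (S : Matrix n n ℂ) (τ : ℝ), S ∈ B ∧ 0 < τ ∧ Q = (τ : ℂ) • (S * S.conjTranspose) := by
    intro Q hQ hQ0
    obtain ⟨T, rfl⟩ := exists_eq_conjTranspose_mul hQ
    have h1 : 0 < (T.conjTranspose * T).trace :=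
      lt_of_le_of_ne hQ.trace_nonneg fun h => hQ0 (by
        rw [Matrix.trace_conjTranspose_mul_self_eq_zero_iff.1 h.symm]; simp)
    obtain ⟨h2, h3⟩ := Complex.pos_iff.1 h1
    set τ := (T.conjTranspose * T).trace.re with hτ
    have h4 : (T.conjTranspose * T).trace = (τ : ℂ) := Complex.ext rfl (by simpa using h3.symm)
    have hs : ((Real.sqrt τ : ℝ) : ℂ) * ((Real.sqrt τ : ℝ) : ℂ) = τ := by
      rw [← Complex.ofReal_mul, Real.mul_self_sqrt h2.le]
    have hs0 : ((Real.sqrt τ : ℝ) : ℂ) ≠ 0 := Complex.ofReal_ne_zero.2 (Real.sqrt_pos.2 h2).ne'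
    have h5 : (((Real.sqrt τ : ℝ) : ℂ)⁻¹ • T.conjTranspose) * (((Real.sqrt τ : ℝ) : ℂ)⁻¹ •
        T.conjTranspose).conjTranspose = (τ : ℂ)⁻¹ • (T.conjTranspose * T) := by
      simp only [Matrix.conjTranspose_smul, Matrix.conjTranspose_conjTranspose, star_inv₀,
        Complex.star_def, Complex.conj_ofReal, Matrix.smul_mul, Matrix.mul_smul, smul_smul]
      rw [← mul_inv, hs]
    have hτ0 : (τ : ℂ) ≠ 0 := Complex.ofReal_ne_zero.2 h2.ne'
    refine ⟨((Real.sqrt τ : ℝ) : ℂ)⁻¹ • T.conjTranspose, τ, ?_, h2, ?_⟩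
    · change Matrix.trace _ = 1
      rw [h5, Matrix.trace_smul, h4, smul_eq_mul, inv_mul_cancel₀ hτ0]
    · rw [h5, smul_smul, mul_inv_cancel₀ hτ0, one_smul]
  obtain ⟨S₀, -, hS₀, -⟩ := hnorm 1 Matrix.PosSemidef.one one_ne_zero
  have hpsd : ∀ S : Matrix n n ℂ, (S * S.conjTranspose).PosSemidef :=
    Matrix.posSemidef_self_mul_conjTranspose
  have hB0 : ∀ S ∈ B, S * S.conjTranspose ≠ 0 := fun S hS h => by
    have : (S * S.conjTranspose).trace = 1 := hS
    rw [h, Matrix.trace_zero] at this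
    exact zero_ne_one this
  obtain ⟨⟨S, lam⟩, ⟨hS, hlam, hpos⟩, hmax⟩ := hcomp.exists_isMaxOn ⟨(S₀, 0), hS₀, le_rfl, by
    simpa using (hA.cpMap_posDef (hpsd S₀) (hB0 S₀ hS₀)).posSemidef⟩ continuous_snd.continuousOn
  simp only at hS hlam hpos
  set P := S * S.conjTranspose with hP
  have hEP := hA.cpMap_posDef (hpsd S) (hB0 S hS)
  rw [← hP] at hEP
  -- otherwise the map makes the remainder positive definite, and `λ` could be increased for
  -- `cpMap A P`
  have hR : cpMap A P - (lam : ℂ) • P = 0 := by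
    by_contra hR
    have h1 := hA.cpMap_posDef hpos hR
    obtain ⟨ε, hε, h2⟩ := exists_posSemidef_sub_smul h1 hEP.isHermitian
    obtain ⟨S', τ, hS', hτ, hQ⟩ := hnorm _ hEP.posSemidef fun h => by
      have := hEP.dotProduct_mulVec_pos (x := fun _ => 1) (by
        intro h; exact one_ne_zero (congrFun h (Classical.arbitrary n)))
      rw [h] at this
      simp at this
    have hτ0 : (τ : ℂ) ≠ 0 := Complex.ofReal_ne_zero.2 hτ.ne'
    have h3 : ((S', lam + ε) : Matrix n n ℂ × ℝ) ∈ 𝒮 := by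
      refine ⟨hS', by positivity, ?_⟩
      have h4 : S' * S'.conjTranspose = (τ : ℂ)⁻¹ • cpMap A P := by
        rw [hQ, smul_smul, inv_mul_cancel₀ hτ0, one_smul]
      have h5 : cpMap A (S' * S'.conjTranspose) - ((lam + ε : ℝ) : ℂ) • (S' * S'.conjTranspose)
          = ((τ⁻¹ : ℝ) : ℂ) • (cpMap A (cpMap A P - (lam : ℂ) • P) - (ε : ℂ) • cpMap A P) := by
        rw [h4, cpMap_smul, cpMap_sub, cpMap_smul]
        simp only [smul_sub, smul_smul, Complex.ofReal_add, Complex.ofReal_inv]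
        rw [sub_sub, ← add_smul]
        congr 2
        ring
      simp only
      rw [h5]
      exact h2.smul (Complex.zero_le_real.2 (inv_nonneg.2 hτ.le))
    have : lam + ε ≤ lam := hmax h3
    linarith
  have hEq : cpMap A P = (lam : ℂ) • P := sub_eq_zero.1 hR
  have hlam0 : lam ≠ 0 := fun h => by
    rw [hEq, h] at hEP
    have := hEP.dotProduct_mulVec_pos (x := fun _ => 1) (by
        intro h; exact one_ne_zero (congrFun h (Classical.arbitrary n)))
    simp at this
  refine ⟨P, lam, ?_, hEq⟩
  have h6 : P = ((lam⁻¹ : ℝ) : ℂ) • cpMap A P := by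
    rw [hEq, smul_smul, ← Complex.ofReal_mul, inv_mul_cancel₀ hlam0, Complex.ofReal_one, one_smul]
  rw [h6]
  exact hEP.smul (Complex.zero_lt_real.2 (inv_pos.2 (lt_of_le_of_ne hlam hlam0.symm)))

/-- The positive definite eigenvector is unique up to a factor. -/
theorem Spans.posDef_eigenvector_unique [Nonempty n] {A : ι → Matrix n n ℂ} (hA : Spans A)
    {P Q : Matrix n n ℂ} {lam : ℝ} (hP : P.PosDef) (hQ : Q.PosDef)
    (h1 : cpMap A P = (lam : ℂ) • P) (h2 : cpMap A Q = (lam : ℂ) • Q) :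
    ∃ t : ℝ, 0 < t ∧ P = (t : ℂ) • Q := by
  have hx : (fun _ => 1 : n → ℂ) ≠ 0 := fun h =>
    one_ne_zero (congrFun h (Classical.arbitrary n))
  -- for the largest `t` with `P ≥ t Q`, the eigenvector `P - t Q` is not positive definite, so it
  -- vanishes
  let T : Set ℝ := {t | 0 ≤ t ∧ (P - (t : ℂ) • Q).PosSemidef}
  have hcl : IsClosed T := (isClosed_le continuous_const continuous_id).inter
    (isClosed_posSemidef.preimage (by fun_prop : Continuous fun t : ℝ => P - (t : ℂ) • Q))
  obtain ⟨hq, -⟩ := Complex.pos_iff.1 (hQ.dotProduct_mulVec_pos hx)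
  have hcomp : IsCompact T := by
    refine (isCompact_Icc (a := 0) (b := (star (fun _ => 1 : n → ℂ) ⬝ᵥ P.mulVec fun _ => 1).re
      / (star (fun _ => 1 : n → ℂ) ⬝ᵥ Q.mulVec fun _ => 1).re)).of_isClosed_subset hcl ?_
    rintro t ⟨h0, ht⟩
    refine ⟨h0, (le_div_iff₀ hq).2 ?_⟩
    have := (Complex.nonneg_iff.1 (ht.dotProduct_mulVec_nonneg fun _ => 1)).1
    simp only [Matrix.sub_mulVec, Matrix.smul_mulVec, dotProduct_sub, dotProduct_smul,
      smul_eq_mul, Complex.sub_re, Complex.re_ofReal_mul] at this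
    linarith
  obtain ⟨t, ⟨ht0, ht⟩, hmax⟩ := hcomp.exists_isMaxOn ⟨0, le_rfl, by simpa using hP.posSemidef⟩
    continuousOn_id
  have hP0 : P ≠ 0 := fun h => by
    have := hP.dotProduct_mulVec_pos hx
    rw [h] at this
    simp at this
  have hlam : 0 < lam := by
    have h3 := (Complex.pos_iff.1 ((hA.cpMap_posDef hP.posSemidef hP0).dotProduct_mulVec_pos hx)).1
    have h4 := (Complex.pos_iff.1 (hP.dotProduct_mulVec_pos hx)).1
    rw [h1, Matrix.smul_mulVec, dotProduct_smul, smul_eq_mul, Complex.re_ofReal_mul] at h3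
    exact pos_of_mul_pos_left h3 h4.le
  have hR : P - (t : ℂ) • Q = 0 := by
    by_contra hR
    have h3 : P - (t : ℂ) • Q = ((lam⁻¹ : ℝ) : ℂ) • cpMap A (P - (t : ℂ) • Q) := by
      rw [cpMap_sub, cpMap_smul, h1, h2, smul_comm (t : ℂ), ← smul_sub, smul_smul,
        ← Complex.ofReal_mul, inv_mul_cancel₀ hlam.ne', Complex.ofReal_one, one_smul]
    have h4 : (P - (t : ℂ) • Q).PosDef := by
      rw [h3]
      exact (hA.cpMap_posDef ht hR).smul (Complex.zero_lt_real.2 (inv_pos.2 hlam))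
    obtain ⟨ε, hε, h5⟩ := exists_posSemidef_sub_smul h4 hQ.isHermitian
    have h6 : t + ε ∈ T := ⟨by positivity, by
      rw [Complex.ofReal_add, add_smul, ← sub_sub]; exact h5⟩
    have : t + ε ≤ t := hmax h6
    linarith
  refine ⟨t, lt_of_le_of_ne ht0 ?_, sub_eq_zero.1 hR⟩
  rintro rfl
  simp [hP0] at hR

omit [DecidableEq n] in
theorem cpMap_act {R : Matrix ι ι ℂ} [DecidableEq ι] (hR : R.conjTranspose * R = 1)
    (A : ι → Matrix n n ℂ) (X : Matrix n n ℂ) : cpMap (act R A) X = cpMap A X := by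
  have h : ∀ j k, ∑ i, star (R i j) * R i k = if j = k then 1 else 0 := fun j k => by
    have := congrFun (congrFun hR j) k
    simpa only [Matrix.mul_apply, Matrix.conjTranspose_apply, Matrix.one_apply] using this
  simp only [cpMap, act, Matrix.conjTranspose_sum, Matrix.conjTranspose_smul, Finset.sum_mul,
    Finset.mul_sum, Matrix.smul_mul, Matrix.mul_smul, smul_smul]
  rw [Finset.sum_comm]
  refine Finset.sum_congr rfl fun j _ => ?_
  rw [Finset.sum_comm]
  simp only [← Finset.sum_smul]
  rw [Finset.sum_eq_single j]
  · rw [h j j, if_pos rfl, one_smul]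
  · intro k _ hk
    rw [h j k, if_neg hk.symm, zero_smul]
  · exact fun h => absurd (Finset.mem_univ _) h

variable {G : Type} [Group G]

/-- For a unitary symmetry, there is a gauge in which the virtual symmetry is unitary: the virtual
symmetry maps the positive definite eigenvector of the transfer map to a multiple of itself. The
cocycle can be chosen freely within the class. -/
theorem Spans.exists_unitary_gauge [DecidableEq ι] {D : ℕ} (hD : 0 < D)
    {A : ι → Matrix (Fin D) (Fin D) ℂ} (hA : Spans A) {R : G → Matrix ι ι ℂ}
    (hR : ∀ g, (R g).conjTranspose * R g = 1) {ω : Z2 G} (h : HasSPTClass A R ω) :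
    ∃ (S S' : Matrix (Fin D) (Fin D) ℂ) (V : G → Matrix.unitaryGroup (Fin D) ℂ) (c : G → Circle),
      S * S' = 1 ∧ S' * S = 1 ∧
      (∀ g i, act (R g) (fun i => S' * A i * S) i
        = (c g : ℂ) • ((V g).val.conjTranspose * (S' * A i * S) * (V g).val)) ∧
      ∀ g h, (V g).val * (V h).val = phase ω g h • (V (g * h)).val := by
  have : Nonempty (Fin D) := ⟨⟨0, hD⟩⟩
  obtain ⟨V, c, ω', hV, hm, hω⟩ := h
  obtain ⟨μ, hμ⟩ := exists_phase_of_cohClass_eq hω.symm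
  obtain ⟨P, lam, hP, hlam⟩ := hA.exists_posDef_eigenvector
  have key : ∀ g, ∃ t : ℝ, 0 < t ∧ (V g).val * P * (V g).val.conjTranspose = (t : ℂ) • P := by
    intro g
    have e0 : act (R g) A = fun i => (c g : ℂ) • ((V g)⁻¹.val * A i * (V g).val) := funext (hV g)
    have e1 : (V g).val * cpMap A P * (V g).val.conjTranspose
        = cpMap A ((V g).val * P * (V g).val.conjTranspose) := by
      rw [← cpMap_act (hR g) A P, e0]
      simp only [cpMap, Finset.mul_sum, Finset.sum_mul]
      refine Finset.sum_congr rfl fun i _ => ?_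
      have hc : (c g : ℂ) * star (c g : ℂ) = 1 := by
        rw [Complex.star_def, Complex.mul_conj, Complex.normSq_eq_norm_sq, Circle.norm_coe]; simp
      have hinv : (V g)⁻¹.val.conjTranspose * (V g).val.conjTranspose = 1 := by
        rw [← Matrix.conjTranspose_mul]; simp
      simp only [Matrix.conjTranspose_smul, Matrix.conjTranspose_mul, Matrix.smul_mul,
        Matrix.mul_smul, smul_smul, mul_comm (star (c g : ℂ)), hc, one_smul]
      simp only [Matrix.mul_assoc, hinv, Matrix.mul_one]
      rw [← Matrix.mul_assoc, Units.mul_inv, Matrix.one_mul]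
    have e2 : ((V g).val * P * (V g).val.conjTranspose).PosDef := by
      refine hP.mul_mul_conjTranspose_same (Matrix.vecMul_injective_of_isUnit (V g).isUnit)
    refine hA.posDef_eigenvector_unique e2 hP ?_ hlam
    rw [← e1, hlam, Matrix.mul_smul, Matrix.smul_mul]
  -- conjugation by `u` with `P = u†u` maps the eigenvector to the identity matrix
  obtain ⟨T, hT⟩ := exists_eq_conjTranspose_mul hP.posSemidef
  have hTu : IsUnit T := by
    rw [Matrix.isUnit_iff_isUnit_det]
    have := (Matrix.isUnit_iff_isUnit_det _).1 hP.isUnit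
    rw [hT, Matrix.det_mul] at this
    exact isUnit_of_mul_isUnit_right this
  obtain ⟨u, rfl⟩ := hTu
  set S := u.val.conjTranspose with hS
  set S' := (u⁻¹).val.conjTranspose with hS'
  have h1 : S * S' = 1 := by rw [hS, hS', ← Matrix.conjTranspose_mul]; simp
  have h2 : S' * S = 1 := by rw [hS, hS', ← Matrix.conjTranspose_mul]; simp
  choose t ht0 ht using key
  let r : G → ℝ := fun g => (Real.sqrt (t g))⁻¹
  have hr0 : ∀ g, 0 < r g := fun g => inv_pos.2 (Real.sqrt_pos.2 (ht0 g))
  have hrt : ∀ g, (r g : ℂ) * (r g : ℂ) * (t g : ℂ) = 1 := fun g => by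
    rw [← Complex.ofReal_mul, ← Complex.ofReal_mul]
    simp only [r]
    rw [← mul_inv, Real.mul_self_sqrt (ht0 g).le, inv_mul_cancel₀ (ht0 g).ne', Complex.ofReal_one]
  -- `r g` makes the matrices unitary and `μ g` adjusts the cocycle within its class
  let W : G → Matrix (Fin D) (Fin D) ℂ := fun g => ((μ g : ℂ) * (r g : ℂ)) • (S' * (V g).val * S)
  have hμ1 : ∀ g, (μ g : ℂ) * star (μ g : ℂ) = 1 := fun g => by
    rw [Complex.star_def, Complex.mul_conj, Complex.normSq_eq_norm_sq, Circle.norm_coe]; simp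
  have hWW : ∀ g, W g * (W g).conjTranspose = 1 := fun g => by
    have e1 : S' * (V g).val * S * (S' * (V g).val * S).conjTranspose
        = (t g : ℂ) • (1 : Matrix (Fin D) (Fin D) ℂ) := by
      calc _ = S' * ((V g).val * (S * S.conjTranspose) * (V g).val.conjTranspose)
            * S'.conjTranspose := by
            simp only [Matrix.conjTranspose_mul, Matrix.mul_assoc]
        _ = (t g : ℂ) • (S' * S * (S' * S).conjTranspose) := by
            have : S * S.conjTranspose = P := by rw [hS, Matrix.conjTranspose_conjTranspose, hT]
            rw [this, ht, ← this]
            simp only [Matrix.conjTranspose_mul, Matrix.mul_assoc, Matrix.smul_mul, Matrix.mul_smul]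
        _ = _ := by rw [h2]; simp
    have e2 : (W g).conjTranspose = (star (μ g : ℂ) * (r g : ℂ)) •
        (S' * (V g).val * S).conjTranspose := by
      simp only [W, Matrix.conjTranspose_smul, star_mul', Complex.star_def, Complex.conj_ofReal]
    rw [e2, Matrix.smul_mul, Matrix.mul_smul, e1, smul_smul, smul_smul]
    rw [show (μ g : ℂ) * (r g : ℂ) * (star (μ g : ℂ) * (r g : ℂ)) * (t g : ℂ) = 1 by
      linear_combination (hrt g) * (μ g : ℂ) * star (μ g : ℂ) + hμ1 g, one_smul]
  have hWW' : ∀ g, (W g).conjTranspose * W g = 1 := fun g => mul_eq_one_comm.1 (hWW g)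
  have hmul : ∀ g h, W g * W h = phase ω g h • W (g * h) := fun g h => by
    set ν : ℝ := r g * r h / r (g * h) with hν
    have hν0 : 0 < ν := div_pos (mul_pos (hr0 g) (hr0 h)) (hr0 _)
    have hrc : (r (g * h) : ℂ) ≠ 0 := Complex.ofReal_ne_zero.2 (hr0 _).ne'
    have e1 : W g * W h = (phase ω g h * (ν : ℂ)) • W (g * h) := by
      have : S' * (V g).val * S * (S' * (V h).val * S) = S' * ((V g).val * (V h).val) * S := by
        calc _ = S' * (V g).val * (S * S') * (V h).val * S := by simp only [Matrix.mul_assoc]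
          _ = _ := by rw [h1, Matrix.mul_one]; simp only [Matrix.mul_assoc]
      simp only [W]
      rw [smul_mul_smul_comm, this, hm, Matrix.mul_smul, Matrix.smul_mul, smul_smul, smul_smul]
      congr 1
      rw [hν]
      push_cast
      field_simp
      linear_combination -(r g : ℂ) * (r h : ℂ) * hμ g h
    -- the positive factor is one because all matrices are unitary
    have e2 : ν = 1 := by
      have e3 : (W g * W h) * (W g * W h).conjTranspose = 1 := by
        rw [Matrix.conjTranspose_mul, Matrix.mul_assoc, ← Matrix.mul_assoc (W h), hWW,
          Matrix.one_mul, hWW]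
      rw [e1, Matrix.conjTranspose_smul, Matrix.smul_mul, Matrix.mul_smul, hWW, smul_smul] at e3
      have e4 := congrFun (congrFun e3 ⟨0, hD⟩) ⟨0, hD⟩
      simp only [Matrix.smul_apply, Matrix.one_apply_eq, smul_eq_mul, mul_one] at e4
      have e5 := congrArg norm e4
      rw [norm_mul, norm_star, norm_mul, norm_phase, one_mul, Complex.norm_real, norm_one,
        Real.norm_of_nonneg hν0.le] at e5
      nlinarith
    rw [e1, e2, Complex.ofReal_one, mul_one]
  refine ⟨S, S', fun g => ⟨W g, Matrix.mem_unitaryGroup_iff.2 (hWW g)⟩, c, h1, h2, fun g i => ?_,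
    hmul⟩
  have e0 : act (R g) A = fun i => (c g : ℂ) • ((V g)⁻¹.val * A i * (V g).val) := funext (hV g)
  have e1 : W g * (S' * ((V g)⁻¹.val * A i * (V g).val) * S) = S' * A i * S * W g := by
    simp only [W, Matrix.smul_mul, Matrix.mul_smul]
    congr 1
    calc _ = S' * ((V g).val * ((S * S') * ((V g)⁻¹.val * (A i * ((V g).val * S))))) := by
          simp only [Matrix.mul_assoc]
      _ = S' * (A i * ((V g).val * S)) := by
          rw [h1, Matrix.one_mul, ← Matrix.mul_assoc (V g).val (V g)⁻¹.val, Units.mul_inv,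
            Matrix.one_mul]
      _ = S' * (A i * ((S * S') * ((V g).val * S))) := by rw [h1, Matrix.one_mul]
      _ = _ := by simp only [Matrix.mul_assoc]
  rw [act_mul_mul, e0]
  simp only [Matrix.mul_smul, Matrix.smul_mul]
  congr 1
  rw [Matrix.mul_assoc (W g).conjTranspose, ← e1, ← Matrix.mul_assoc (W g).conjTranspose, hWW', Matrix.one_mul]

end Perron

/-! ### Pure states as density operators -/

section Pure

variable {G : Type} [Group G] {d D : ℕ}

/-- The transfer matrix `∑ᵢ Aⁱ ⊗ (Aⁱ)*` of a matrix product state. -/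
def transferOp {ι n : Type} [Fintype ι] (A : ι → Matrix n n ℂ) : Matrix (n × n) (n × n) ℂ :=
  ∑ i, A i ⊗ₖ (A i).map star

/-- A real eigenvalue of multiplicity one is larger than the modulus of every other eigenvalue. -/
def UniqueLargest {n : Type} [Fintype n] [DecidableEq n] (M : Matrix n n ℂ) : Prop :=
  ∃ lam : ℝ, M.charpoly.rootMultiplicity (lam : ℂ) = 1 ∧
    ∀ μ : ℂ, M.charpoly.IsRoot μ → μ ≠ (lam : ℂ) → ‖μ‖ < lam

theorem uniqueLargest_reindex {n m : Type} [Fintype n] [DecidableEq n] [Fintype m] [DecidableEq m]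
    (e : n ≃ m) (M : Matrix n n ℂ) : UniqueLargest (Matrix.reindex e e M) ↔ UniqueLargest M := by
  rw [UniqueLargest, Matrix.charpoly_reindex, UniqueLargest]

theorem uniqueLargest_conj {n m : Type} [Fintype n] [DecidableEq n] [Fintype m] [DecidableEq m]
    {X : Matrix n m ℂ} {Y : Matrix m n ℂ} (hXY : X * Y = 1) (hYX : Y * X = 1) {M : Matrix m m ℂ} :
    UniqueLargest (X * M * Y) ↔ UniqueLargest M := by
  have hcard : Fintype.card n = Fintype.card m := by
    have h := Matrix.trace_mul_comm X Y
    rw [hXY, hYX, Matrix.trace_one, Matrix.trace_one] at h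
    exact_mod_cast h
  have h : (X * M * Y).charpoly = M.charpoly := by
    have := Matrix.charpoly_mul_comm' (X * M) Y
    rw [hcard, ← Matrix.mul_assoc, hYX, Matrix.one_mul] at this
    exact mul_left_cancel₀ (pow_ne_zero _ Polynomial.X_ne_zero) this
  rw [UniqueLargest, h, UniqueLargest]

/-- A matrix of rank one with positive trace has a single nonzero eigenvalue, its trace. -/
theorem uniqueLargest_vecMulVec {n : Type} [Fintype n] [DecidableEq n] [Nonempty n] {u v : n → ℂ}
    {r : ℝ} (hr : 0 < r) (h : u ⬝ᵥ v = r) : UniqueLargest (Matrix.vecMulVec u v) := by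
  have hc : (Matrix.vecMulVec u v).charpoly
      = Polynomial.X ^ (Fintype.card n - 1) * (Polynomial.X - Polynomial.C (r : ℂ)) := by
    obtain ⟨k, hk⟩ := Nat.exists_eq_succ_of_ne_zero (Fintype.card_ne_zero (α := n))
    rw [Matrix.charpoly_vecMulVec, h, hk, Nat.succ_sub_one, Polynomial.smul_eq_C_mul, pow_succ]
    ring
  have hr' : (r : ℂ) ≠ 0 := by exact_mod_cast hr.ne'
  refine ⟨r, ?_, fun μ hμ hne => ?_⟩
  · rw [hc, Polynomial.rootMultiplicity_mul (mul_ne_zero (pow_ne_zero _ Polynomial.X_ne_zero)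
      (Polynomial.X_sub_C_ne_zero _)), Polynomial.rootMultiplicity_X_sub_C_self,
      Polynomial.rootMultiplicity_eq_zero]
    simp [Polynomial.IsRoot.def, hr']
  · rw [hc, Polynomial.IsRoot.def] at hμ
    simp only [Polynomial.eval_mul, Polynomial.eval_pow, Polynomial.eval_X, Polynomial.eval_sub,
      Polynomial.eval_C, mul_eq_zero, sub_eq_zero, hne, or_false] at hμ
    rw [eq_zero_of_pow_eq_zero hμ, norm_zero]
    exact hr

variable (U : G →* Matrix.unitaryGroup (Fin d) ℂ) (A : Fin d → Matrix (Fin D) (Fin D) ℂ)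

omit U A in
/-- Reindexing is a conjugation by permutation matrices. -/
theorem exists_conj_eq_reindex {n m : Type} [Fintype n] [DecidableEq n] [Fintype m] [DecidableEq m]
    (e : n ≃ m) : ∃ (X : Matrix n m ℂ) (Y : Matrix m n ℂ), X * Y = 1 ∧ Y * X = 1 ∧
      ∀ M : Matrix n n ℂ, Y * M * X = Matrix.reindex e e M := by
  refine ⟨(1 : Matrix n n ℂ).submatrix id e.symm, (1 : Matrix n n ℂ).submatrix e.symm id, ?_, ?_,
    fun M => ?_⟩
  · rw [Matrix.submatrix_mul_equiv, Matrix.one_mul, Matrix.submatrix_id_id]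
  · change Matrix.submatrix _ _ (Equiv.refl _) * Matrix.submatrix _ (Equiv.refl _) _ = _
    rw [Matrix.submatrix_mul_equiv, Matrix.one_mul, Matrix.submatrix_one_equiv]
  · change Matrix.submatrix _ _ (Equiv.refl _) * M.submatrix (Equiv.refl _) (Equiv.refl _)
      * Matrix.submatrix _ (Equiv.refl _) _ = _
    rw [Matrix.submatrix_mul_equiv, Matrix.submatrix_mul_equiv, Matrix.one_mul, Matrix.mul_one]
    rfl

theorem pureMPO_isLocalPurification :
    (pureMPO U A).IsLocalPurification (e := 1) (D := D) fun p : Fin d × Fin 1 => A p.1 := by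
  obtain ⟨X, Y, hXY, hYX, h⟩ := exists_conj_eq_reindex (finProdFinEquiv (m := D) (n := D))
  have key : ∀ M : Matrix (Fin D × Fin D) (Fin D × Fin D) ℂ,
      X * Matrix.reindex finProdFinEquiv finProdFinEquiv M * Y = M := fun M => by
    rw [← h, Matrix.mul_assoc Y, ← Matrix.mul_assoc X, hXY, Matrix.one_mul, Matrix.mul_assoc, hXY,
      Matrix.mul_one]
  refine ⟨X, Y, hXY, hYX, fun i j => ?_⟩
  rw [Fin.sum_univ_one]
  exact key _

theorem pureMPO_state (L : ℕ) : (pureMPO U A).state L = mpsDensity A L := by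
  ext s t
  rw [(pureMPO U A).state_eq_sum (pureMPO_isLocalPurification U A)]
  exact Fintype.sum_unique _

theorem act_purifiedRep_pureMPO (g : G) (p : Fin d × Fin 1) :
    act ((pureMPO U A).purifiedRep 1 g) (fun p : Fin d × Fin 1 => A p.1) p
      = act (U g).val A p.1 := by
  obtain ⟨i, k⟩ := p
  change ∑ q : Fin d × Fin 1, ((U g).val ⊗ₖ (1 : Matrix (Fin 1) (Fin 1) ℂ)) (i, k) q • A q.1 = _
  rw [Fintype.sum_prod_type, act]
  refine Finset.sum_congr rfl fun j _ => ?_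
  rw [Fin.sum_univ_one, Subsingleton.elim k 0, Matrix.kroneckerMap_apply, Matrix.one_apply_eq,
    mul_one]

variable {U A}

theorem hasSPTClass_purifiedRep_pureMPO {ω : Z2 G} :
    HasSPTClass (fun p : Fin d × Fin 1 => A p.1) ((pureMPO U A).purifiedRep 1) ω
      ↔ HasSPTClass A (fun g => (U g).val) ω := by
  constructor
  · rintro ⟨V, c, ω', h, hm, hω⟩
    exact ⟨V, c, ω', fun g i => (act_purifiedRep_pureMPO U A g (i, 0)).symm.trans (h g (i, 0)),
      hm, hω⟩
  · rintro ⟨V, c, ω', h, hm, hω⟩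
    exact ⟨V, c, ω', fun g i => (act_purifiedRep_pureMPO U A g i).trans (h g i.1), hm, hω⟩

theorem inPhase_pureMPO {ω : Z2 G} (h : HasSPTClass A (fun g => (U g).val) ω) :
    (pureMPO U A).InPhase ω :=
  (pureMPO_isLocalPurification U A).inPhase (hasSPTClass_purifiedRep_pureMPO.2 h)

theorem hasSPTClass_of_inPhase (hρ : (pureMPO U A).IsStrongInjectiveMPDO)
    (hs : (pureMPO U A).StronglySymmetric) {ω : Z2 G} (h : (pureMPO U A).InPhase ω) :
    HasSPTClass A (fun g => (U g).val) ω :=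
  hasSPTClass_purifiedRep_pureMPO.1
    (h.isPureSPT hρ hs (pureMPO_isLocalPurification U A)).sptClass

theorem isStrongInjectiveMPDO_pureMPO (hD : 0 < D) (hA : Spans A)
    (hu : UniqueLargest (transferOp A)) : (pureMPO U A).IsStrongInjectiveMPDO where
  bond_pos := Nat.mul_pos hD hD
  posSemidef L _ := by
    rw [pureMPO_state, mpsDensity]
    exact Matrix.posSemidef_vecMulVec_self_star (mps A L)
  injective := by
    obtain ⟨X, Y, -, hYX, h⟩ := exists_conj_eq_reindex (finProdFinEquiv (m := D) (n := D))
    have h' := hA.kronecker.conj hYX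
    simp only [h] at h'
    exact (injectiveTensor_iff_spans _).2 h'
  uniqueLargest := by
    have h : ∑ i, Matrix.reindex finProdFinEquiv finProdFinEquiv (A i ⊗ₖ (A i).map star)
        = Matrix.reindex finProdFinEquiv finProdFinEquiv (transferOp A) := by
      ext x y
      simp only [transferOp, Matrix.reindex_apply, Matrix.submatrix_apply, Matrix.sum_apply]
    have := (uniqueLargest_reindex finProdFinEquiv _).2 hu
    rw [← h] at this
    exact this

theorem stronglySymmetric_pureMPO (h : SymmetricMPS A fun g => (U g).val) :
    (pureMPO U A).StronglySymmetric := by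
  intro L hL g
  obtain ⟨θ, hθ⟩ := h L hL g
  have h1 : (tensorOp fun _ : Fin L => (U g).val) * mpsDensity A L = (θ : ℂ) • mpsDensity A L := by
    rw [mpsDensity, Matrix.mul_vecMulVec, hθ, Matrix.smul_vecMulVec]
  have h2 : mpsDensity A L * (tensorOp fun _ : Fin L => (U g).val).conjTranspose
      = ((θ⁻¹ : Circle) : ℂ) • mpsDensity A L := by
    rw [mpsDensity, Matrix.vecMulVec_mul, ← Matrix.star_mulVec, hθ, star_smul,
      Matrix.vecMulVec_smul, Circle.coe_inv_eq_conj]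
    rfl
  rw [pureMPO_state]
  exact ⟨θ, h1, h2⟩

/-- A symmetric injective matrix product state whose transfer matrix has a unique eigenvalue of
largest modulus, as a density operator. -/
def pureNode (U : G →* Matrix.unitaryGroup (Fin d) ℂ) (A : Fin d → Matrix (Fin D) (Fin D) ℂ)
    (hD : 0 < D) (hA : Spans A) (hs : SymmetricMPS A fun g => (U g).val)
    (hu : UniqueLargest (transferOp A)) : PurifiableMPDO G :=
  ⟨pureMPO U A, isStrongInjectiveMPDO_pureMPO hD hA hu, stronglySymmetric_pureMPO hs,
    1, D, _, pureMPO_isLocalPurification U A⟩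

/-- Pure states connected by a path of symmetric injective tensors are in the same phase. -/
theorem PureDeformation.cohClass_eq {ρ ρ' : MPO G} (h : PureDeformation ρ ρ')
    (hρ : ρ.IsStrongInjectiveMPDO) (hs : ρ.StronglySymmetric) (hρ' : ρ'.IsStrongInjectiveMPDO)
    (hs' : ρ'.StronglySymmetric) {ω ω' : Z2 G} (hω : ρ.InPhase ω) (hω' : ρ'.InPhase ω') :
    cohClass ω = cohClass ω' := by
  obtain ⟨d, D, U, A, hc, hA, rfl, rfl⟩ := h
  have hD : 0 < D := Nat.pos_of_mul_pos_right hρ.bond_pos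
  exact cohClass_eq_of_path hc hA hD (hasSPTClass_of_inPhase hρ hs hω)
    (hasSPTClass_of_inPhase hρ' hs' hω')

end Pure

/-! ### Elementary one-way connections -/

section Circuits

variable {G : Type} [Group G]

omit [Group G] in
theorem IsSymNondegChannel.of_isometry {a b : Type} [Fintype a] [Fintype b] [DecidableEq a]
    {R : G → Matrix a a ℂ} {R' : G → Matrix b b ℂ} {W : Matrix b a ℂ}
    (hW : W.conjTranspose * W = 1) (h : ∃ θ : G → Circle, ∀ g,
      R' g * W * (R g).conjTranspose = (θ g : ℂ) • W) :
    IsSymNondegChannel R R' fun _ : Fin 1 => W where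
  tracePreserving := by rw [Fin.sum_univ_one, hW]
  nondegenerate := by
    have key : ∀ X : Matrix a a ℂ,
        W.conjTranspose * krausMap (fun _ : Fin 1 => W) X * W = X := fun X => by
      rw [krausMap, Fin.sum_univ_one, Matrix.mul_assoc W, ← Matrix.mul_assoc, hW, Matrix.one_mul,
        Matrix.mul_assoc, hW, Matrix.mul_one]
    intro X Y hXY
    rw [← key X, ← key Y]
    exact congrArg (fun Z => W.conjTranspose * Z * W) hXY
  stronglySymmetric := h.imp fun _ h g _ => h g

theorem krausMap_unique {κ a b : Type} [Fintype κ] [Unique κ] [Fintype a] (W : Matrix b a ℂ)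
    (X : Matrix a a ℂ) : krausMap (fun _ : κ => W) X = W * X * W.conjTranspose :=
  Fintype.sum_unique _

theorem superOp_kronecker {κ a b : Type} [Fintype κ] (K : κ → Matrix b a ℂ) :
    superOp (fun k : κ × κ => K k.1 ⊗ₖ K k.2) = (superOp K ⊗ₖ superOp K).submatrix
      (Equiv.prodProdProdComm b b b b) (Equiv.prodProdProdComm a a a a) := by
  ext ⟨⟨p₁, p₂⟩, p₃, p₄⟩ ⟨⟨q₁, q₂⟩, q₃, q₄⟩
  simp only [superOp, Matrix.of_apply, Matrix.submatrix_apply, Matrix.kroneckerMap_apply,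
    Equiv.prodProdProdComm_apply, Fintype.sum_prod_type, Finset.sum_mul_sum, star_mul']
  exact Finset.sum_congr rfl fun _ _ => Finset.sum_congr rfl fun _ _ => by ring

theorem krausMap_comp_equiv {κ κ' a b : Type} [Fintype κ] [Fintype κ'] [Fintype a]
    (f : κ ≃ κ') (K : κ' → Matrix b a ℂ) : krausMap (fun k => K (f k)) = krausMap K := by
  funext X
  exact f.sum_comp fun k => K k * X * (K k).conjTranspose

/-- Two copies of an onsite channel form a two-site channel. -/
theorem IsSymNondegChannel.kronecker {m n e : ℕ} {U : G →* Matrix.unitaryGroup (Fin m) ℂ}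
    {U' : G →* Matrix.unitaryGroup (Fin n) ℂ} {K : Fin e → Matrix (Fin n) (Fin m) ℂ}
    (hK : IsSymNondegChannel (fun g => (U g).val) (fun g => (U' g).val) K) :
    IsSymNondegChannel (pairRep U) (pairRep U') fun k : Fin (e * e) =>
      K (finProdFinEquiv.symm k).1 ⊗ₖ K (finProdFinEquiv.symm k).2 where
  tracePreserving := by
    rw [(finProdFinEquiv (m := e) (n := e)).symm.sum_comp fun k : Fin e × Fin e =>
      (K k.1 ⊗ₖ K k.2).conjTranspose * (K k.1 ⊗ₖ K k.2)]
    simp only [Matrix.conjTranspose_kronecker, ← Matrix.mul_kronecker_mul, Fintype.sum_prod_type]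
    have h : ∀ X Y : Fin e → Matrix (Fin m) (Fin m) ℂ,
        ∑ i, ∑ j, X i ⊗ₖ Y j = (∑ i, X i) ⊗ₖ ∑ j, Y j := fun X Y => by
      ext ⟨_, _⟩ ⟨_, _⟩
      simp only [Matrix.sum_apply, Matrix.kroneckerMap_apply, Finset.sum_mul_sum]
    rw [h (fun i => (K i).conjTranspose * K i) fun i => (K i).conjTranspose * K i,
      hK.tracePreserving, Matrix.one_kronecker_one]
  nondegenerate := by
    rw [krausMap_comp_equiv (finProdFinEquiv (m := e) (n := e)).symm fun k : Fin e × Fin e =>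
      K k.1 ⊗ₖ K k.2, ← superOp_mulVec_injective, superOp_kronecker]
    obtain ⟨N, hN⟩ := exists_leftInverse (superOp_mulVec_injective.2 hK.nondegenerate)
    have h : (N ⊗ₖ N).submatrix (Equiv.prodProdProdComm _ _ _ _) (Equiv.prodProdProdComm _ _ _ _)
        * (superOp K ⊗ₖ superOp K).submatrix (Equiv.prodProdProdComm _ _ _ _)
          (Equiv.prodProdProdComm _ _ _ _) = 1 := by
      rw [Matrix.submatrix_mul_equiv, ← Matrix.mul_kronecker_mul, hN, Matrix.one_kronecker_one,
        Matrix.submatrix_one_equiv]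
    intro v w hvw
    rw [← Matrix.one_mulVec v, ← Matrix.one_mulVec w, ← h, ← Matrix.mulVec_mulVec,
      ← Matrix.mulVec_mulVec]
    exact congrArg _ hvw
  stronglySymmetric := by
    obtain ⟨θ, hθ⟩ := hK.stronglySymmetric
    refine ⟨fun g => θ g * θ g, fun g k => ?_⟩
    rw [pairRep, pairRep, Matrix.conjTranspose_kronecker, ← Matrix.mul_kronecker_mul,
      ← Matrix.mul_kronecker_mul, hθ, hθ, Matrix.smul_kronecker, Matrix.kronecker_smul, smul_smul,
      Circle.coe_mul]

theorem layerChannel_eq_onsiteChannel {M m n e : ℕ} (K : Fin e → Matrix (Fin n) (Fin m) ℂ)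
    (X : Matrix (Fin (2 * M) → Fin m) (Fin (2 * M) → Fin m) ℂ) :
    layerChannel 0 (fun (_ : Fin M) (k : Fin (e * e)) =>
      K (finProdFinEquiv.symm k).1 ⊗ₖ K (finProdFinEquiv.symm k).2) X
      = onsiteChannel K (2 * M) X := by
  have h := krausMap_comp_equiv ((pairConf (M := M) 0 (Fin e)).trans
    ((Equiv.refl (Fin M)).arrowCongr finProdFinEquiv)) fun k : Fin M → Fin (e * e) =>
      (Matrix.of fun (s : Fin (2 * M) → Fin n) (r : Fin (2 * M) → Fin m) => ∏ x,
        (K (finProdFinEquiv.symm (k x)).1 ⊗ₖ K (finProdFinEquiv.symm (k x)).2)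
          (s (pairFst 0 x), s (pairSnd 0 x)) (r (pairFst 0 x), r (pairSnd 0 x)))
  rw [layerChannel, ← h, onsiteChannel]
  congr 1
  funext k
  ext s r
  simp only [tensorOp, Matrix.of_apply]
  rw [prod_pairs 0]
  refine Finset.prod_congr rfl fun x _ => ?_
  simp [pairConf]

/-- Onsite channels are circuits of depth one. -/
theorem mapsTo_of_onsiteChannel {ρ ρ' : MPO G} {e : ℕ} {K : Fin e → Matrix (Fin ρ'.d) (Fin ρ.d) ℂ}
    (hK : IsSymNondegChannel ρ.rep ρ'.rep K)
    (h : ∀ L : ℕ, 0 < L → SameState (ρ'.state L) (onsiteChannel K L (ρ.state L))) :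
    MapsTo ρ ρ' := by
  refine ⟨1, fun M hM => ⟨_, .layer ρ'.U (fun _ k => K (finProdFinEquiv.symm k).1 ⊗ₖ
    K (finProdFinEquiv.symm k).2) .nil fun _ => hK.kronecker, ?_⟩⟩
  rw [layerChannel_eq_onsiteChannel]
  exact h _ (by omega)

theorem mul_vecMulVec_star_mul {a b : Type} [Fintype a] (P : Matrix b a ℂ) (v : a → ℂ) :
    P * Matrix.vecMulVec v (star v) * P.conjTranspose
      = Matrix.vecMulVec (P.mulVec v) (star (P.mulVec v)) := by
  rw [Matrix.mul_vecMulVec, Matrix.vecMulVec_mul, ← Matrix.star_mulVec]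

/-- Symmetric onsite isometries are one-way connections of pure states. -/
theorem mapsTo_of_isometry {m n D : ℕ} {U : G →* Matrix.unitaryGroup (Fin m) ℂ}
    {U' : G →* Matrix.unitaryGroup (Fin n) ℂ} {A : Fin m → Matrix (Fin D) (Fin D) ℂ}
    {W : Matrix (Fin n) (Fin m) ℂ} (hW : W.conjTranspose * W = 1)
    (h : ∃ θ : G → Circle, ∀ g, (U' g).val * W = (θ g : ℂ) • (W * (U g).val)) :
    MapsTo (pureMPO U A) (pureMPO U' (act W A)) := by
  have hsym : ∃ θ : G → Circle, ∀ g, (U' g).val * W * (U g).val.conjTranspose = (θ g : ℂ) • W :=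
    h.imp fun θ h g => by
      rw [h, Matrix.smul_mul, Matrix.mul_assoc]
      exact congrArg _ ((congrArg (W * ·) (Matrix.mem_unitaryGroup_iff.1 (U g).2)).trans
        (Matrix.mul_one W))
  refine mapsTo_of_onsiteChannel (K := fun _ : Fin 1 => W) (.of_isometry hW hsym) fun L _ =>
    ⟨1, one_pos, ?_⟩
  rw [Complex.ofReal_one, one_smul, pureMPO_state, pureMPO_state]
  have h1 := siteOp_mulVec_chain (fun _ : Fin L => W) fun _ => A
  rw [mpsDensity, mps_eq_chain, ← h1, ← mul_vecMulVec_star_mul]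
  exact (krausMap_unique (κ := Fin L → Fin 1) _ _).symm

/-- A circuit of two layers with the same symmetric unitary gate everywhere. -/
theorem mapsTo_of_gate {d D D' : ℕ} {U : G →* Matrix.unitaryGroup (Fin d) ℂ}
    {A : Fin d → Matrix (Fin D) (Fin D) ℂ} {B : Fin d → Matrix (Fin D') (Fin D') ℂ}
    {H : Matrix (Fin d × Fin d) (Fin d × Fin d) ℂ} (hH : H.conjTranspose * H = 1)
    (hU : ∀ g, pairRep U g * H * (pairRep U g).conjTranspose = H)
    (h : ∀ M : ℕ, 0 < M → ∃ r : ℝ, 0 < r ∧ (pairOp 1 (fun _ : Fin M => H)).mulVec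
      ((pairOp 0 fun _ : Fin M => H).mulVec (mps A (2 * M))) = (r : ℂ) • mps B (2 * M)) :
    MapsTo (pureMPO U A) (pureMPO U B) := by
  have hK : IsSymNondegChannel (pairRep U) (pairRep U) fun _ : Fin 1 => H :=
    .of_isometry hH ⟨fun _ => 1, fun g => by rw [hU, Circle.coe_one, one_smul]⟩
  have hl : ∀ (M t : ℕ) (v : (Fin (2 * M) → Fin d) → ℂ),
      layerChannel t (fun (_ : Fin M) (_ : Fin 1) => H) (Matrix.vecMulVec v (star v))
        = Matrix.vecMulVec ((pairOp t fun _ : Fin M => H).mulVec v)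
          (star ((pairOp t fun _ : Fin M => H).mulVec v)) := fun M t v => by
    rw [← mul_vecMulVec_star_mul]
    exact Fintype.sum_unique _
  refine ⟨2, fun M hM => ⟨_, .layer U (fun _ _ => H) (.layer U (fun _ _ => H) .nil fun _ => hK)
    fun _ => hK, ?_⟩⟩
  obtain ⟨r, hr, h⟩ := h M hM
  refine ⟨(r ^ 2)⁻¹, by positivity, ?_⟩
  have hr' : (r : ℂ) ≠ 0 := by exact_mod_cast hr.ne'
  have key : Matrix.vecMulVec (mps B (2 * M)) (star (mps B (2 * M)))
      = (((r ^ 2)⁻¹ : ℝ) : ℂ) • Matrix.vecMulVec ((r : ℂ) • mps B (2 * M))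
        (star ((r : ℂ) • mps B (2 * M))) := by
    have h1 : (((r ^ 2)⁻¹ : ℝ) : ℂ) * ((r : ℂ) * star (r : ℂ)) = 1 := by
      rw [RCLike.star_def, Complex.conj_ofReal, Complex.ofReal_inv, Complex.ofReal_pow]
      field_simp
    rw [star_smul, Matrix.smul_vecMulVec, Matrix.vecMulVec_smul, smul_smul (r : ℂ), smul_smul, h1,
      one_smul]
  rw [pureMPO_state, pureMPO_state, mpsDensity, mpsDensity, hl, hl, h]
  exact key

end Circuits

/-! ### States of entangled bonds -/

section Bond

variable {G : Type} [Group G] {b : Type} [Fintype b] [DecidableEq b] {d D : ℕ}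

/-- The tensor `Aˡʳ = j† |l⟩⟨r| j`, whose matrix product state is a product of the states
`∑ (j j†)ᵣₗ |r⟩|l⟩` on the bonds between neighbouring sites. -/
def bondTensor (e : Fin d ≃ b × b) (j : Matrix b (Fin D) ℂ) (i : Fin d) :
    Matrix (Fin D) (Fin D) ℂ :=
  j.conjTranspose * Matrix.single (e i).1 (e i).2 (1 : ℂ) * j

omit [DecidableEq b] in
theorem star_kronecker_self_mul {ω : Z2 G} {V : G → Matrix b b ℂ}
    (hV : ∀ g h, V g * V h = phase ω g h • V (g * h)) (g h : G) :
    (V (g * h)).map star ⊗ₖ V (g * h) = ((V g).map star ⊗ₖ V g) * ((V h).map star ⊗ₖ V h) := by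
  have h1 : (V g).map star * (V h).map star = (V g * V h).map star :=
    (Matrix.map_mul (f := starRingEnd ℂ)).symm
  have h2 : (phase ω g h • V (g * h)).map star = star (phase ω g h) • (V (g * h)).map star := by
    ext; simp
  have h3 : star (phase ω g h) * phase ω g h = 1 := by
    have := Complex.conj_mul' (phase ω g h)
    rw [norm_phase] at this
    simpa using this
  rw [← Matrix.mul_kronecker_mul, h1, hV, h2, Matrix.smul_kronecker, Matrix.kronecker_smul,
    smul_smul, h3, one_smul]

/-- The linear representation `V* ⊗ V` on the pairs of virtual indices of a site, where `V` is
a projective unitary representation. -/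
def bondRep (e : Fin d ≃ b × b) {ω : Z2 G} {V : G → Matrix.unitaryGroup b ℂ}
    (hV : ∀ g h, (V g).val * (V h).val = phase ω g h • (V (g * h)).val) :
    G →* Matrix.unitaryGroup (Fin d) ℂ :=
  MonoidHom.mk' (fun g => ⟨((V g).val.map star ⊗ₖ (V g).val).submatrix e e, by
    have h := Matrix.mem_unitaryGroup_iff.1 (V g).2
    have h' : (V g).val.map star * ((V g).val.map star).conjTranspose = 1 := by
      have h1 : (V g).val.map star * ((V g).val.map star).conjTranspose
          = ((V g).val * star (V g).val).map star := by
        rw [Matrix.star_eq_conjTranspose]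
        exact (Matrix.map_mul (f := starRingEnd ℂ)).symm
      rw [h1, h, Matrix.map_one _ (star_zero _) (star_one _)]
    rw [Matrix.mem_unitaryGroup_iff, Matrix.star_eq_conjTranspose, Matrix.conjTranspose_submatrix,
      Matrix.submatrix_mul_equiv, Matrix.conjTranspose_kronecker, ← Matrix.mul_kronecker_mul, h',
      ← Matrix.star_eq_conjTranspose, h, Matrix.one_kronecker_one, Matrix.submatrix_one_equiv]⟩)
    fun g h => by
      apply Subtype.ext
      change Matrix.submatrix _ _ _ = Matrix.submatrix _ _ _ * Matrix.submatrix _ _ _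
      rw [Matrix.submatrix_mul_equiv, ← star_kronecker_self_mul (V := fun g => (V g).val) hV]

theorem spans_single {n : Type} [Fintype n] [DecidableEq n] {ι : Type} (e : ι ≃ n × n) :
    Spans fun i => Matrix.single (e i).1 (e i).2 (1 : ℂ) := by
  rw [Spans, eq_top_iff]
  intro M _
  rw [Matrix.matrix_eq_sum_single M]
  refine Submodule.sum_mem _ fun x _ => Submodule.sum_mem _ fun y _ => ?_
  have : Matrix.single x y (M x y) = M x y • Matrix.single x y 1 := by
    rw [Matrix.smul_single, smul_eq_mul, mul_one]
  rw [this]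
  exact Submodule.smul_mem _ _ (Submodule.subset_span ⟨e.symm (x, y), by simp⟩)

variable {e : Fin d ≃ b × b} {j : Matrix b (Fin D) ℂ}

theorem spans_bondTensor (hj : j.conjTranspose * j = 1) : Spans (bondTensor e j) :=
  (spans_single e).conj hj

omit [Group G] in
theorem act_kronecker_single (V : Matrix b b ℂ) (i : Fin d) :
    act ((V.map star ⊗ₖ V).submatrix e e) (fun i => Matrix.single (e i).1 (e i).2 (1 : ℂ)) i
      = V.conjTranspose * Matrix.single (e i).1 (e i).2 (1 : ℂ) * V := by
  rw [act, ← e.symm.sum_comp]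
  ext x y
  simp only [Matrix.submatrix_apply, Equiv.apply_symm_apply, Matrix.sum_apply, Matrix.smul_apply,
    Matrix.kroneckerMap_apply, Matrix.map_apply, Fintype.sum_prod_type, Matrix.single_apply,
    smul_eq_mul, mul_ite, mul_one, mul_zero]
  rw [Finset.sum_eq_single x (fun z _ hz => by simp [hz]) (by simp),
    Finset.sum_eq_single y (fun z _ hz => by simp [hz]) (by simp)]
  simp [Matrix.mul_apply, Matrix.single_apply, ite_and, Finset.sum_ite_eq]

/-- An isometry `j` that intertwines `W` with `V` makes `W` the virtual symmetry of the state of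
entangled bonds. -/
theorem act_bondRep {ω : Z2 G} {V : G → Matrix.unitaryGroup b ℂ}
    (hV : ∀ g h, (V g).val * (V h).val = phase ω g h • (V (g * h)).val)
    {W : G → Matrix.unitaryGroup (Fin D) ℂ} (hW : ∀ g, (V g).val * j = j * (W g).val)
    (g : G) (i : Fin d) : act (bondRep e hV g).val (bondTensor e j) i
      = (W g).val.conjTranspose * bondTensor e j i * (W g).val := by
  have h1 : act (bondRep e hV g).val (bondTensor e j) i = j.conjTranspose *
      act (bondRep e hV g).val (fun i => Matrix.single (e i).1 (e i).2 (1 : ℂ)) i * j :=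
    congrFun (act_mul_mul (bondRep e hV g).val j.conjTranspose j
      fun i => Matrix.single (e i).1 (e i).2 (1 : ℂ)) i
  have h2 := act_kronecker_single (e := e) (V g).val i
  change act (bondRep e hV g).val _ i = _ at h2
  have h3 : j.conjTranspose * (V g).val.conjTranspose
      = (W g).val.conjTranspose * j.conjTranspose := by
    rw [← Matrix.conjTranspose_mul, hW, Matrix.conjTranspose_mul]
  rw [h1, h2, bondTensor]
  calc _ = j.conjTranspose * (V g).val.conjTranspose * Matrix.single (e i).1 (e i).2 (1 : ℂ)
        * ((V g).val * j) := by simp only [Matrix.mul_assoc]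
    _ = _ := by rw [h3, hW]; simp only [Matrix.mul_assoc]

/-- The transfer matrix of a state of entangled bonds has rank one: it is the projection onto the
maximally entangled state, up to a factor. -/
theorem uniqueLargest_bondTensor (hD : 0 < D) (hj : j.conjTranspose * j = 1) :
    UniqueLargest (transferOp (bondTensor e j)) := by
  have : Nonempty (Fin D) := ⟨⟨0, hD⟩⟩
  have h : transferOp (bondTensor e j) = Matrix.vecMulVec
      (fun p : Fin D × Fin D => (1 : Matrix (Fin D) (Fin D) ℂ) p.1 p.2)
      (fun p : Fin D × Fin D => (1 : Matrix (Fin D) (Fin D) ℂ) p.1 p.2) := by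
    ext ⟨x, x'⟩ ⟨y, y'⟩
    have hE : ∀ i x y, bondTensor e j i x y = star (j (e i).1 x) * j (e i).2 y := fun i x y => by
      simp [bondTensor, Matrix.mul_apply, Matrix.single_apply, ite_and, Finset.sum_ite_eq]
    have hsym : ∀ x x' : Fin D, (1 : Matrix (Fin D) (Fin D) ℂ) x x'
        = (1 : Matrix (Fin D) (Fin D) ℂ) x' x := fun x x' => by
      simp only [Matrix.one_apply, eq_comm]
    have h1 : ∀ x x', ∑ l, j l x * star (j l x') = (1 : Matrix (Fin D) (Fin D) ℂ) x x' := by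
      intro x x'
      have := congrFun (congrFun hj x') x
      rw [Matrix.mul_apply] at this
      simp only [Matrix.conjTranspose_apply] at this
      rw [hsym, ← this]
      exact Finset.sum_congr rfl fun _ _ => mul_comm _ _
    simp only [transferOp, Matrix.sum_apply, Matrix.kroneckerMap_apply, Matrix.map_apply, hE,
      Matrix.vecMulVec_apply]
    rw [← e.symm.sum_comp, Fintype.sum_prod_type, hsym x, ← h1, ← h1, Finset.sum_mul_sum]
    refine Finset.sum_congr rfl fun l _ => Finset.sum_congr rfl fun r _ => ?_
    simp only [Equiv.apply_symm_apply, star_mul', star_star]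
    ring
  rw [h]
  refine uniqueLargest_vecMulVec (r := D) (by exact_mod_cast hD) ?_
  simp [dotProduct, Fintype.sum_prod_type, Matrix.one_apply]

theorem prod_bondTensor (j : Matrix b (Fin D) ℂ) (L : ℕ) (l r : Fin (L + 1) → b) :
    (List.ofFn fun x => j.conjTranspose * Matrix.single (l x) (r x) (1 : ℂ) * j).prod
      = (∏ x : Fin L, (j * j.conjTranspose) (r x.castSucc) (l x.succ))
        • (j.conjTranspose * Matrix.single (l 0) (r (Fin.last L)) (1 : ℂ) * j) := by
  induction L with
  | zero => simp
  | succ L ih =>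
    rw [List.ofFn_succ, List.prod_cons, ih (fun x => l x.succ) fun x => r x.succ,
      Fin.prod_univ_succ, Matrix.mul_smul, mul_smul, smul_comm]
    congr 1
    have h : ∀ (x y z w : b) (N : Matrix b b ℂ), Matrix.single x y (1 : ℂ) * N * Matrix.single z w 1
        = N y z • Matrix.single x w 1 := fun x y z w N => by
      rw [Matrix.single_mul_mul_single, one_mul, mul_one, Matrix.smul_single, smul_eq_mul, mul_one]
    calc _ = j.conjTranspose * (Matrix.single (l 0) (r 0) (1 : ℂ) * (j * j.conjTranspose)
          * Matrix.single (l (Fin.succ 0)) (r (Fin.last L).succ) (1 : ℂ)) * j := by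
          simp only [Matrix.mul_assoc]
      _ = _ := by
          rw [h, Matrix.mul_smul, Matrix.smul_mul]
          rfl

/-- Pairing of the right index of every site with the left index of the next site. -/
def bondConf (e : Fin d ≃ b × b) (L : ℕ) : (Fin L → Fin d) ≃ (Fin L → b × b) where
  toFun s y := ((e (s y)).2, (e (s (finRotate L y))).1)
  invFun β y := e.symm ((β ((finRotate L).symm y)).2, (β y).1)
  left_inv s := by funext y; simp only [Equiv.apply_symm_apply, Prod.mk.eta, Equiv.symm_apply_apply]
  right_inv β := by
    funext y
    simp only [Equiv.apply_symm_apply, Prod.mk.eta, Equiv.symm_apply_apply]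

/-- The matrix product state of `bondTensor` is the product over the bonds of the state given by the
matrix `j j†`. -/
theorem mps_bondTensor {L : ℕ} (hL : 0 < L) (s : Fin L → Fin d) :
    mps (bondTensor e j) L s
      = ∏ y, (j * j.conjTranspose) (bondConf e L s y).1 (bondConf e L s y).2 := by
  obtain ⟨n, rfl⟩ := Nat.exists_eq_succ_of_ne_zero hL.ne'
  have h := prod_bondTensor j n (fun x => (e (s x)).1) fun x => (e (s x)).2
  have ht : ∀ x y : b, (j.conjTranspose * Matrix.single x y (1 : ℂ) * j).trace
      = (j * j.conjTranspose) y x := fun x y => by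
    rw [Matrix.mul_assoc, Matrix.trace_mul_comm, Matrix.mul_assoc, Matrix.trace_single_mul,
      one_smul]
  rw [mps]
  change (List.ofFn fun x => j.conjTranspose * Matrix.single (e (s x)).1 (e (s x)).2 (1 : ℂ)
    * j).prod.trace = _
  rw [h, Matrix.trace_smul, ht, Fin.prod_univ_castSucc, smul_eq_mul]
  simp only [bondConf, Equiv.coe_fn_mk, finRotate_apply, Fin.coeSucc_eq_succ,
    Fin.last_add_one]

end Bond

/-! ### A circuit that changes the states of the bonds -/

section Gate

variable {G : Type} [Group G] {b : Type} {d D D' : ℕ}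

theorem val_finRotate {L : ℕ} (y : Fin L) : (finRotate L y).val = (y.val + 1) % L := by
  cases L with
  | zero => exact y.elim0
  | succ n => rw [finRotate_apply, Fin.val_add]; simp

theorem finRotate_pairFst {M : ℕ} (t : ℕ) (x : Fin M) :
    finRotate (2 * M) (pairFst t x) = pairSnd t x := by
  apply Fin.ext
  rw [val_finRotate]
  rfl

theorem finRotate_pairSnd {M : ℕ} (t : ℕ) (x : Fin M) :
    finRotate (2 * M) (pairSnd t x) = pairFst t (finRotate M x) := by
  apply Fin.ext
  rw [val_finRotate]
  simp only [pairFst, pairSnd, val_finRotate]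
  have := x.isLt
  have ht := Nat.mod_lt t (by norm_num : 0 < 2)
  rw [Nat.mod_add_mod]
  rcases Nat.lt_or_ge (x.val + 1) M with h | h
  · rw [Nat.mod_eq_of_lt h, Nat.mod_eq_of_lt (by omega)]
    omega
  · have hM : M = x.val + 1 := by omega
    have : 2 * x.val + t % 2 + 1 + 1 = t % 2 + 2 * M := by omega
    rw [this, Nat.add_mod_right, ← hM, Nat.mod_self, Nat.mod_eq_of_lt (by omega)]
    omega

/-- The four virtual indices of two neighbouring sites: the outer ones, and those of the bond
between the two sites. -/
def pairBonds (e : Fin d ≃ b × b) : Fin d × Fin d ≃ (b × b) × (b × b) where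
  toFun p := (((e p.1).1, (e p.2).2), ((e p.1).2, (e p.2).1))
  invFun q := (e.symm (q.1.1, q.2.1), e.symm (q.2.2, q.1.2))
  left_inv p := by simp
  right_inv q := by simp

variable [Fintype b] [DecidableEq b]

/-- The two-site gate that acts by `h` on the bond between the sites. -/
def bondGate (e : Fin d ≃ b × b) (h : Matrix (b × b) (b × b) ℂ) :
    Matrix (Fin d × Fin d) (Fin d × Fin d) ℂ :=
  ((1 : Matrix (b × b) (b × b) ℂ) ⊗ₖ h).submatrix (pairBonds e) (pairBonds e)

omit [Fintype b] in
/-- Layer `t` acts on the bonds of parity `t`. -/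
theorem pairOp_bondGate (e : Fin d ≃ b × b) (h : Matrix (b × b) (b × b) ℂ) (M t : ℕ) :
    pairOp t (fun _ : Fin M => bondGate e h)
      = (siteOp fun y : Fin (2 * M) => if y.val % 2 = t % 2 then h else 1).submatrix
        (bondConf e (2 * M)) (bondConf e (2 * M)) := by
  ext s r
  have ht := Nat.mod_lt t (by norm_num : 0 < 2)
  have h1 : ∀ x : Fin M, (pairFst t x).val % 2 = t % 2 := fun x => by
    simp only [pairFst]; omega
  have h2 : ∀ x : Fin M, (pairSnd t x).val % 2 ≠ t % 2 := fun x => by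
    simp only [pairSnd]
    rw [Nat.mod_mul_right_mod]
    omega
  have hone : ∀ x y x' y' : b, (1 : Matrix (b × b) (b × b) ℂ) (x, y) (x', y')
      = (1 : Matrix b b ℂ) x x' * (1 : Matrix b b ℂ) y y' := fun x y x' y' => by
    rw [← Matrix.one_kronecker_one, Matrix.kroneckerMap_apply]
  simp only [pairOp, siteOp, Matrix.submatrix_apply, Matrix.of_apply]
  rw [prod_pairs t]
  simp only [h1, h2, if_true, if_false, bondConf, Equiv.coe_fn_mk, finRotate_pairFst,
    finRotate_pairSnd, bondGate, Matrix.submatrix_apply, Matrix.kroneckerMap_apply, pairConf,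
    pairBonds, hone, Finset.prod_mul_distrib]
  rw [Equiv.prod_comp (finRotate M) fun x => (1 : Matrix b b ℂ) (e (s (pairFst t x))).1
    (e (r (pairFst t x))).1]
  ring

theorem siteOp_mulVec_prod {ι : Type} [Fintype ι] [DecidableEq ι] {a c : Type} [Fintype a]
    (F : ι → Matrix c a ℂ) (f : ι → a → ℂ) :
    (siteOp F).mulVec (fun β => ∏ y, f y (β y)) = fun β => ∏ y, (F y).mulVec (f y) (β y) := by
  funext β
  simp only [Matrix.mulVec, dotProduct, siteOp, Matrix.of_apply, ← Finset.prod_mul_distrib]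
  rw [Finset.prod_univ_sum, Fintype.piFinset_univ]

/-- The product of the states `f y` of the bonds `y`. -/
def bondState (e : Fin d ≃ b × b) {L : ℕ} (f : Fin L → b × b → ℂ) : (Fin L → Fin d) → ℂ :=
  fun s => ∏ y, f y (bondConf e L s y)

theorem bondGate_mulVec_bondState (e : Fin d ≃ b × b) (h : Matrix (b × b) (b × b) ℂ) (M t : ℕ)
    (f : Fin (2 * M) → b × b → ℂ) :
    (pairOp t (fun _ : Fin M => bondGate e h)).mulVec (bondState e f)
      = bondState e fun y => (if y.val % 2 = t % 2 then h else 1).mulVec (f y) := by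
  have h1 : bondState e f ∘ (bondConf e (2 * M)).symm = fun β => ∏ y, f y (β y) := by
    funext β
    simp only [bondState, Function.comp_apply, Equiv.apply_symm_apply]
  rw [pairOp_bondGate, Matrix.submatrix_mulVec_equiv, h1, siteOp_mulVec_prod]
  rfl

/-- Layer `0` followed by layer `1` changes the states of all bonds. -/
theorem bondGate_mulVec_const (e : Fin d ≃ b × b) {h : Matrix (b × b) (b × b) ℂ} {r : ℂ}
    {Φ Φ' : b × b → ℂ} (hΦ : h.mulVec Φ = r • Φ') (M : ℕ) :
    (pairOp 1 (fun _ : Fin M => bondGate e h)).mulVec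
      ((pairOp 0 fun _ : Fin M => bondGate e h).mulVec (bondState e fun _ => Φ))
      = r ^ (2 * M) • bondState e fun _ => Φ' := by
  rw [bondGate_mulVec_bondState, bondGate_mulVec_bondState]
  funext s
  have hr : r ^ (2 * M) = ∏ _y : Fin (2 * M), r := by simp
  simp only [bondState, Pi.smul_apply, smul_eq_mul]
  rw [hr, ← Finset.prod_mul_distrib]
  refine Finset.prod_congr rfl fun y _ => ?_
  rcases Nat.mod_two_eq_zero_or_one y.val with h0 | h0
  · simp only [h0, Nat.zero_mod, Nat.one_mod, zero_ne_one, if_true, if_false, hΦ,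
      Matrix.one_mulVec]
    rfl
  · simp only [h0, Nat.zero_mod, Nat.one_mod, one_ne_zero, if_true, if_false, hΦ,
      Matrix.one_mulVec]
    rfl

theorem mps_bondTensor_eq_bondState {e : Fin d ≃ b × b} (j : Matrix b (Fin D) ℂ) {L : ℕ}
    (hL : 0 < L) : mps (bondTensor e j) L
      = bondState e fun _ p => (j * j.conjTranspose) p.1 p.2 :=
  funext fun s => mps_bondTensor hL s

/-- The reflection that exchanges two orthogonal directions. It commutes with all unitaries that fix
both vectors. -/
theorem exists_reflection {n : Type} [Fintype n] [DecidableEq n] {v w : n → ℂ} {p q : ℝ}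
    (hp : 0 < p) (hq : 0 < q) (hv : star v ⬝ᵥ v = p) (hw : star w ⬝ᵥ w = q)
    (hvw : star v ⬝ᵥ w = 0) :
    ∃ (h : Matrix n n ℂ) (r : ℝ), 0 < r ∧ h.conjTranspose * h = 1 ∧ h.mulVec v = (r : ℂ) • w ∧
      ∀ S : Matrix n n ℂ, S * S.conjTranspose = 1 → S.mulVec v = v → S.mulVec w = w →
        S * h * S.conjTranspose = h := by
  -- the factor `r` makes `v` and `r w` equally long; the mirror is orthogonal to `u = v - r w`
  obtain ⟨r, hr, hr2⟩ : ∃ r : ℝ, 0 < r ∧ r * r * q = p :=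
    ⟨√(p / q), Real.sqrt_pos.2 (div_pos hp hq), by
      rw [Real.mul_self_sqrt (div_pos hp hq).le, div_mul_cancel₀ _ hq.ne']⟩
  have hr2' : (r : ℂ) * r * q = p := by exact_mod_cast hr2
  have hp' : (p : ℂ) ≠ 0 := by exact_mod_cast hp.ne'
  have hwv : star w ⬝ᵥ v = 0 := by
    rw [Matrix.star_dotProduct, hvw, star_zero]
  have hsr : star (r : ℂ) = r := Complex.conj_ofReal r
  let u := v - (r : ℂ) • w
  have huv : star u ⬝ᵥ v = p := by
    simp only [u, star_sub, star_smul, sub_dotProduct, smul_dotProduct, hv, hwv, smul_zero,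
      sub_zero]
  have huu : star u ⬝ᵥ u = 2 * p := by
    have : star u ⬝ᵥ w = -(r * q) := by
      simp only [u, star_sub, star_smul, sub_dotProduct, smul_dotProduct, hw, hvw, hsr,
        smul_eq_mul, zero_sub]
    change star u ⬝ᵥ (v - (r : ℂ) • w) = _
    rw [dotProduct_sub, dotProduct_smul, huv, this, smul_eq_mul]
    linear_combination hr2'
  let Q := Matrix.vecMulVec u (star u)
  have hQ : Q * Q = (2 * p : ℂ) • Q := by
    rw [Matrix.vecMulVec_mul_vecMulVec, huu]
    ext i k
    simp [Q, Matrix.vecMulVec_apply]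
    ring
  have hQh : Q.conjTranspose = Q := by
    rw [Matrix.conjTranspose_vecMulVec, star_star]
  have hs : ((p : ℂ)⁻¹ • Q).conjTranspose = (p : ℂ)⁻¹ • Q := by
    rw [Matrix.conjTranspose_smul, hQh, star_inv₀]
    congr 2
    exact Complex.conj_ofReal p
  refine ⟨1 - (p : ℂ)⁻¹ • Q, r, hr, ?_, ?_, fun S hS hSv hSw => ?_⟩
  · rw [Matrix.conjTranspose_sub, Matrix.conjTranspose_one, hs, Matrix.sub_mul, Matrix.one_mul,
      Matrix.mul_sub, Matrix.mul_one, smul_mul_smul_comm, hQ, smul_smul]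
    have : (p : ℂ)⁻¹ * (p : ℂ)⁻¹ * (2 * p) = (p : ℂ)⁻¹ + (p : ℂ)⁻¹ := by field_simp; norm_num
    rw [this, add_smul]
    abel
  · rw [Matrix.sub_mulVec, Matrix.one_mulVec, Matrix.smul_mulVec, Matrix.vecMulVec_mulVec, huv]
    ext i
    simp [u, hp']
  · have hSu : S.mulVec u = u := by
      rw [Matrix.mulVec_sub, Matrix.mulVec_smul, hSv, hSw]
    rw [Matrix.mul_sub, Matrix.sub_mul, Matrix.mul_one, hS, Matrix.mul_smul, Matrix.smul_mul,
      mul_vecMulVec_star_mul, hSu]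

omit [DecidableEq b] in
/-- The action of a product operator on a matrix that is read as a vector. -/
theorem kronecker_mulVec_vec (P Q Φ : Matrix b b ℂ) :
    (Q ⊗ₖ P).mulVec (fun p => Φ p.1 p.2) = fun p => (Q * Φ * P.transpose) p.1 p.2 := by
  funext ⟨x, y⟩
  simp only [Matrix.mulVec, dotProduct, Fintype.sum_prod_type, Matrix.kroneckerMap_apply,
    Matrix.mul_apply, Matrix.transpose_apply, Finset.sum_mul]
  rw [Finset.sum_comm]
  exact Finset.sum_congr rfl fun _ _ => Finset.sum_congr rfl fun _ _ => by ring

/-- Two states of entangled bonds, whose bond states are invariant under the same symmetry and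
orthogonal to each other, are connected by a symmetric unitary circuit of depth two. -/
theorem mapsTo_bondTensor {e : Fin d ≃ b × b} {ω : Z2 G} {V : G → Matrix.unitaryGroup b ℂ}
    (hV : ∀ g h, (V g).val * (V h).val = phase ω g h • (V (g * h)).val)
    {j : Matrix b (Fin D) ℂ} {j' : Matrix b (Fin D') ℂ} (hD : 0 < D) (hD' : 0 < D')
    (hj : j.conjTranspose * j = 1) (hj' : j'.conjTranspose * j' = 1)
    (hjj' : j.conjTranspose * j' = 0) {W : G → Matrix.unitaryGroup (Fin D) ℂ}
    {W' : G → Matrix.unitaryGroup (Fin D') ℂ} (hW : ∀ g, (V g).val * j = j * (W g).val)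
    (hW' : ∀ g, (V g).val * j' = j' * (W' g).val) :
    MapsTo (pureMPO (bondRep e hV) (bondTensor e j)) (pureMPO (bondRep e hV) (bondTensor e j')) := by
  have hdot : ∀ X Y : Matrix b b ℂ, star (fun p : b × b => X p.1 p.2) ⬝ᵥ (fun p => Y p.1 p.2)
      = (X.conjTranspose * Y).trace := fun X Y => by
    simp only [dotProduct, Fintype.sum_prod_type, Matrix.trace, Matrix.diag_apply,
      Matrix.mul_apply, Matrix.conjTranspose_apply, Pi.star_apply]
    rw [Finset.sum_comm]
  have hself : ∀ {D : ℕ} {j : Matrix b (Fin D) ℂ}, j.conjTranspose * j = 1 →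
      ((j * j.conjTranspose).conjTranspose * (j * j.conjTranspose)).trace = ((D : ℝ) : ℂ) :=
    fun {D j} hj => by
      rw [Matrix.conjTranspose_mul, Matrix.conjTranspose_conjTranspose, Matrix.mul_assoc,
        ← Matrix.mul_assoc j.conjTranspose, hj, Matrix.one_mul, Matrix.trace_mul_comm, hj]
      simp
  obtain ⟨h, r, hr, hh, hhv, hS⟩ := exists_reflection (p := D) (q := D')
    (v := fun p : b × b => (j * j.conjTranspose) p.1 p.2)
    (w := fun p : b × b => (j' * j'.conjTranspose) p.1 p.2) (by exact_mod_cast hD)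
    (by exact_mod_cast hD') ((hdot _ _).trans (hself hj)) ((hdot _ _).trans (hself hj')) (by
      rw [hdot, Matrix.conjTranspose_mul, Matrix.conjTranspose_conjTranspose, Matrix.mul_assoc,
        ← Matrix.mul_assoc j.conjTranspose, hjj', Matrix.zero_mul, Matrix.mul_zero,
        Matrix.trace_zero])
  have hinv : ∀ {D : ℕ} {j : Matrix b (Fin D) ℂ} {W : G → Matrix.unitaryGroup (Fin D) ℂ},
      (∀ g, (V g).val * j = j * (W g).val) → ∀ g,
      ((V g).val ⊗ₖ (V g).val.map star).mulVec (fun p => (j * j.conjTranspose) p.1 p.2)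
        = fun p => (j * j.conjTranspose) p.1 p.2 := fun {D j W} hW g => by
    rw [kronecker_mulVec_vec]
    have h1 : ((V g).val.map star).transpose = (V g).val.conjTranspose := rfl
    have h2 : (V g).val * (j * j.conjTranspose) * (V g).val.conjTranspose
        = j * j.conjTranspose := by
      calc _ = ((V g).val * j) * ((V g).val * j).conjTranspose := by
            rw [Matrix.conjTranspose_mul]; simp only [Matrix.mul_assoc]
        _ = j * ((W g).val * star (W g).val) * j.conjTranspose := by
            rw [hW, Matrix.conjTranspose_mul, Matrix.star_eq_conjTranspose]
            simp only [Matrix.mul_assoc]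
        _ = _ := by rw [Matrix.mem_unitaryGroup_iff.1 (W g).2, Matrix.mul_one]
    rw [h1, h2]
  have hVV : ∀ g, (V g).val * (V g).val.conjTranspose = 1 := fun g =>
    Matrix.mem_unitaryGroup_iff.1 (V g).2
  have hVV' : ∀ g, (V g).val.map star * ((V g).val.map star).conjTranspose = 1 := fun g => by
    have h1 : (V g).val.map star * ((V g).val.map star).conjTranspose
        = ((V g).val * (V g).val.conjTranspose).map star :=
      (Matrix.map_mul (f := starRingEnd ℂ)).symm
    rw [h1, hVV, Matrix.map_one _ (star_zero _) (star_one _)]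
  have hrep : ∀ g, pairRep (bondRep e hV) g = (((V g).val.map star ⊗ₖ (V g).val)
      ⊗ₖ ((V g).val ⊗ₖ (V g).val.map star)).submatrix (pairBonds e) (pairBonds e) := fun g => by
    ext ⟨x, y⟩ ⟨x', y'⟩
    change (V g).val.map star (e x).1 (e x').1 * (V g).val (e x).2 (e x').2
      * ((V g).val.map star (e y).1 (e y').1 * (V g).val (e y).2 (e y').2)
      = (V g).val.map star (e x).1 (e x').1 * (V g).val (e y).2 (e y').2
      * ((V g).val (e x).2 (e x').2 * (V g).val.map star (e y).1 (e y').1)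
    ring
  refine mapsTo_of_gate (H := bondGate e h) ?_ (fun g => ?_) fun M hM =>
    ⟨r ^ (2 * M), by positivity, ?_⟩
  · rw [bondGate, Matrix.conjTranspose_submatrix, Matrix.submatrix_mul_equiv,
      Matrix.conjTranspose_kronecker, ← Matrix.mul_kronecker_mul, hh, Matrix.conjTranspose_one,
      Matrix.one_mul, Matrix.one_kronecker_one, Matrix.submatrix_one_equiv]
  · have h1 := hS ((V g).val ⊗ₖ (V g).val.map star) (by
      rw [Matrix.conjTranspose_kronecker, ← Matrix.mul_kronecker_mul, hVV, hVV',
        Matrix.one_kronecker_one]) (hinv hW g) (hinv hW' g)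
    rw [hrep, bondGate, Matrix.conjTranspose_submatrix, Matrix.submatrix_mul_equiv,
      Matrix.submatrix_mul_equiv, Matrix.conjTranspose_kronecker, ← Matrix.mul_kronecker_mul,
      ← Matrix.mul_kronecker_mul, h1, Matrix.mul_one, Matrix.conjTranspose_kronecker,
      ← Matrix.mul_kronecker_mul, hVV, hVV', Matrix.one_kronecker_one]
  · rw [mps_bondTensor_eq_bondState j (by omega), mps_bondTensor_eq_bondState j' (by omega),
      Complex.ofReal_pow]
    exact bondGate_mulVec_const e hhv M

end Gate

/-! ### Equivalence of pure states with the same gauge -/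

section Related

variable {G : Type} [Group G] {D : ℕ}

/-- The equivalence relation of `oneWaySetoid`: generated by one-way connections and by deformations
of pure states. -/
def Related (ρ ρ' : PurifiableMPDO G) : Prop :=
  Relation.EqvGen (fun ρ ρ' : PurifiableMPDO G =>
    MapsTo ρ.1 ρ'.1 ∨ MapsTo ρ'.1 ρ.1 ∨ PureDeformation ρ.1 ρ'.1) ρ ρ'

theorem Related.of_mapsTo {ρ ρ' : PurifiableMPDO G} (h : MapsTo ρ.1 ρ'.1) : Related ρ ρ' :=
  .rel _ _ (.inl h)

theorem Related.symm {ρ ρ' : PurifiableMPDO G} (h : Related ρ ρ') : Related ρ' ρ :=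
  Relation.EqvGen.symm _ _ h

theorem Related.trans {ρ ρ' ρ'' : PurifiableMPDO G} (h : Related ρ ρ') (h' : Related ρ' ρ'') :
    Related ρ ρ'' :=
  Relation.EqvGen.trans _ _ _ h h'

/-- Channels preserve the trace, so the transfer matrix of the image of a pure state under an onsite
channel is that of the pure state. -/
theorem transferOp_kraus {κ ι ι' n : Type} [Fintype κ] [Fintype ι] [Fintype ι'] [DecidableEq ι]
    {K : κ → Matrix ι' ι ℂ} (hK : ∑ k, (K k).conjTranspose * K k = 1) (B : ι → Matrix n n ℂ) :
    ∑ i, ∑ k, act (K k) B i ⊗ₖ (act (K k) B i).map star = transferOp B := by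
  have h : ∀ p q : ι, ∑ i, superOp K (i, i) (p, q) = (1 : Matrix ι ι ℂ) q p := fun p q => by
    rw [← hK]
    simp only [superOp, Matrix.of_apply, Matrix.sum_apply, Matrix.mul_apply,
      Matrix.conjTranspose_apply]
    rw [Finset.sum_comm]
    exact Finset.sum_congr rfl fun _ _ => Finset.sum_congr rfl fun _ _ => mul_comm _ _
  calc _ = ∑ i, act (superOp K) (fun q : ι × ι => B q.1 ⊗ₖ (B q.2).map star) (i, i) :=
        Finset.sum_congr rfl fun i _ => (act_superOp K B (i, i)).symm
    _ = ∑ q : ι × ι, (1 : Matrix ι ι ℂ) q.2 q.1 • (B q.1 ⊗ₖ (B q.2).map star) := by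
        simp only [act]
        rw [Finset.sum_comm]
        exact Finset.sum_congr rfl fun q _ => by rw [← Finset.sum_smul, h]
    _ = _ := by
        simp [Fintype.sum_prod_type, Matrix.one_apply, ite_smul, transferOp]

theorem transferOp_act {ι ι' n : Type} [Fintype ι] [Fintype ι'] [DecidableEq ι]
    {W : Matrix ι' ι ℂ} (hW : W.conjTranspose * W = 1) (B : ι → Matrix n n ℂ) :
    transferOp (act W B) = transferOp B := by
  rw [← transferOp_kraus (κ := Fin 1) (K := fun _ => W) (by rw [Fin.sum_univ_one, hW]) B]
  exact Finset.sum_congr rfl fun i _ => by rw [Fin.sum_univ_one]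

theorem Spans.of_act {ι κ n : Type} [Fintype ι] {A : ι → Matrix n n ℂ} {O : Matrix κ ι ℂ}
    (h : Spans (act O A)) : Spans A := by
  rw [Spans, eq_top_iff, ← h, Submodule.span_le]
  rintro _ ⟨i, rfl⟩
  exact Submodule.sum_mem _ fun j _ => Submodule.smul_mem _ _ (Submodule.subset_span ⟨j, rfl⟩)

theorem Spans.smul {ι n : Type} {A : ι → Matrix n n ℂ} (h : Spans A) {r : ℂ} (hr : r ≠ 0) :
    Spans fun i => r • A i := by
  rw [Spans, eq_top_iff, ← h, Submodule.span_le]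
  rintro _ ⟨i, rfl⟩
  have : A i = r⁻¹ • r • A i := by rw [smul_smul, inv_mul_cancel₀ hr, one_smul]
  rw [this]
  exact Submodule.smul_mem _ _ (Submodule.subset_span ⟨i, rfl⟩)

/-- An injective tensor, whose transfer matrix has a unique eigenvalue of largest modulus, with a
symmetry in a unitary gauge: `U(g)` acts on the tensor as the phase `c(g)` and the conjugation by
`V(g)`. -/
structure IsGauge {d : ℕ} (U : G →* Matrix.unitaryGroup (Fin d) ℂ)
    (A : Fin d → Matrix (Fin D) (Fin D) ℂ) (V : G → Matrix.unitaryGroup (Fin D) ℂ)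
    (c : G → Circle) : Prop where
  bond_pos : 0 < D
  spans : Spans A
  uniqueLargest : UniqueLargest (transferOp A)
  act_eq : ∀ g, act (U g).val A
    = fun i => (c g : ℂ) • ((V g).val.conjTranspose * A i * (V g).val)

variable {d d' : ℕ} {U : G →* Matrix.unitaryGroup (Fin d) ℂ}
  {A : Fin d → Matrix (Fin D) (Fin D) ℂ} {V : G → Matrix.unitaryGroup (Fin D) ℂ} {c : G → Circle}

theorem symmetricMPS_of_unitary_gauge (h : ∀ g, act (U g).val A
    = fun i => (c g : ℂ) • ((V g).val.conjTranspose * A i * (V g).val)) :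
    SymmetricMPS A fun g => (U g).val :=
  symmetricMPS_of_gauge (V := fun g => Unitary.toUnits (V g)) fun g i => congrFun (h g) i

/-- The density operator of a pure state with a unitary gauge. -/
def IsGauge.node (h : IsGauge U A V c) : PurifiableMPDO G :=
  pureNode U A h.bond_pos h.spans (symmetricMPS_of_unitary_gauge h.act_eq) h.uniqueLargest

/-- Multiplication of the representation by a character. -/
theorem exists_twist (U : G →* Matrix.unitaryGroup (Fin d) ℂ) {c : G → Circle}
    (hc : ∀ g h, c (g * h) = c g * c h) :
    ∃ U' : G →* Matrix.unitaryGroup (Fin d) ℂ, ∀ g, (U' g).val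
      = (((c g)⁻¹ : Circle) : ℂ) • (U g).val := by
  refine ⟨MonoidHom.mk' (fun g => ⟨(((c g)⁻¹ : Circle) : ℂ) • (U g).val, ?_⟩) fun g h => ?_,
    fun g => rfl⟩
  · rw [Matrix.mem_unitaryGroup_iff, star_smul, smul_mul_smul_comm,
      Matrix.mem_unitaryGroup_iff.1 (U g).2]
    have : (((c g)⁻¹ : Circle) : ℂ) * star (((c g)⁻¹ : Circle) : ℂ) = 1 := by
      rw [RCLike.star_def, Complex.mul_conj', Circle.norm_coe]
      simp
    rw [this, one_smul]
  · apply Subtype.ext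
    change (((c (g * h))⁻¹ : Circle) : ℂ) • (U (g * h)).val
      = ((((c g)⁻¹ : Circle) : ℂ) • (U g).val) * ((((c h)⁻¹ : Circle) : ℂ) • (U h).val)
    rw [smul_mul_smul_comm, map_mul, hc, mul_inv, Circle.coe_mul]
    rfl

theorem fromBlocks_mem_unitaryGroup {n m : Type} [Fintype n] [DecidableEq n] [Fintype m]
    [DecidableEq m] (u : Matrix.unitaryGroup n ℂ) (v : Matrix.unitaryGroup m ℂ) :
    Matrix.fromBlocks u.val 0 0 v.val ∈ Matrix.unitaryGroup (n ⊕ m) ℂ := by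
  rw [Matrix.mem_unitaryGroup_iff, Matrix.star_eq_conjTranspose, Matrix.fromBlocks_conjTranspose,
    Matrix.fromBlocks_multiply]
  have hu := Matrix.mem_unitaryGroup_iff.1 u.2
  have hv := Matrix.mem_unitaryGroup_iff.1 v.2
  rw [Matrix.star_eq_conjTranspose] at hu hv
  simp [hu, hv]

/-- The direct sum of two representations, with the inclusions of the summands. -/
theorem exists_directSum (U : G →* Matrix.unitaryGroup (Fin d) ℂ)
    (U' : G →* Matrix.unitaryGroup (Fin d') ℂ) :
    ∃ (R : G →* Matrix.unitaryGroup (Fin (d + d')) ℂ) (W : Matrix (Fin (d + d')) (Fin d) ℂ)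
      (W' : Matrix (Fin (d + d')) (Fin d') ℂ), W.conjTranspose * W = 1 ∧
      W'.conjTranspose * W' = 1 ∧ W.conjTranspose * W' = 0 ∧
      (∀ g, (R g).val * W = W * (U g).val) ∧ ∀ g, (R g).val * W' = W' * (U' g).val := by
  let f : Fin (d + d') ≃ Fin d ⊕ Fin d' := finSumFinEquiv.symm
  refine ⟨MonoidHom.mk' (fun g => ⟨(Matrix.fromBlocks (U g).val 0 0 (U' g).val).submatrix f f, ?_⟩)
    fun g h => ?_, (Matrix.fromRows 1 0).submatrix f id, (Matrix.fromRows 0 1).submatrix f id,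
    ?_, ?_, ?_, fun g => ?_, fun g => ?_⟩
  · have h := Matrix.mem_unitaryGroup_iff.1 (fromBlocks_mem_unitaryGroup (U g) (U' g))
    rw [Matrix.star_eq_conjTranspose] at h
    rw [Matrix.mem_unitaryGroup_iff, Matrix.star_eq_conjTranspose, Matrix.conjTranspose_submatrix,
      Matrix.submatrix_mul_equiv, h, Matrix.submatrix_one_equiv]
  · apply Subtype.ext
    change Matrix.submatrix _ _ _ = Matrix.submatrix _ _ _ * Matrix.submatrix _ _ _
    rw [Matrix.submatrix_mul_equiv, Matrix.fromBlocks_multiply, map_mul, map_mul]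
    simp
  · rw [Matrix.conjTranspose_submatrix, Matrix.submatrix_mul_equiv,
      Matrix.conjTranspose_fromRows_eq_fromCols_conjTranspose, Matrix.fromCols_mul_fromRows]
    simp
  · rw [Matrix.conjTranspose_submatrix, Matrix.submatrix_mul_equiv,
      Matrix.conjTranspose_fromRows_eq_fromCols_conjTranspose, Matrix.fromCols_mul_fromRows]
    simp
  · rw [Matrix.conjTranspose_submatrix, Matrix.submatrix_mul_equiv,
      Matrix.conjTranspose_fromRows_eq_fromCols_conjTranspose, Matrix.fromCols_mul_fromRows]
    simp
  · change Matrix.submatrix _ _ _ * Matrix.submatrix _ _ _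
      = Matrix.submatrix _ _ _ * (U g).val.submatrix (Equiv.refl _) id
    rw [Matrix.submatrix_mul_equiv]
    change _ = Matrix.submatrix _ _ (Equiv.refl _) * _
    rw [Matrix.submatrix_mul_equiv, Matrix.fromBlocks_mul_fromRows, Matrix.fromRows_mul]
    simp
  · change Matrix.submatrix _ _ _ * Matrix.submatrix _ _ _
      = Matrix.submatrix _ _ _ * (U' g).val.submatrix (Equiv.refl _) id
    rw [Matrix.submatrix_mul_equiv]
    change _ = Matrix.submatrix _ _ (Equiv.refl _) * _
    rw [Matrix.submatrix_mul_equiv, Matrix.fromBlocks_mul_fromRows, Matrix.fromRows_mul]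
    simp

/-- An onsite isometry that intertwines the symmetries up to phases does not change the virtual
symmetry. -/
theorem act_isometry_gauge {U' : G →* Matrix.unitaryGroup (Fin d') ℂ} {W : Matrix (Fin d') (Fin d) ℂ}
    {c c' : G → Circle} (h : ∀ g, act (U g).val A
      = fun i => (c g : ℂ) • ((V g).val.conjTranspose * A i * (V g).val))
    (hW : ∀ g, (U' g).val * W = (((c' g) : Circle) : ℂ) • (W * (U g).val)) (g : G) :
    act (U' g).val (act W A)
      = fun i => ((c' g * c g : Circle) : ℂ) • ((V g).val.conjTranspose * act W A i * (V g).val) := by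
  rw [act_act, hW, smul_act, ← act_act, h, act_smul, act_mul_mul]
  funext i
  rw [smul_smul, Circle.coe_mul]

/-- Two pure states with the same gauge on the virtual space are equivalent: both are embedded
into the direct sum of the local spaces, where the segment between the two tensors is a path of
symmetric injective tensors. -/
theorem IsGauge.related {U' : G →* Matrix.unitaryGroup (Fin d') ℂ}
    {A' : Fin d' → Matrix (Fin D) (Fin D) ℂ} (hc : ∀ g h, c (g * h) = c g * c h)
    (h : IsGauge U A V c) (h' : IsGauge U' A' V 1) : Related h.node h'.node := by
  -- the character `c` is absorbed in the local representation, because along the path both tensors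
  -- have to transform in the same way
  obtain ⟨T, hT⟩ := exists_twist U hc
  obtain ⟨R, W, W', hW, hW', hWW', hR, hR'⟩ := exists_directSum T U'
  have hRW : ∀ g, (R g).val * W = (((c g)⁻¹ : Circle) : ℂ) • (W * (U g).val) := fun g => by
    rw [hR, hT, Matrix.mul_smul]
  have hRW' : ∀ g, (R g).val * W' = ((1 : Circle) : ℂ) • (W' * (U' g).val) := fun g => by
    rw [hR', Circle.coe_one, one_smul]
  have g₁ : ∀ g, act (R g).val (act W A)
      = fun i => ((1 : Circle) : ℂ) • ((V g).val.conjTranspose * act W A i * (V g).val) :=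
    fun g => by rw [act_isometry_gauge (c' := fun g => (c g)⁻¹) h.act_eq hRW g, inv_mul_cancel]
  have g₂ : ∀ g, act (R g).val (act W' A')
      = fun i => ((1 : Circle) : ℂ) • ((V g).val.conjTranspose * act W' A' i * (V g).val) :=
    fun g => by rw [act_isometry_gauge (c' := fun _ => 1) h'.act_eq hRW' g, Pi.one_apply, mul_one]
  have hinj : ∀ {d₁ d₂ : ℕ} {W : Matrix (Fin d₂) (Fin d₁) ℂ}, W.conjTranspose * W = 1 →
      Function.Injective W.mulVec := fun {d₁ d₂ W} hW x y hxy => by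
    have := congrArg W.conjTranspose.mulVec hxy
    rwa [Matrix.mulVec_mulVec, Matrix.mulVec_mulVec, hW, Matrix.one_mulVec,
      Matrix.one_mulVec] at this
  have n₁ : IsGauge R (act W A) V 1 := ⟨h.bond_pos, h.spans.act_of_injective (hinj hW),
    by rw [transferOp_act hW]; exact h.uniqueLargest, g₁⟩
  have n₂ : IsGauge R (act W' A') V 1 := ⟨h.bond_pos, h'.spans.act_of_injective (hinj hW'),
    by rw [transferOp_act hW']; exact h'.uniqueLargest, g₂⟩
  have e₁ : Related h.node n₁.node := .of_mapsTo (mapsTo_of_isometry hW ⟨_, hRW⟩)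
  have e₂ : Related h'.node n₂.node := .of_mapsTo (mapsTo_of_isometry hW' ⟨_, hRW'⟩)
  refine (e₁.trans (.rel _ _ (.inr (.inr ?_)))).trans e₂.symm
  let P : unitInterval → Fin (d + d') → Matrix (Fin D) (Fin D) ℂ := fun s i =>
    (1 - (s : ℝ) : ℂ) • act W A i + ((s : ℝ) : ℂ) • act W' A' i
  have hact : ∀ {m : ℕ} (O : Matrix (Fin m) (Fin (d + d')) ℂ) s i, act O (P s) i
      = (1 - (s : ℝ) : ℂ) • act O (act W A) i + ((s : ℝ) : ℂ) • act O (act W' A') i :=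
    fun {m} O s i => by
      have h1 := congrFun (act_smul O (1 - (s : ℝ) : ℂ) (act W A)) i
      have h2 := congrFun (act_smul O ((s : ℝ) : ℂ) (act W' A')) i
      rw [← h1, ← h2]
      simp only [act, P, smul_add, Finset.sum_add_distrib]
  have hWW'' : W'.conjTranspose * W = 0 := by
    rw [← Matrix.conjTranspose_conjTranspose W, ← Matrix.conjTranspose_mul, hWW',
      Matrix.conjTranspose_zero]
  have hzero : ∀ {m n : ℕ} (C : Fin n → Matrix (Fin D) (Fin D) ℂ) (i : Fin m),
      act (0 : Matrix (Fin m) (Fin n) ℂ) C i = 0 := fun C i => by simp [act]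
  refine ⟨d + d', D, R, P, ?_, fun s => ⟨(injectiveTensor_iff_spans _).2 ?_,
    symmetricMPS_of_unitary_gauge (V := V) (c := 1) fun g => ?_⟩, ?_, ?_⟩
  · refine continuous_pi fun i => ?_
    exact ((continuous_const.sub (Complex.continuous_ofReal.comp continuous_subtype_val)).smul
      continuous_const).add
      ((Complex.continuous_ofReal.comp continuous_subtype_val).smul continuous_const)
  -- the component in one of the two summands is a nonzero multiple of an injective tensor
  · by_cases hs : ((s : ℝ) : ℂ) = 0
    · refine Spans.of_act (O := W.conjTranspose) ?_
      have : act W.conjTranspose (P s) = A := by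
        funext i
        rw [hact, act_act, hW, act_one, hs, sub_zero, one_smul, zero_smul, add_zero]
      rw [this]
      exact h.spans
    · refine Spans.of_act (O := W'.conjTranspose) ?_
      have : act W'.conjTranspose (P s) = fun i => ((s : ℝ) : ℂ) • A' i := by
        funext i
        rw [hact, act_act, act_act, hW', act_one, hWW'', hzero, smul_zero, zero_add]
      rw [this]
      exact h'.spans.smul hs
  · funext i
    rw [hact, g₁, g₂]
    simp only [P, Circle.coe_one, one_smul, Pi.one_apply, Matrix.mul_add, Matrix.add_mul,
      Matrix.mul_smul, Matrix.smul_mul]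
  · have : P 0 = act W A := by funext i; simp [P]
    rw [this]
    rfl
  · have : P 1 = act W' A' := by funext i; simp [P]
    rw [this]
    rfl

/-- Every strong injective MPDO with strong symmetry and a local purification is the image of a
pure state whose virtual representation is unitary. -/
theorem PurifiableMPDO.exists_gauge (ρ : PurifiableMPDO G) {ω : Z2 G} (hω : ρ.1.InPhase ω) :
    ∃ (D : ℕ) (U : G →* Matrix.unitaryGroup (Fin (D * D)) ℂ)
      (B : Fin (D * D) → Matrix (Fin D) (Fin D) ℂ) (V : G → Matrix.unitaryGroup (Fin D) ℂ)
      (c : G → Circle) (h : IsGauge U B V c), (∀ g h, c (g * h) = c g * c h) ∧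
      (∀ g h, (V g).val * (V h).val = phase ω g h • (V (g * h)).val) ∧ Related h.node ρ := by
  obtain ⟨ρ, hρ, hs, e, D, A, hA⟩ := ρ
  have hD := hA.bond_pos hρ.bond_pos
  have hsp := hA.spans hρ.injective
  obtain ⟨S, S', V, c, hSS', hS'S, hV, hm⟩ := hsp.exists_unitary_gauge hD
    (ρ.purifiedRep_unitary e) (hω.isPureSPT hρ hs hA).sptClass
  have hA' : ρ.IsLocalPurification fun p => S' * A p * S := by
    obtain ⟨X, Y, hXY, hYX, h⟩ := hA
    have hstar : ∀ M N : Matrix (Fin D) (Fin D) ℂ, (M * N).map star = M.map star * N.map star :=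
      fun M N => Matrix.map_mul (f := starRingEnd ℂ)
    have hone : (1 : Matrix (Fin D) (Fin D) ℂ).map star = 1 :=
      Matrix.map_one _ (star_zero _) (star_one _)
    refine ⟨(S' ⊗ₖ S'.map star) * X, Y * (S ⊗ₖ S.map star), ?_, ?_, fun i j => ?_⟩
    · rw [Matrix.mul_assoc, ← Matrix.mul_assoc X, hXY, Matrix.one_mul, ← Matrix.mul_kronecker_mul,
        ← hstar, hS'S, hone, Matrix.one_kronecker_one]
    · rw [Matrix.mul_assoc, ← Matrix.mul_assoc (S ⊗ₖ _), ← Matrix.mul_kronecker_mul, ← hstar, hSS',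
        hone, Matrix.one_kronecker_one, Matrix.one_mul, hYX]
    · calc _ = (S' ⊗ₖ S'.map star) * (X * ρ.tensor i j * Y) * (S ⊗ₖ S.map star) := by
            simp only [Matrix.mul_assoc]
        _ = _ := by
            rw [h, Matrix.mul_sum, Matrix.sum_mul]
            refine Finset.sum_congr rfl fun k _ => ?_
            rw [hstar, hstar, ← Matrix.mul_kronecker_mul, ← Matrix.mul_kronecker_mul]
  obtain ⟨U, B, K, hB, hBsp, hK, hKB⟩ := hA'.exists_channel hρ.injective
    (V := fun g => Unitary.toUnits (V g)) hV
  have hact : ∀ g, act (U g).val B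
      = fun i => (c g : ℂ) • ((V g).val.conjTranspose * B i * (V g).val) := fun g =>
    funext fun i => hB g i
  -- the channel preserves the trace, so both states have the same transfer matrix up to conjugation
  have htr : ∃ (X : Matrix (Fin D × Fin D) (Fin ρ.χ) ℂ) (Y : Matrix (Fin ρ.χ) (Fin D × Fin D) ℂ),
      X * Y = 1 ∧ Y * X = 1 ∧ X * ρ.transfer * Y = transferOp B := by
    obtain ⟨X, Y, hXY, hYX, h⟩ := hA'
    refine ⟨X, Y, hXY, hYX, ?_⟩
    rw [MPO.transfer, Matrix.mul_sum, Matrix.sum_mul, ← transferOp_kraus hK.tracePreserving B]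
    refine Finset.sum_congr rfl fun i _ => (h i i).trans ?_
    exact Finset.sum_congr rfl fun k _ => by rw [hKB]
  obtain ⟨X, Y, hXY, hYX, hX⟩ := htr
  have hu : UniqueLargest (transferOp B) := by
    rw [← hX, uniqueLargest_conj hXY hYX]
    exact hρ.uniqueLargest
  have hg : IsGauge U B V c := ⟨hD, hBsp, hu, hact⟩
  have hmulU : ∀ g h, (U (g * h)).val = (U g).val * (U h).val := fun g h => by rw [map_mul]; rfl
  refine ⟨D, U, B, V, c, hg, fun g h => (hBsp.exists_mul_eq_smul hD hmulU hB g h).1, hm,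
    .of_mapsTo ?_⟩
  refine mapsTo_of_onsiteChannel (ρ := pureMPO U B) (K := K) hK fun L _ => ⟨1, one_pos, ?_⟩
  ext s t
  rw [Complex.ofReal_one, one_smul, pureMPO_state]
  refine Eq.trans ?_ (onsiteChannel_mpsDensity K B L s t).symm
  rw [ρ.state_eq_sum hA']
  simp only [hKB]
  exact (chain_sum_kronecker (fun i k => S' * A (i, k) * S) (fun i k => S' * A (i, k) * S) s t).symm

/-- The virtual symmetry of a state of entangled bonds is the subrepresentation on the range of
`j`. -/
theorem isGauge_bondTensor {b : Type} [Fintype b] [DecidableEq b] {e : Fin d ≃ b × b} {ω : Z2 G}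
    {V : G → Matrix.unitaryGroup b ℂ}
    (hV : ∀ g h, (V g).val * (V h).val = phase ω g h • (V (g * h)).val)
    {j : Matrix b (Fin D) ℂ} (hD : 0 < D) (hj : j.conjTranspose * j = 1)
    {W : G → Matrix.unitaryGroup (Fin D) ℂ} (hW : ∀ g, (V g).val * j = j * (W g).val) :
    IsGauge (bondRep e hV) (bondTensor e j) W 1 where
  bond_pos := hD
  spans := spans_bondTensor hj
  uniqueLargest := uniqueLargest_bondTensor hD hj
  act_eq g := by
    funext i
    rw [act_bondRep hV hW, Pi.one_apply, Circle.coe_one, one_smul]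

/-- Density operators in the same phase are equivalent. Both virtual representations are
contained in their direct sum, and the states of entangled bonds of the two summands are connected
by a circuit. -/
theorem related_of_inPhase {ρ ρ' : PurifiableMPDO G} {ω : Z2 G} (hω : ρ.1.InPhase ω)
    (hω' : ρ'.1.InPhase ω) : Related ρ ρ' := by
  obtain ⟨D, U, B, V, c, hg, hc, hm, hρ⟩ := ρ.exists_gauge hω
  obtain ⟨D', U', B', V', c', hg', hc', hm', hρ'⟩ := ρ'.exists_gauge hω'
  -- both projective representations have the same cocycle, so their direct sum is one too
  let T : G → Matrix.unitaryGroup (Fin D ⊕ Fin D') ℂ := fun g =>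
    ⟨Matrix.fromBlocks (V g).val 0 0 (V' g).val, fromBlocks_mem_unitaryGroup _ _⟩
  have hT : ∀ g h, (T g).val * (T h).val = phase ω g h • (T (g * h)).val := fun g h => by
    change Matrix.fromBlocks _ _ _ _ * Matrix.fromBlocks _ _ _ _
      = phase ω g h • Matrix.fromBlocks _ _ _ _
    rw [Matrix.fromBlocks_multiply, Matrix.fromBlocks_smul]
    simp [hm, hm']
  let j : Matrix (Fin D ⊕ Fin D') (Fin D) ℂ := Matrix.fromRows 1 0
  let j' : Matrix (Fin D ⊕ Fin D') (Fin D') ℂ := Matrix.fromRows 0 1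
  have hj : j.conjTranspose * j = 1 := by
    rw [Matrix.conjTranspose_fromRows_eq_fromCols_conjTranspose, Matrix.fromCols_mul_fromRows]
    simp
  have hj' : j'.conjTranspose * j' = 1 := by
    rw [Matrix.conjTranspose_fromRows_eq_fromCols_conjTranspose, Matrix.fromCols_mul_fromRows]
    simp
  have hjj' : j.conjTranspose * j' = 0 := by
    rw [Matrix.conjTranspose_fromRows_eq_fromCols_conjTranspose, Matrix.fromCols_mul_fromRows]
    simp
  have hTj : ∀ g, (T g).val * j = j * (V g).val := fun g => by
    change Matrix.fromBlocks _ _ _ _ * Matrix.fromRows _ _ = Matrix.fromRows _ _ * _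
    rw [Matrix.fromBlocks_mul_fromRows, Matrix.fromRows_mul]
    simp
  have hTj' : ∀ g, (T g).val * j' = j' * (V' g).val := fun g => by
    change Matrix.fromBlocks _ _ _ _ * Matrix.fromRows _ _ = Matrix.fromRows _ _ * _
    rw [Matrix.fromBlocks_mul_fromRows, Matrix.fromRows_mul]
    simp
  let e := (Fintype.equivFin ((Fin D ⊕ Fin D') × (Fin D ⊕ Fin D'))).symm
  have n := isGauge_bondTensor (e := e) hT hg.bond_pos hj hTj
  have n' := isGauge_bondTensor (e := e) hT hg'.bond_pos hj' hTj'
  have hnn' : Related n.node n'.node :=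
    .of_mapsTo (mapsTo_bondTensor hT hg.bond_pos hg'.bond_pos hj hj' hjj' hTj hTj')
  exact hρ.symm.trans ((hg.related hc n).trans (hnn'.trans ((hg'.related hc' n').symm.trans hρ')))

end Related

/-! ### The invariant of the equivalence relation -/

section Classification

variable {G : Type} [Group G]

theorem PurifiableMPDO.exists_inPhase (ρ : PurifiableMPDO G) : ∃ ω, ρ.1.InPhase ω := by
  obtain ⟨ρ, hρ, hs, e, D, A, hA⟩ := ρ
  obtain ⟨ω, h⟩ := hA.exists_class hρ hs
  exact ⟨ω, hA.inPhase h⟩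

/-- The class `[ω]` of the phase of a density operator. -/
def phaseClass (ρ : PurifiableMPDO G) : H2 G := cohClass ρ.exists_inPhase.choose

/-- Every density operator is in exactly one phase. -/
theorem inPhase_iff (ρ : PurifiableMPDO G) (ω : Z2 G) :
    ρ.1.InPhase ω ↔ phaseClass ρ = cohClass ω :=
  ⟨ρ.exists_inPhase.choose_spec.unique ρ.2.1, ρ.exists_inPhase.choose_spec.congr⟩

theorem Related.phaseClass_eq {ρ ρ' : PurifiableMPDO G} (h : Related ρ ρ') :
    phaseClass ρ = phaseClass ρ' := by
  induction h with
  | rel ρ ρ' h =>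
    have h₁ := ρ.exists_inPhase.choose_spec
    have h₂ := ρ'.exists_inPhase.choose_spec
    rcases h with h | h | h
    · exact (h.cohClass_eq ρ.2.1 ρ'.2.1 h₁ h₂).symm
    · exact h.cohClass_eq ρ'.2.1 ρ.2.1 h₂ h₁
    · exact h.cohClass_eq ρ.2.1 ρ.2.2.1 ρ'.2.1 ρ'.2.2.1 h₁ h₂
  | refl => rfl
  | symm _ _ _ ih => exact ih.symm
  | trans _ _ _ _ _ ih ih' => exact ih.trans ih'

theorem related_of_phaseClass_eq {ρ ρ' : PurifiableMPDO G} (h : phaseClass ρ = phaseClass ρ') :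
    Related ρ ρ' := by
  obtain ⟨ω, hω⟩ := ρ.exists_inPhase
  exact related_of_inPhase hω ((inPhase_iff ρ' ω).2 (h.symm.trans ((inPhase_iff ρ ω).1 hω)))

/-- The regular projective representation `V(g)|h⟩ = ω(g, h)|gh⟩` of a finite group. -/
theorem exists_regular [Finite G] (ω : Z2 G) :
    ∃ (n : ℕ) (V : G → Matrix.unitaryGroup (Fin n) ℂ), 0 < n ∧
      ∀ g h, (V g).val * (V h).val = phase ω g h • (V (g * h)).val := by
  classical
  obtain ⟨n, ⟨f⟩⟩ := Finite.exists_equiv_fin G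
  have : Fintype G := Fintype.ofFinite G
  let T : G → Matrix G G ℂ := fun g => Matrix.of fun x h => if x = g * h then phase ω g h else 0
  have hTu : ∀ g, (T g).conjTranspose * T g = 1 := fun g => by
    ext x y
    simp only [T, Matrix.mul_apply, Matrix.conjTranspose_apply, Matrix.of_apply, mul_ite, mul_zero,
      Finset.sum_ite_eq', Finset.mem_univ, if_true, mul_right_inj]
    rw [Matrix.one_apply]
    by_cases h : x = y
    · subst h
      have := Complex.conj_mul' (phase ω g x)
      rw [norm_phase] at this
      simpa using this
    · simp [h, Ne.symm h]
  have hT : ∀ g h, T g * T h = phase ω g h • T (g * h) := fun g h => by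
    ext x y
    simp only [T, Matrix.mul_apply, Matrix.of_apply, mul_ite, mul_zero, Finset.sum_ite_eq',
      Finset.mem_univ, if_true, Matrix.smul_apply, smul_eq_mul, mul_assoc, ite_mul, zero_mul]
    split_ifs
    · rw [mul_comm (phase ω g h), phase_cocycle, mul_comm]
    · rfl
  refine ⟨n, fun g => ⟨(T g).submatrix f.symm f.symm, ?_⟩, Fin.pos (f 1), fun g h => ?_⟩
  · rw [Matrix.mem_unitaryGroup_iff', Matrix.star_eq_conjTranspose, Matrix.conjTranspose_submatrix,
      Matrix.submatrix_mul_equiv, hTu, Matrix.submatrix_one_equiv]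
  · change Matrix.submatrix _ _ _ * Matrix.submatrix _ _ _ = _ • Matrix.submatrix _ _ _
    rw [Matrix.submatrix_mul_equiv, hT, Matrix.submatrix_smul]
    rfl

/-- Every class of a finite group is realized by entangled bonds that carry the regular projective
representation. -/
theorem phaseClass_surjective [Finite G] :
    Function.Surjective (phaseClass : PurifiableMPDO G → H2 G) := fun x => by
  obtain ⟨ω, rfl⟩ := cohClass_surjective x
  obtain ⟨n, V, hn, hV⟩ := exists_regular ω
  have h := isGauge_bondTensor (e := finProdFinEquiv.symm) (j := 1) hV hn (by simp) (W := V)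
    fun g => by rw [Matrix.mul_one, Matrix.one_mul]
  refine ⟨h.node, (inPhase_iff h.node ω).1 (inPhase_pureMPO ?_)⟩
  exact ⟨fun g => Unitary.toUnits (V g), 1, ω, fun g i => congrFun (h.act_eq g) i, hV, rfl⟩

end Classification

end SPT

end

theorem mainTheorem2 (G : Type) [Group G] :
    (∀ ρ : SPT.MPO G, ρ.IsStrongInjectiveMPDO → ρ.StronglySymmetric → ∀ ω : SPT.Z2 G,
      List.TFAE [
        ρ.InPhase ω ∧ ρ.LocallyPurifiable,
        ∃ (e D : ℕ) (A : Fin ρ.d × Fin e → Matrix (Fin D) (Fin D) ℂ),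
          ρ.IsLocalPurification A ∧ SPT.IsPureSPT A (ρ.purifiedRep e) ω,
        ρ.LocallyPurifiable ∧
          ∀ (e D : ℕ) (A : Fin ρ.d × Fin e → Matrix (Fin D) (Fin D) ℂ),
            ρ.IsLocalPurification A → SPT.IsPureSPT A (ρ.purifiedRep e) ω,
        ρ.FromPureSPT ω]) ∧
    ∃ cls : Quotient (SPT.oneWaySetoid G) → SPT.H2 G,
      (∀ (ρ : SPT.PurifiableMPDO G) (ω : SPT.Z2 G),
        ρ.1.InPhase ω ↔ cls (Quotient.mk (SPT.oneWaySetoid G) ρ) = SPT.cohClass ω) ∧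
      Function.Injective cls ∧
      (Finite G → Function.Bijective cls) := by
  refine ⟨fun ρ hρ hs ω => ρ.tfae hρ hs ω, Quotient.lift SPT.phaseClass fun ρ ρ' h =>
    SPT.Related.phaseClass_eq h, SPT.inPhase_iff, ?_⟩
  have hinj : Function.Injective (Quotient.lift (s := SPT.oneWaySetoid G) SPT.phaseClass
      fun ρ ρ' h => SPT.Related.phaseClass_eq h) := by
    rintro ⟨ρ⟩ ⟨ρ'⟩ h
    exact Quotient.sound (SPT.related_of_phaseClass_eq h)
  refine ⟨hinj, fun _ => ⟨hinj, fun x => ?_⟩⟩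
  obtain ⟨ρ, hρ⟩ := SPT.phaseClass_surjective x
  exact ⟨Quotient.mk _ ρ, hρ⟩
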